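/- Let $\lambda_1,\lambda_2\in\mathbb{C}\setminus\{0,1\}$, let $E_n$ $(n=1,2)$ be the elliptic curve $y_n^2=x_n(x_n-1)(x_n-\lambda_n)$, and let $\mathcal{S}=\operatorname{Kum}(E_1\times E_2)$ be the Kummer surface, i.e. the complex K3 surface birational to the quotient of $E_1\times E_2$ by the inversion $-1$. Let $\mathcal{Y}$ be a complex surface with the Weierstrass equation $$Y^2=X^3+u^2\big((\lambda_1-1)(\lambda_2-1)(u+u^{-1})-2(\lambda_1+1)(\lambda_2+1)\big)X^2+16\lambda_1\lambda_2u^4X,$$ i.e. an integral complex variety whose function field is $\mathbb{C}(u,X,Y)$ with this relation (for instance the K3 surface with this equation), and put $\omega_{\mathcal Y}=du\wedge dX/Y$. Then the following hold. (1) $\mathcal{S}$ has a Weierstrass equation $$y^2=x^3+t^2\big((\lambda_1-1)(\lambda_2-1)(t^2+t^{-2})-2(\lambda_1+1)(\lambda_2+1)\big)x^2+16\lambda_1\lambda_2t^4x,\qquad \mathbb{C}(\mathcal S)=\mathbb{C}(t,x,y),$$ (the fibration $\mathcal J_1$), where $c\,t=y_2x_1/(y_1x_2)$ with a constant $c$ such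 that $c^2=(\lambda_2-1)/(\lambda_1-1)$, and a second Weierstrass equation $$\eta^2=\xi^3+(v^2-4)\big((\lambda_1-1)(\lambda_2-1)v-2(\lambda_1+1)(\lambda_2+1)\big)\xi^2+16\lambda_1\lambda_2(v^2-4)^2\xi,\qquad \mathbb{C}(\mathcal S)=\mathbb{C}(v,\xi,\eta),$$ such that $\omega_{\mathcal S}:=dt\wedge dx/y=dv\wedge d\xi/\eta$. The holomorphic two-forms on $\mathcal S$ are the multiples $a\,\omega_{\mathcal S}$, $a\in\mathbb{C}$; if $\mathcal Y$ is a K3 surface, then the holomorphic two-forms on $\mathcal Y$ are the multiples $a\,\omega_{\mathcal Y}$. (2) $\mathcal S$ has two commuting Nikulin involutions $\imath,\jmath$ (automorphisms of order two that leave all holomorphic two-forms invariant), given by $$\imath:(t,x,y)\mapsto(-t,x,-y),\qquad \jmath:(t,x,y)\mapsto\Big(\frac1t,\frac{x}{t^4},-\frac{y}{t^6}\Big).$$ (3) The quotient surface $\mathcal S/\langle\imath\rangle$ is birational to $\mathcal Y$, and the quotient surface $\mathcal S/\langle\imath,\jmath\rangle$ is birational to $\mathcal S$. (4) There are dominant rational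 maps of degree two $\psi:\mathcal S\dashrightarrow\mathcal Y$ and $\phi:\mathcal Y\dashrightarrow\mathcal S$, given by $$\psi:(t,x,y)\mapsto(u,X,Y)=(t^2,t^2x,t^3y),\qquad \phi:(u,X,Y)\mapsto(v,\xi,\eta)=\Big(u+u^{-1},\frac{(u^2-1)^2}{u^4}X,\frac{(u^2-1)^3}{u^6}Y\Big),$$ such that $\psi^*\mathbb{C}(\mathcal Y)$ is the field of $\imath$-invariant functions on $\mathcal S$, $\psi^*\phi^*\mathbb{C}(\mathcal S)$ is the field of functions on $\mathcal S$ invariant under $\imath$ and $\jmath$, and $$\psi^*\omega_{\mathcal Y}=2\,\omega_{\mathcal S},\qquad \phi^*\omega_{\mathcal S}=\omega_{\mathcal Y}.$$ -/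

import Mathlib

open CategoryTheory AlgebraicGeometry KaehlerDifferential TensorProduct

noncomputable section

namespace KummerSandwich

/-! ### Complex schemes and their function fields -/

/-- The spectrum of the complex numbers. -/
abbrev SpecC : Scheme.{0} := Spec (.of ℂ)

/-- A complex variety: an integral separated scheme of finite type over `ℂ`. -/
structure IsComplexVariety (X : Scheme.{0}) [X.Over SpecC] : Prop where
  isIntegral : IsIntegral X
  isSeparated : IsSeparated (X ↘ SpecC)
  locallyOfFiniteType : LocallyOfFiniteType (X ↘ SpecC)
  quasiCompact : QuasiCompact (X ↘ SpecC)

/-- The function field of a complex scheme is an extension of `ℂ`, through the structure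
morphism. -/
instance functionFieldAlgebra (X : Scheme.{0}) [X.Over SpecC] [IsIntegral X] :
    Algebra ℂ X.functionField :=
  ((Scheme.ΓSpecIso (.of ℂ)).inv ≫ (X ↘ SpecC).appTop ≫
    X.presheaf.germ ⊤ (genericPoint X) trivial).hom.toAlgebra

/-- `σ` is the homomorphism `f^* : ℂ(Y) → ℂ(X)` of function fields given by composition with the
dominant rational map `f : X ⤏ Y` over `ℂ`: on the generic point of `X`, the map `f` is
`Spec ℂ(X) ⟶ Spec ℂ(Y) ⟶ Y`. (Such a `σ` exists exactly if `f` is dominant and defined over `ℂ`,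
and is then unique.) -/
def IsComorphism {X Y : Scheme.{0}} [X.Over SpecC] [Y.Over SpecC] [IsIntegral X] [IsIntegral Y]
    (f : X ⤏ Y) (σ : Y.functionField →ₐ[ℂ] X.functionField) : Prop :=
  f.fromFunctionField =
    Spec.map (CommRingCat.ofHom σ.toRingHom) ≫ Y.fromSpecStalk (genericPoint Y)

/-- The degree `[ℂ(X) : f^* ℂ(Y)]` of a dominant rational map with comorphism `σ = f^*`
(`0` if it is infinite). -/
def degree {K L : Type} [Field K] [Field L] [Algebra ℂ K] [Algebra ℂ L] (σ : K →ₐ[ℂ] L) : ℕ :=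
  Module.finrank σ.fieldRange L

/-- The group of automorphisms of the `ℂ`-scheme `X`. -/
abbrev AutC (X : Scheme.{0}) [X.Over SpecC] : Type := Aut (X.asOver SpecC)

/-- The morphism of schemes underlying an automorphism over `ℂ`. -/
abbrev autHom {X : Scheme.{0}} [X.Over SpecC] (g : AutC X) : X ⟶ X := g.hom.left

/-! ### Two-forms -/

/-- Rational two-forms: the elements of `⋀² Ω_{K/ℂ}` for a function field `K`. -/
abbrev TwoForm (K : Type) [Field K] [Algebra ℂ K] : Type := ⋀[K]^2 (Ω[K⁄ℂ])

/-- The two-form `da ∧ db`. -/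
def wedge {K : Type} [Field K] [Algebra ℂ K] (a b : K) : TwoForm K :=
  exteriorPower.ιMulti K 2 ![D ℂ K a, D ℂ K b]

/-- The pullback of two-forms along `σ : K → L`, that is
`f da ∧ db ↦ σ f d(σ a) ∧ d(σ b)`. -/
def formPullback {K L : Type} [Field K] [Algebra ℂ K] [Field L] [Algebra ℂ L] (σ : K →ₐ[ℂ] L) :
    TwoForm K →+ TwoForm L :=
  letI : Algebra K L := σ.toRingHom.toAlgebra
  haveI : IsScalarTower ℂ K L := IsScalarTower.of_algebraMap_eq fun z => (σ.commutes z).symm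
  (exteriorPower.alternatingMapLinearEquiv (R := K) (n := 2) (M := Ω[K⁄ℂ]) (N := TwoForm L)
    { (((exteriorPower.ιMulti L 2 (M := Ω[L⁄ℂ])).toMultilinearMap.restrictScalars K).compLinearMap
        fun _ => KaehlerDifferential.map ℂ ℂ K L) with
      map_eq_zero_of_eq' := fun _ _ _ h hij =>
        (exteriorPower.ιMulti L 2 (M := Ω[L⁄ℂ])).map_eq_zero_of_eq _
          (congrArg (KaehlerDifferential.map ℂ ℂ K L) h) hij }).toAddMonoidHom

/-- The two-forms that are regular at `p`: the image of `⋀² Ω_{𝒪_p/ℂ}` in the rational two-forms,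
that is the sums of terms `f da ∧ db` with `f, a, b` in the local ring `𝒪_p` of `p`. -/
def localTwoForms (X : Scheme.{0}) [X.Over SpecC] [IsIntegral X] (p : X) :
    AddSubgroup (TwoForm X.functionField) :=
  AddSubgroup.closure {ω | ∃ f a b : X.presheaf.stalk p,
    ω = algebraMap _ X.functionField f •
      wedge (algebraMap _ X.functionField a) (algebraMap _ X.functionField b)}

/-- The global holomorphic two-forms `H⁰(X, Ω²)` on a smooth integral scheme over `ℂ`: the rational
two-forms that are regular at all points. -/
def holomorphicTwoForms (X : Scheme.{0}) [X.Over SpecC] [IsIntegral X] :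
    AddSubgroup (TwoForm X.functionField) :=
  ⨅ p : X, localTwoForms X p

/-! ### K3 surfaces, Nikulin involutions, quotients -/

/-- The structure sheaf as a sheaf of abelian groups. -/
def structureSheafAb (X : Scheme.{0}) : TopCat.Sheaf AddCommGrpCat.{0} X :=
  (sheafCompose _ (forget₂ CommRingCat RingCat ⋙ forget₂ RingCat AddCommGrpCat)).obj X.sheaf

/-- A complex algebraic K3 surface: a smooth proper (equivalently, projective) integral surface
with trivial canonical bundle and `H¹(X, 𝒪_X) = 0`. The canonical bundle is trivial if
some two-form generates the regular two-forms at every point. -/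
structure IsK3Surface (X : Scheme.{0}) [X.Over SpecC] [IsIntegral X] : Prop where
  isProper : IsProper (X ↘ SpecC)
  smooth : SmoothOfRelativeDimension 2 (X ↘ SpecC)
  canonical_trivial : ∃ ω : TwoForm X.functionField, ∀ p : X,
    (localTwoForms X p : Set (TwoForm X.functionField)) =
      Set.range fun f : X.presheaf.stalk p => algebraMap _ X.functionField f • ω
  h1_eq_zero : Subsingleton (Sheaf.H.{0} (structureSheafAb X) 1)

/-- A Nikulin involution of a K3 surface: an automorphism of order two that leaves every
holomorphic two-form invariant. -/
structure IsNikulinInvolution {X : Scheme.{0}} [X.Over SpecC] [IsIntegral X] (g : AutC X) :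
    Prop where
  ne_one : g ≠ 1
  mul_self : g * g = 1
  symplectic : ∃ σ : X.functionField →ₐ[ℂ] X.functionField,
    IsComorphism (autHom g).toRationalMap σ ∧
      ∀ ω ∈ holomorphicTwoForms X, formPullback σ ω = ω

/-- `q : X ⟶ Q` is the quotient of `X` by the (finite) group `G` of automorphisms: it is finite
and surjective, its fibres are the orbits of `G`, and the functions on an open subset of `Q` are
the `G`-invariant functions on its preimage. -/
structure IsQuotient {X Q : Scheme.{0}} [X.Over SpecC] [Q.Over SpecC] (G : Subgroup (AutC X))
    (q : X ⟶ Q) : Prop where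
  comp_structure : q ≫ (Q ↘ SpecC) = X ↘ SpecC
  isFinite : IsFinite q
  surjective : Function.Surjective q
  invariant : ∀ g ∈ G, autHom g ≫ q = q
  orbit : ∀ a b : X, q a = q b → ∃ g ∈ G, autHom g a = b
  injective : ∀ U : Q.Opens, Function.Injective (q.app U)
  invariants : ∀ (U : Q.Opens) (s : Γ(X, q ⁻¹ᵁ U)),
    (∀ g ∈ G, ∀ h : q ⁻¹ᵁ U ≤ autHom g ⁻¹ᵁ (q ⁻¹ᵁ U), (autHom g).appLE _ _ h s = s) →
      ∃ r : Γ(Q, U), q.app U r = s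

/-- The quotient surface of `X` by `G` is birational to `Y` over `ℂ`. -/
def QuotientBirationalTo (X Y : Scheme.{0}) [X.Over SpecC] [Y.Over SpecC]
    (G : Subgroup (AutC X)) : Prop :=
  ∀ (Q : Scheme.{0}) [Q.Over SpecC] (q : X ⟶ Q), IsComplexVariety Q → IsQuotient G q →
    Scheme.BirationalOver (Q ↘ SpecC) (Y ↘ SpecC)

/-! ### The Kummer surface of two Legendre curves -/

/-- The Legendre curve `y² = x (x - 1) (x - l)`. -/
abbrev legendre (l : ℂ) : WeierstrassCurve.Affine ℂ := ⟨0, -(1 + l), 0, l, 0⟩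

/-- The coordinate ring `ℂ[x, y]` of the affine Legendre curve. -/
abbrev LegendreRing (l : ℂ) : Type := (legendre l).CoordinateRing

/-- The coordinate function `x` of the Legendre curve. -/
def xE (l : ℂ) : LegendreRing l := WeierstrassCurve.Affine.CoordinateRing.mk _ (.C .X)

/-- The coordinate function `y` of the Legendre curve. -/
def yE (l : ℂ) : LegendreRing l := WeierstrassCurve.Affine.CoordinateRing.mk _ .X

lemma eval₂_legendre (l : ℂ) {T : Type} [CommRing T] (f : Polynomial ℂ →+* T) (z : T) :
    Polynomial.eval₂ f z (legendre l).polynomial =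
      z ^ 2 - f (.X ^ 3 + .C (-(1 + l)) * .X ^ 2 + .C l * .X) := by
  rw [WeierstrassCurve.Affine.polynomial, Polynomial.eval₂_sub, Polynomial.eval₂_add,
    Polynomial.eval₂_mul, Polynomial.eval₂_pow, Polynomial.eval₂_X, Polynomial.eval₂_C,
    Polynomial.eval₂_C]
  simp

lemma eval₂_neg_yE (l : ℂ) :
    Polynomial.eval₂ (Algebra.algHom ℂ (Polynomial ℂ) (LegendreRing l)).toRingHom (-yE l)
      (legendre l).polynomial = 0 := by
  refine (eval₂_legendre l _ _).trans ?_
  rw [neg_sq]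
  exact (eval₂_legendre l _ _).symm.trans (AdjoinRoot.eval₂_root (legendre l).polynomial)

/-- The inversion `(x, y) ↦ (x, -y)` of the Legendre curve, on functions. -/
def negE (l : ℂ) : LegendreRing l →ₐ[ℂ] LegendreRing l :=
  AdjoinRoot.liftAlgHom (legendre l).polynomial
    (Algebra.algHom ℂ (Polynomial ℂ) (LegendreRing l)) (-yE l) (eval₂_neg_yE l)

lemma negE_xE (l : ℂ) : negE l (xE l) = xE l :=
  AdjoinRoot.lift_of (eval₂_neg_yE l)

lemma negE_yE (l : ℂ) : negE l (yE l) = -yE l :=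
  AdjoinRoot.lift_root (eval₂_neg_yE l)

/-- The functions on (the affine part of) `E₁ × E₂` that are invariant under the inversion `-1`. -/
def kummerRing (l₁ l₂ : ℂ) : Subalgebra ℂ (LegendreRing l₁ ⊗[ℂ] LegendreRing l₂) :=
  AlgHom.equalizer (Algebra.TensorProduct.map (negE l₁) (negE l₂)) (AlgHom.id ℂ _)

/-- The quotient of (the affine part of) `E₁ × E₂` by the inversion `-1`. -/
def kummerQuotient (l₁ l₂ : ℂ) : Scheme.{0} := Spec (.of (kummerRing l₁ l₂))

instance kummerQuotientOver (l₁ l₂ : ℂ) : (kummerQuotient l₁ l₂).Over SpecC where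
  hom := Spec.map (CommRingCat.ofHom (algebraMap ℂ (kummerRing l₁ l₂)))

/-- The invariant function `x₁ y₁ y₂` on `E₁ × E₂`. -/
def kummerNum (l₁ l₂ : ℂ) : kummerRing l₁ l₂ :=
  ⟨(xE l₁ * yE l₁) ⊗ₜ yE l₂, by
    change Algebra.TensorProduct.map (negE l₁) (negE l₂) _ = _
    simp [negE_xE, negE_yE, TensorProduct.neg_tmul, TensorProduct.tmul_neg]⟩

/-- The invariant function `y₁² x₂` on `E₁ × E₂`. -/
def kummerDen (l₁ l₂ : ℂ) : kummerRing l₁ l₂ :=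
  ⟨(yE l₁ ^ 2) ⊗ₜ xE l₂, by
    change Algebra.TensorProduct.map (negE l₁) (negE l₂) _ = _
    simp [negE_xE, negE_yE]⟩

/-- The rational function on `S` that a function on `(E₁ × E₂)/±1` becomes under a birational map
`κ : S ⤏ (E₁ × E₂)/±1`. -/
def kummerFunction {l₁ l₂ : ℂ} {S : Scheme.{0}} [IsIntegral S]
    (κ : S.PartialIso (kummerQuotient l₁ l₂)) : kummerRing l₁ l₂ →+* S.functionField :=
  (Spec.preimage (R := .of (kummerRing l₁ l₂)) κ.toRationalMap.fromFunctionField).hom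

/-- The rational function `y₂ x₁ / (y₁ x₂) = x₁ y₁ y₂ / (y₁² x₂)` on the Kummer surface. -/
def kummerParameter {l₁ l₂ : ℂ} {S : Scheme.{0}} [IsIntegral S]
    (κ : S.PartialIso (kummerQuotient l₁ l₂)) : S.functionField :=
  kummerFunction κ (kummerNum l₁ l₂) / kummerFunction κ (kummerDen l₁ l₂)

/-! ### Weierstrass equations of elliptic surfaces -/

/-- `K = ℂ(t, x, y)` is the function field of the surface `y² = x³ + A x² + B x`, where `A` and `B`
are rational expressions in `t`: the functions `t, x` are independent variables, `y` satisfies the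
equation, and the three generate `K`. -/
structure IsWeierstrassSurface {K : Type} [Field K] [Algebra ℂ K] (t x y A B : K) : Prop where
  independent : AlgebraicIndependent ℂ ![t, x]
  equation : y ^ 2 = x ^ 3 + A * x ^ 2 + B * x
  generate : IntermediateField.adjoin ℂ {t, x, y} = ⊤

section Equations

variable {K : Type} [Field K] [Algebra ℂ K] (l₁ l₂ : ℂ)

/-- `(l₁ - 1) (l₂ - 1) s - 2 (l₁ + 1) (l₂ + 1)`. -/
def linearTerm (s : K) : K :=
  algebraMap ℂ K ((l₁ - 1) * (l₂ - 1)) * s - algebraMap ℂ K (2 * (l₁ + 1) * (l₂ + 1))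

/-- The fibration `𝒥₁`:
`y² = x³ + t² ((l₁-1)(l₂-1)(t² + t⁻²) - 2(l₁+1)(l₂+1)) x² + 16 l₁ l₂ t⁴ x`. -/
def IsJ1 (t x y : K) : Prop :=
  IsWeierstrassSurface t x y (t ^ 2 * linearTerm l₁ l₂ (t ^ 2 + (t ^ 2)⁻¹))
    (algebraMap ℂ K (16 * l₁ * l₂) * t ^ 4)

/-- The surface `𝒴`:
`Y² = X³ + u² ((l₁-1)(l₂-1)(u + u⁻¹) - 2(l₁+1)(l₂+1)) X² + 16 l₁ l₂ u⁴ X`. -/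
def IsB12 (u X Y : K) : Prop :=
  IsWeierstrassSurface u X Y (u ^ 2 * linearTerm l₁ l₂ (u + u⁻¹))
    (algebraMap ℂ K (16 * l₁ * l₂) * u ^ 4)

/-- The fibration `𝒥₇`:
`y² = x³ + (v²-4) ((l₁-1)(l₂-1) v - 2(l₁+1)(l₂+1)) x² + 16 l₁ l₂ (v²-4)² x`. -/
def IsJ7 (v x y : K) : Prop :=
  IsWeierstrassSurface v x y ((v ^ 2 - 4) * linearTerm l₁ l₂ v)
    (algebraMap ℂ K (16 * l₁ * l₂) * (v ^ 2 - 4) ^ 2)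

/-- The two-form `dt ∧ dx / y` of a Weierstrass equation. -/
def weierstrassForm (t x y : K) : TwoForm K := y⁻¹ • wedge t x

end Equations

end KummerSandwich

end

open KummerSandwich

noncomputable section

/-! Almost everything is a computation in function fields; two geometric facts about K3 surfaces
carry the result back to schemes.

Coordinates. The functions on `E₁ × E₂` invariant under `-1` are generated by `x₁`, `x₂` and `w =
y₁y₂`, so ℂ(S) = ℂ(x₁, x₂, w). With `k = x₂/x₁` and `ct = x₁y₂/(x₂y₁)` the equation for `w` becomes
a quadratic in `x₁` over ℂ(t, k). The derivative of this quadratic at its root `x₁` is a square root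
of the discriminant, which is a cubic in `k`; after rescaling, this is `𝒥₁` (`exists_isJ1`).
Substituting `x = q t²` and a new parameter `v` that is linear in `y/x` over ℂ(t) lowers the degree
in `t`, and the result is the second equation (`exists_isJ7`). Differentiating the relations and
wedging shows that both Weierstrass forms equal `-½ dx₁ ∧ dx₂ / w`.

Holomorphic forms. On a K3 surface every rational two-form is `g ω₀` for a canonical generator `ω₀`.
If the form is regular along all valuation rings of the function field, then `g` has no pole in
codimension one, so it lies in every local ring by normality, and it is constant by properness
(`mem_holomorphicTwoForms_iff`). This criterion does not depend on a model. For `dx₁ ∧ dx₂ / w` it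
is checked directly on a valuation ring (`inv_smul_wedge_mem_of_div_mem`), without resolving the
sixteen singular points. For `𝒴` it follows by pulling back along `φ`.

Involutions. `exists_forall_mem_localRing` replaces the theory of minimal models: an automorphism of
the function field that preserves `ω₀` is biregular. If it were undefined at a closed point,
Zariski's main theorem would give a curve that the inverse contracts to that point. Pullback of
two-forms under a contraction vanishes along the contracted curve, but `ω₀` is invariant and
vanishes nowhere.

Maps and quotients. `IsWeierstrassSurface.exists_algHom` turns each coordinate formula into a field
homomorphism: it suffices that the new coordinates are independent and satisfy the equation. Each of
`ψ^*` and `φ^*` is a quadratic extension generated by a square root (`t`, respectively `u - 1/u`)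
whose sign an involution changes, so its image is the fixed field
(`mem_range_iff_and_degree_eq_two`). The function field of a quotient is the field of invariants,
and varieties with isomorphic function fields are birational. -/

namespace KummerSandwich

/-! ### Commutative algebra -/

section CommAlg

/-- An element of the fraction field of a Noetherian normal domain `R` that is not in `R` is not in
`R_P` for some prime `P` such that `R_P` is a discrete valuation ring. -/
theorem exists_dvr_notMem {R K : Type*} [CommRing R] [IsDomain R] [IsNoetherianRing R]
    [IsIntegrallyClosed R] [Field K] [Algebra R K] [IsFractionRing R K] (h : K)
    (hh : h ∉ Set.range (algebraMap R K)) :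
    ∃ (P : Ideal R) (_ : P.IsPrime), P ≠ ⊥ ∧ (IsLocalRing.maximalIdeal (Localization.AtPrime P)).IsPrincipal ∧
      ∀ a b : R, b ∉ P → h * algebraMap R K b ≠ algebraMap R K a := by
  obtain ⟨a, b, hb, rfl⟩ := IsFractionRing.div_surjective (A := R) h
  have hb0 : b ≠ 0 := nonZeroDivisors.ne_zero hb
  have hbK : algebraMap R K b ≠ 0 := by simpa using hb0
  have hab : (Ideal.Quotient.mk (Ideal.span {b}) a) ≠ 0 := by
    rw [Ne, Ideal.Quotient.eq_zero_iff_mem, Ideal.mem_span_singleton']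
    rintro ⟨c, rfl⟩
    exact hh ⟨c, by simp [hbK]⟩
  -- `P` is an associated prime of `R/(b)` containing the annihilator of `a`. It is the annihilator
  -- of a class `c`, so `p ∈ P` exactly if `pc/b` lies in `R`; below, `s p` is this quotient.
  obtain ⟨P, hP, hle⟩ := exists_le_isAssociatedPrime_of_isNoetherianRing (R := R) _ hab
  obtain ⟨hPp, z, hz⟩ := Submodule.isAssociatedPrime_iff.mp hP
  obtain ⟨c, rfl⟩ := Ideal.Quotient.mk_surjective z
  have key (p : R) (d : R) : p ∈ (⊥ : Submodule R (R ⧸ Ideal.span {b})).colon {Ideal.Quotient.mk _ d} ↔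
      ∃ q, q * b = p * d := by
    rw [Submodule.mem_colon_singleton, Submodule.mem_bot, ← Ideal.mem_span_singleton',
      ← Ideal.Quotient.eq_zero_iff_mem, map_mul]
    rfl
  have hPmem (p : R) : p ∈ P ↔ ∃ q, q * b = p * c := by rw [← key, ← hz]
  have hbP : b ∈ P := (hPmem b).mpr ⟨c, mul_comm _ _⟩
  refine ⟨P, hPp, fun e => hb0 (by simpa [e] using hbP), ?_, ?_⟩
  · choose! s hs using fun p hp => (hPmem p).mp hp
    -- If multiplication by `c/b` maps `P` to itself, then `c/b` is integral, hence in `R`, and `1 ∈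
    -- P`. Otherwise `s p` is a unit at `P` for some `p ∈ P`, and `q = p · s q / s p` shows that `p`
    -- generates the maximal ideal.
    by_cases hall : ∀ p ∈ P, s p ∈ P
    · exfalso
      have hintg : IsIntegral R (algebraMap R K c / algebraMap R K b) := by
        refine isIntegral_of_smul_mem_submodule (A := K) (M := K)
          (Submodule.map (Algebra.linearMap R K) P) ?_ ?_ _ ?_
        · rw [Submodule.ne_bot_iff]
          exact ⟨_, ⟨b, hbP, rfl⟩, hbK⟩
        · exact Submodule.FG.map _ (IsNoetherian.noetherian _)
        · rintro _ ⟨p, hp, rfl⟩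
          refine ⟨s p, hall p hp, ?_⟩
          have := congr(algebraMap R K $(hs p hp))
          simp only [map_mul] at this
          simp only [Algebra.linearMap_apply, smul_eq_mul]
          rw [div_mul_eq_mul_div, eq_div_iff hbK, this, mul_comm]
      obtain ⟨y, hy⟩ := IsIntegrallyClosed.algebraMap_eq_of_integral hintg
      rw [eq_div_iff hbK, ← map_mul] at hy
      refine hPp.ne_top ((Ideal.eq_top_iff_one _).mpr ((hPmem 1).mpr ⟨y, ?_⟩))
      rw [one_mul]
      exact IsFractionRing.injective R K hy
    · push Not at hall
      obtain ⟨p, hp, hsp⟩ := hall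
      refine ⟨⟨algebraMap R _ p, ?_⟩⟩
      rw [← Localization.AtPrime.map_eq_maximalIdeal]
      refine le_antisymm (Ideal.map_le_iff_le_comap.mpr fun q hq => ?_) ?_
      · have h1 : q * s p = p * s q := by
          apply mul_right_cancel₀ hb0
          linear_combination q * hs p hp - p * hs q hq
        have hu : IsUnit (algebraMap R (Localization.AtPrime P) (s p)) :=
          IsLocalization.map_units (M := P.primeCompl) _ ⟨s p, hsp⟩
        rw [Ideal.mem_comap]
        refine (Ideal.mul_unit_mem_iff_mem _ hu).mp ?_
        rw [← map_mul, h1, map_mul]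
        exact Ideal.mul_mem_right _ _ (Ideal.subset_span rfl)
      · rw [Ideal.submodule_span_eq, Ideal.span_le, Set.singleton_subset_iff]
        exact Ideal.mem_map_of_mem _ hp
  · intro a' s hs e
    refine hs (hle ((key s a).mpr ⟨a', ?_⟩))
    rw [div_mul_eq_mul_div, div_eq_iff hbK, ← map_mul, ← map_mul] at e
    rw [← IsFractionRing.injective R K e, mul_comm]

/-- Zariski's main theorem for a subring `B` of the fraction field of a normal local domain `R`:
if `B` is of finite type over `R` and not `R`, then no fibre ring of dimension zero lies over the
closed point. -/
theorem eq_bot_or_exists_primes_lt {R K : Type*} [CommRing R] [IsDomain R] [IsLocalRing R]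
    [IsIntegrallyClosed R] [Field K] [Algebra R K] [IsFractionRing R K] (B : Subalgebra R K)
    (hB : B.FG) (P : Ideal B) [P.IsPrime] (hP : P.under R = IsLocalRing.maximalIdeal R) :
    B = ⊥ ∨ ∃ Q Q' : Ideal B, Q.IsPrime ∧ Q'.IsPrime ∧ Q < Q' ∧
      Q.under R = IsLocalRing.maximalIdeal R := by
  by_cases hdim : ∃ Q Q' : Ideal B, Q.IsPrime ∧ Q'.IsPrime ∧ Q < Q' ∧
      Q.under R = IsLocalRing.maximalIdeal R
  · exact Or.inr hdim
  left
  have hft : Algebra.FiniteType R B := B.fg_iff_finiteType.mp hB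
  -- Without such a chain the fibre over the closed point is Noetherian of dimension zero. Its
  -- spectrum is discrete, so `P` is isolated in its fibre.
  have hqf : Algebra.QuasiFiniteAt R P := by
    let q : PrimeSpectrum B := ⟨P, inferInstance⟩
    refine Algebra.QuasiFiniteAt.of_isOpen_singleton_fiber (R := R) q ?_
    let p := q.comap (algebraMap R B)
    have hp : p.asIdeal = IsLocalRing.maximalIdeal R := hP
    let e := PrimeSpectrum.preimageHomeomorphFiber R B p
    have hk : Ring.KrullDimLE 0 (p.asIdeal.Fiber B) := by
      refine Ring.KrullDimLE.mk₀ fun I hI => ?_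
      obtain ⟨M, hM, hIM⟩ := Ideal.exists_le_maximal I hI.ne_top
      rcases hIM.eq_or_lt with rfl | hlt
      · exact hM
      exfalso
      let o := PrimeSpectrum.preimageOrderIsoFiber R B p
      have h1 : o.symm ⟨I, hI⟩ < o.symm ⟨M, hM.isPrime⟩ := o.symm.strictMono hlt
      refine hdim ⟨_, _, (o.symm ⟨I, hI⟩).1.2, (o.symm ⟨M, hM.isPrime⟩).1.2, h1, ?_⟩
      rw [← hp]
      exact congr($((o.symm ⟨I, hI⟩).2).asIdeal)
    have : IsNoetherianRing (p.asIdeal.Fiber B) :=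
      Algebra.FiniteType.isNoetherianRing p.asIdeal.ResidueField _
    have : IsArtinianRing (p.asIdeal.Fiber B) :=
      isArtinianRing_iff_isNoetherianRing_krullDimLE_zero.mpr ⟨inferInstance, inferInstance⟩
    have : DiscreteTopology (PrimeSpectrum (p.asIdeal.Fiber B)) := inferInstance
    have : DiscreteTopology ↑(PrimeSpectrum.comap (algebraMap R B) ⁻¹' {p}) :=
      e.symm.discreteTopology
    exact isOpen_discrete _
  -- Here `r ∉ P` is integral, and every `b` becomes integral after multiplication by a power of
  -- `r`. Normality puts `r` and these products in `R`, where `r` is a unit because it is outside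
  -- the maximal ideal.
  obtain ⟨r, hrP, hr, hx⟩ := Algebra.zariskisMainProperty_iff.mp
    (Algebra.ZariskisMainProperty.of_finiteType (R := R) P)
  have hin (b : B) (hb : IsIntegral R b) : ∃ a : R, algebraMap R B a = b := by
    obtain ⟨a, ha⟩ := IsIntegrallyClosed.algebraMap_eq_of_integral (K := K)
      (hb.map B.val)
    exact ⟨a, Subtype.ext ha⟩
  obtain ⟨a, rfl⟩ := hin r hr
  have hu : IsUnit a := by
    by_contra hu
    have : a ∈ P.under R := hP ▸ (IsLocalRing.mem_maximalIdeal a).mpr hu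
    exact hrP this
  rw [eq_bot_iff]
  intro b hb
  obtain ⟨k, hk⟩ := hx ⟨b, hb⟩
  obtain ⟨d, hd⟩ := hin _ hk
  obtain ⟨u, rfl⟩ := hu
  rw [Algebra.mem_bot]
  refine ⟨(↑(u⁻¹) : R) ^ k * d, ?_⟩
  have h2 : (⟨b, hb⟩ : B) = algebraMap R B (↑(u⁻¹) ^ k * d) := by
    rw [map_mul, hd, ← mul_assoc, ← map_pow, ← map_mul, ← mul_pow, Units.inv_mul, one_pow, map_one,
      one_mul]
  exact congr(($h2).1).symm

/-- In a domain of finite type over a field whose fraction field has transcendence degree at most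
two, chains of primes have length at most two. -/
theorem eq_bot_of_prime_chain {k A K : Type} [Field k] [CommRing A] [IsDomain A] [Algebra k A]
    [Algebra.FiniteType k A] [Field K] [Algebra k K] [Algebra A K] [IsScalarTower k A K]
    [FaithfulSMul A K]
    (htr : Algebra.trdeg k K ≤ 2) {P Q M : Ideal A} [P.IsPrime] [Q.IsPrime] [M.IsPrime]
    (h1 : P < Q) (h2 : Q < M) : P = ⊥ := by
  by_contra h0
  -- Noether normalization: by incomparability the chain `0 < P < Q < M` contracts to a strict chain
  -- of length three in a polynomial ring in `s ≤ 2` variables.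
  obtain ⟨s, g, hg, hintg⟩ := exists_integral_inj_algHom_of_fg k A
  have hs : s ≤ 2 := by
    have hinj : Function.Injective ((IsScalarTower.toAlgHom k A K).comp g) :=
      (FaithfulSMul.algebraMap_injective A K).comp hg
    have := lift_trdeg_le_of_injective _ hinj
    rw [MvPolynomial.trdeg_of_isDomain] at this
    simp only [Cardinal.mk_fintype, Fintype.card_fin, Cardinal.lift_id] at this
    exact_mod_cast this.trans htr
  algebraize [g.toRingHom]
  have hdim := MvPolynomial.ringKrullDim_of_isNoetherianRing (R := k) (ι := Fin s)
  have hI : Algebra.IsIntegral (MvPolynomial (Fin s) k) A := ⟨hintg⟩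
  let f (I : PrimeSpectrum A) : PrimeSpectrum (MvPolynomial (Fin s) k) := I.comap (algebraMap _ A)
  have hf {I J : PrimeSpectrum A} (h : I < J) : f I < f J :=
    Ideal.IsIntegral.comap_lt_comap (I := I.1) (J := J.1) h
  let l : LTSeries (PrimeSpectrum (MvPolynomial (Fin s) k)) :=
    { length := 3
      toFun := ![f ⊥, f ⟨P, inferInstance⟩, f ⟨Q, inferInstance⟩, f ⟨M, inferInstance⟩]
      step := fun i => by
        fin_cases i
        · exact hf (bot_lt_iff_ne_bot.mpr fun h => h0 congr(($h).asIdeal))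
        · exact hf h1
        · exact hf h2 }
  have h3 : ((3 : ℕ) : WithBot ℕ∞) ≤ ringKrullDim (MvPolynomial (Fin s) k) := Order.LTSeries.length_le_krullDim l
  rw [hdim, ringKrullDim_eq_zero_of_field] at h3
  have : (3:ℕ) ≤ s := by
    simp only [Nat.card_eq_fintype_card, Fintype.card_fin, zero_add] at h3
    exact_mod_cast h3
  omega

end CommAlg

/-! ### Two-forms on a field -/

section Forms

variable {K L : Type} [Field K] [Algebra ℂ K] [Field L] [Algebra ℂ L]

/-- The exterior product of one-forms as a bilinear map. -/
def wedgeB : Ω[K⁄ℂ] →ₗ[K] Ω[K⁄ℂ] →ₗ[K] TwoForm K :=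
  LinearMap.mk₂ K (fun α β => exteriorPower.ιMulti K 2 ![α, β])
    (fun a b c => by
      convert (exteriorPower.ιMulti K 2 (M := Ω[K⁄ℂ])).map_update_add ![a, c] 0 a b using 3 <;>
        (funext i; fin_cases i <;> rfl))
    (fun r a c => by
      convert (exteriorPower.ιMulti K 2 (M := Ω[K⁄ℂ])).map_update_smul ![a, c] 0 r a using 3 <;>
        (funext i; fin_cases i <;> rfl))
    (fun a b c => by
      convert (exteriorPower.ιMulti K 2 (M := Ω[K⁄ℂ])).map_update_add ![a, c] 1 b c using 3 <;>
        (funext i; fin_cases i <;> rfl))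
    (fun r a c => by
      convert (exteriorPower.ιMulti K 2 (M := Ω[K⁄ℂ])).map_update_smul ![a, c] 1 r c using 3 <;>
        (funext i; fin_cases i <;> rfl))

lemma wedge_eq (a b : K) : wedge a b = wedgeB (D ℂ K a) (D ℂ K b) := rfl

@[simp]
lemma wedgeB_self (α : Ω[K⁄ℂ]) : wedgeB α α = 0 :=
  (exteriorPower.ιMulti K 2 (M := Ω[K⁄ℂ])).map_eq_zero_of_eq ![α, α] (i := 0) (j := 1) rfl
    (by decide)

lemma wedgeB_swap (α β : Ω[K⁄ℂ]) : wedgeB α β = -wedgeB β α := by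
  have h := wedgeB_self (α + β)
  simp only [map_add, LinearMap.add_apply, wedgeB_self, zero_add, add_zero] at h
  exact eq_neg_of_add_eq_zero_right h

/-- The two-forms `∑ f da ∧ db` with `f, a, b` in a subring. -/
def formsOf (R : Subalgebra ℂ K) : AddSubgroup (TwoForm K) :=
  AddSubgroup.closure {ω | ∃ f ∈ R, ∃ a ∈ R, ∃ b ∈ R, ω = f • wedge a b}

lemma smul_wedge_mem_formsOf {R : Subalgebra ℂ K} {f a b : K} (hf : f ∈ R) (ha : a ∈ R)
    (hb : b ∈ R) : f • wedge a b ∈ formsOf R :=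
  AddSubgroup.subset_closure ⟨f, hf, a, ha, b, hb, rfl⟩

lemma smul_mem_formsOf {R : Subalgebra ℂ K} {f : K} (hf : f ∈ R) {ω : TwoForm K}
    (hω : ω ∈ formsOf R) : f • ω ∈ formsOf R := by
  induction hω using AddSubgroup.closure_induction with
  | mem x hx =>
    obtain ⟨g, hg, a, ha, b, hb, rfl⟩ := hx
    rw [smul_smul]
    exact smul_wedge_mem_formsOf (mul_mem hf hg) ha hb
  | zero => simp
  | add x y _ _ hx hy => rw [smul_add]; exact add_mem hx hy
  | neg x _ hx => rw [smul_neg]; exact neg_mem hx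

lemma formPullback_smul_wedge (σ : K →ₐ[ℂ] L) (f a b : K) :
    formPullback σ (f • wedge a b) = σ f • wedge (σ a) (σ b) := by
  let _ : Algebra K L := σ.toRingHom.toAlgebra
  have : IsScalarTower ℂ K L := IsScalarTower.of_algebraMap_eq fun z => (σ.commutes z).symm
  change (exteriorPower.alternatingMapLinearEquiv (R := K) (n := 2) (M := Ω[K⁄ℂ]) (N := TwoForm L) _)
    (f • wedge a b) = _
  rw [map_smul, wedge, exteriorPower.alternatingMapLinearEquiv_apply_ιMulti]
  rw [← algebraMap_smul L f]
  congr 1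
  change exteriorPower.ιMulti L 2 (fun i => KaehlerDifferential.map ℂ ℂ K L (![D ℂ K a, D ℂ K b] i)) = _
  rw [wedge]
  congr 1
  funext i
  fin_cases i
  · exact KaehlerDifferential.map_D ℂ ℂ K L a
  · exact KaehlerDifferential.map_D ℂ ℂ K L b

lemma formPullback_smul (σ : K →ₐ[ℂ] L) (f : K) (ω : TwoForm K) :
    formPullback σ (f • ω) = σ f • formPullback σ ω := by
  let _ : Algebra K L := σ.toRingHom.toAlgebra
  have : IsScalarTower ℂ K L := IsScalarTower.of_algebraMap_eq fun z => (σ.commutes z).symm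
  change (exteriorPower.alternatingMapLinearEquiv (R := K) (n := 2) (M := Ω[K⁄ℂ]) (N := TwoForm L) _)
    (f • ω) = _
  rw [map_smul, ← algebraMap_smul L f]
  rfl

lemma formPullback_mem_formsOf (σ : K →ₐ[ℂ] L) {R : Subalgebra ℂ K} {R' : Subalgebra ℂ L}
    (h : ∀ a ∈ R, σ a ∈ R') {ω : TwoForm K} (hω : ω ∈ formsOf R) :
    formPullback σ ω ∈ formsOf R' := by
  induction hω using AddSubgroup.closure_induction with
  | mem x hx =>
    obtain ⟨f, hf, a, ha, b, hb, rfl⟩ := hx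
    rw [formPullback_smul_wedge]
    exact smul_wedge_mem_formsOf (h f hf) (h a ha) (h b hb)
  | zero => simp
  | add x y _ _ hx hy => rw [map_add]; exact add_mem hx hy
  | neg x _ hx => rw [map_neg]; exact neg_mem hx

/-- The differentials of a separating transcendence basis with two elements form a basis. -/
lemma exists_basis_D {t x : K} (h : AlgebraicIndependent ℂ ![t, x])
    (halg : Algebra.IsAlgebraic (IntermediateField.adjoin ℂ {t, x}) K) :
    ∃ b : Module.Basis (Fin 2) K Ω[K⁄ℂ], b 0 = D ℂ K t ∧ b 1 = D ℂ K x := by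
  -- `K` is formally étale over ℂ[t, x], being algebraic in characteristic zero over a localization
  -- of it. Hence the differentials of `K` are the base change of those of ℂ[t, x].
  let A := MvPolynomial (Fin 2) ℂ
  let _ : Algebra A K := (MvPolynomial.aeval ![t, x]).toRingHom.toAlgebra
  have : IsScalarTower ℂ A K := IsScalarTower.of_algebraMap_eq fun z =>
    ((MvPolynomial.aeval ![t, x]).commutes z).symm
  have : FaithfulSMul A K := (faithfulSMul_iff_algebraMap_injective _ _).mpr h
  let _ : Algebra (FractionRing A) K := FractionRing.liftAlgebra A K
  have : IsScalarTower A (FractionRing A) K := FractionRing.isScalarTower_liftAlgebra A K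
  have : IsScalarTower ℂ (FractionRing A) K := .to₁₃₄ ℂ A (FractionRing A) K
  have ht : algebraMap A K (.X 0) = t := by
    change MvPolynomial.aeval ![t, x] _ = _; simp
  have hx : algebraMap A K (.X 1) = x := by
    change MvPolynomial.aeval ![t, x] _ = _; simp
  have halg' : Algebra.IsAlgebraic (FractionRing A) K := by
    let F : IntermediateField ℂ K := (IsScalarTower.toAlgHom ℂ (FractionRing A) K).fieldRange
    have hle : IntermediateField.adjoin ℂ {t, x} ≤ F := by
      rw [IntermediateField.adjoin_le_iff]
      rintro z (rfl | rfl)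
      · exact ⟨algebraMap A _ (.X 0), by
          change algebraMap _ K _ = _
          rw [← IsScalarTower.algebraMap_apply, ht]⟩
      · exact ⟨algebraMap A _ (.X 1), by
          change algebraMap _ K _ = _
          rw [← IsScalarTower.algebraMap_apply, hx]⟩
    refine ⟨fun z => ?_⟩
    have hz := halg.isAlgebraic z
    have hzF : IsAlgebraic F z := by
      let _ : Algebra (IntermediateField.adjoin ℂ {t, x}) F := (IntermediateField.inclusion hle).toAlgebra
      have : IsScalarTower (IntermediateField.adjoin ℂ {t, x}) F K := .of_algebraMap_eq fun _ => rfl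
      exact hz.tower_top F
    obtain ⟨p, hp0, hp⟩ := hzF
    let e : FractionRing A ≃+* F := RingEquiv.ofBijective
      (IsScalarTower.toAlgHom ℂ (FractionRing A) K).rangeRestrict.toRingHom
      ⟨fun a b hab => (algebraMap (FractionRing A) K).injective congr(($hab).1),
        (IsScalarTower.toAlgHom ℂ (FractionRing A) K).rangeRestrict_surjective⟩
    refine ⟨p.map e.symm.toRingHom, ?_, ?_⟩
    · exact (Polynomial.map_ne_zero_iff e.symm.injective).mpr hp0
    · have he : (algebraMap (FractionRing A) K).comp e.symm.toRingHom = algebraMap F K := by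
        refine RingHom.ext fun c => ?_
        change algebraMap (FractionRing A) K (e.symm c) = c
        obtain ⟨d, rfl⟩ := e.surjective c
        rw [RingEquiv.symm_apply_apply]
        rfl
      rw [Polynomial.aeval_def, Polynomial.eval₂_map]
      exact (congr(Polynomial.eval₂ $he z p)).trans hp
  have : CharZero (FractionRing A) := charZero_of_injective_algebraMap (algebraMap ℂ (FractionRing A)).injective
  have : Algebra.IsSeparable (FractionRing A) K := inferInstance
  have : Algebra.FormallyEtale (FractionRing A) K := Algebra.FormallyEtale.of_isSeparable _ K
  have : Algebra.FormallyEtale A (FractionRing A) :=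
    Algebra.FormallyEtale.of_isLocalization (nonZeroDivisors A)
  have : Algebra.FormallyEtale A K := .comp A (FractionRing A) K
  let b : Module.Basis (Fin 2) K Ω[K⁄ℂ] :=
    ((mvPolynomialBasis ℂ (Fin 2)).baseChange K).map (tensorKaehlerEquivOfFormallyEtale ℂ A K)
  have hb (i : Fin 2) : b i = D ℂ K (algebraMap A K (.X i)) := by
    simp only [b, Module.Basis.map_apply, Module.Basis.baseChange_apply, mvPolynomialBasis_apply]
    rw [← tensorKaehlerEquivOfFormallyEtale_symm_D_algebraMap, LinearEquiv.apply_symm_apply]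
  exact ⟨b, by rw [hb, ht], by rw [hb, hx]⟩

/-- The determinant with respect to the basis `dt, dx` is an alternating form with value `1` on this
pair. -/
lemma wedge_ne_zero {t x : K} (h : AlgebraicIndependent ℂ ![t, x])
    (halg : Algebra.IsAlgebraic (IntermediateField.adjoin ℂ {t, x}) K) : wedge t x ≠ 0 := by
  obtain ⟨b, h0, h1⟩ := exists_basis_D h halg
  intro hz
  have h2 : exteriorPower.alternatingMapLinearEquiv b.det (wedge t x) = 1 := by
    rw [wedge, exteriorPower.alternatingMapLinearEquiv_apply_ιMulti, ← h0, ← h1]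
    convert b.det_self using 2
    funext i
    fin_cases i <;> rfl
  rw [hz, map_zero] at h2
  exact zero_ne_one h2

lemma D_div (a b : K) (hb : b ≠ 0) :
    D ℂ K (a / b) = b⁻¹ • D ℂ K a - (a / b ^ 2) • D ℂ K b := by
  have h : a = (a / b) * b := by field_simp
  have h2 := congr(D ℂ K $h)
  rw [Derivation.leibniz] at h2
  rw [h2, smul_add, smul_smul, smul_smul, inv_mul_cancel₀ hb, one_smul,
    show b⁻¹ * (a / b) = a / b ^ 2 by field_simp]
  abel

/-- If `K` is the fraction field of `R` and the two-forms of `R` are multiples of `ω`, then so are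
all two-forms of the form `da ∧ db`. -/
lemma wedge_mem_span_of_frac {R : Subalgebra ℂ K} {ω : TwoForm K}
    (hK : ∀ z : K, ∃ a ∈ R, ∃ b ∈ R, b ≠ 0 ∧ z = a / b)
    (hω : ∀ a ∈ R, ∀ b ∈ R, wedge a b ∈ Submodule.span K {ω}) (t x : K) :
    wedge t x ∈ Submodule.span K {ω} := by
  obtain ⟨a, ha, b, hb, hb0, rfl⟩ := hK t
  obtain ⟨c, hc, d, hd, hd0, rfl⟩ := hK x
  rw [wedge_eq, D_div _ _ hb0, D_div _ _ hd0]
  simp only [map_sub, map_smul, LinearMap.sub_apply, LinearMap.smul_apply, ← wedge_eq]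
  exact sub_mem (Submodule.smul_mem _ _ (sub_mem (Submodule.smul_mem _ _ (hω _ ha _ hc))
    (Submodule.smul_mem _ _ (hω _ hb _ hc))))
    (Submodule.smul_mem _ _ (sub_mem (Submodule.smul_mem _ _ (hω _ ha _ hd))
    (Submodule.smul_mem _ _ (hω _ hb _ hd))))

end Forms

/-! ### Local rings inside the function field -/

/-- The localization of a subring of a field at a prime ideal, inside the field. -/
def atPrime {K : Type} [Field K] [Algebra ℂ K] (A : Subalgebra ℂ K) (P : Ideal A) [P.IsPrime] :
    Subalgebra ℂ K where
  carrier := {z | ∃ a b : A, b ∉ P ∧ z * b = a}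
  mul_mem' := by
    rintro z w ⟨a, b, hb, h⟩ ⟨a', b', hb', h'⟩
    refine ⟨a * a', b * b', fun hm => (Ideal.IsPrime.mem_or_mem ‹_› hm).elim hb hb', ?_⟩
    push_cast
    rw [← h, ← h']
    ring
  add_mem' := by
    rintro z w ⟨a, b, hb, h⟩ ⟨a', b', hb', h'⟩
    refine ⟨a * b' + a' * b, b * b', fun hm => (Ideal.IsPrime.mem_or_mem ‹_› hm).elim hb hb', ?_⟩
    push_cast
    rw [← h, ← h']
    ring
  algebraMap_mem' z := ⟨algebraMap ℂ A z, 1, fun h => Ideal.IsPrime.ne_top ‹_›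
    ((Ideal.eq_top_iff_one P).mpr h), by simp⟩

lemma mem_atPrime {K : Type} [Field K] [Algebra ℂ K] {A : Subalgebra ℂ K} {P : Ideal A}
    [P.IsPrime] {z : K} : z ∈ atPrime A P ↔ ∃ a b : A, b ∉ P ∧ z * b = a := Iff.rfl

lemma le_atPrime {K : Type} [Field K] [Algebra ℂ K] (A : Subalgebra ℂ K) (P : Ideal A)
    [P.IsPrime] : A ≤ atPrime A P := fun z hz =>
  ⟨⟨z, hz⟩, 1, fun h => Ideal.IsPrime.ne_top ‹_› ((Ideal.eq_top_iff_one P).mpr h), by simp⟩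

section

variable (X : Scheme.{0}) [X.Over SpecC]

/-- The constants, as functions on an open subset. -/
def scalarSection (U : X.Opens) : ℂ →+* Γ(X, U) :=
  ((Scheme.ΓSpecIso (.of ℂ)).inv ≫ (X ↘ SpecC).appTop ≫
    X.presheaf.map (homOfLE le_top : U ⟶ ⊤).op).hom

variable [IsIntegral X]

lemma germ_scalarSection (U : X.Opens) (h : genericPoint X ∈ U) (z : ℂ) :
    X.presheaf.germ U (genericPoint X) h (scalarSection X U z) =
      algebraMap ℂ X.functionField z := by
  have : ((Scheme.ΓSpecIso (.of ℂ)).inv ≫ (X ↘ SpecC).appTop ≫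
    X.presheaf.map (homOfLE le_top : U ⟶ ⊤).op) ≫ X.presheaf.germ U (genericPoint X) h = 
    (Scheme.ΓSpecIso (.of ℂ)).inv ≫ (X ↘ SpecC).appTop ≫
    X.presheaf.germ ⊤ (genericPoint X) trivial := by
    simp only [Category.assoc, TopCat.Presheaf.germ_res]
  exact congr($(this).hom z)

/-- The local ring of a point as a subring of the function field. -/
def localRing (p : X) : Subalgebra ℂ X.functionField where
  toSubsemiring := (algebraMap (X.presheaf.stalk p) X.functionField).rangeS
  algebraMap_mem' z := by
    refine ⟨X.presheaf.germ ⊤ p trivial (scalarSection X ⊤ z), ?_⟩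
    rw [← germ_scalarSection X ⊤ trivial z]
    have : Nonempty (⊤ : X.Opens) := ⟨⟨p, trivial⟩⟩
    exact X.algebraMap_germ_eq_germToFunctionField (U := ⊤) (x := p) trivial _

/-- The regular functions on an open subset as a subring of the function field. -/
def regularRing (U : X.Opens) [Nonempty U] : Subalgebra ℂ X.functionField where
  toSubsemiring := (X.germToFunctionField U).hom.rangeS
  algebraMap_mem' z := ⟨scalarSection X U z, germ_scalarSection X U _ z⟩

variable {X}

lemma mem_localRing {p : X} {z : X.functionField} :
    z ∈ localRing X p ↔ ∃ s, algebraMap (X.presheaf.stalk p) X.functionField s = z := Iff.rfl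

lemma mem_regularRing {U : X.Opens} [Nonempty U] {z : X.functionField} :
    z ∈ regularRing X U ↔ ∃ s, X.germToFunctionField U s = z := Iff.rfl

lemma localTwoForms_eq (p : X) : localTwoForms X p = formsOf (localRing X p) := by
  unfold localTwoForms formsOf
  congr 1
  ext ω
  constructor
  · rintro ⟨f, a, b, rfl⟩
    exact ⟨_, ⟨f, rfl⟩, _, ⟨a, rfl⟩, _, ⟨b, rfl⟩, rfl⟩
  · rintro ⟨_, ⟨f, rfl⟩, _, ⟨a, rfl⟩, _, ⟨b, rfl⟩, rfl⟩
    exact ⟨f, a, b, rfl⟩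

/-- The stalk at a point is isomorphic to the local ring in the function field. -/
def stalkEquiv (p : X) : X.presheaf.stalk p ≃+* localRing X p :=
  RingEquiv.ofBijective ((algebraMap (X.presheaf.stalk p) X.functionField).codRestrict
    (localRing X p).toSubring fun s => ⟨s, rfl⟩)
    ⟨fun _ _ h => IsFractionRing.injective (X.presheaf.stalk p) X.functionField
      congr(($h : X.functionField)), fun ⟨_, s, hs⟩ => ⟨s, Subtype.ext hs⟩⟩

lemma coe_stalkEquiv (p : X) (s : X.presheaf.stalk p) :
    (stalkEquiv p s : X.functionField) = algebraMap _ _ s := rfl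

/-- The sections over an open subset are isomorphic to the regular functions in the function
field. -/
def sectionEquiv (U : X.Opens) [Nonempty U] : Γ(X, U) ≃+* regularRing X U :=
  RingEquiv.ofBijective ((X.germToFunctionField U).hom.codRestrict
    (regularRing X U).toSubring fun s => ⟨s, rfl⟩)
    ⟨fun _ _ h => X.germToFunctionField_injective U
      congr(($h : X.functionField)), fun ⟨_, s, hs⟩ => ⟨s, Subtype.ext hs⟩⟩

lemma coe_sectionEquiv (U : X.Opens) [Nonempty U] (s : Γ(X, U)) :
    (sectionEquiv U s : X.functionField) = X.germToFunctionField U s := rfl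

lemma regularRing_fg [LocallyOfFiniteType (X ↘ SpecC)] {U : X.Opens} [Nonempty U]
    (hU : IsAffineOpen U) : (regularRing X U).FG := by
  have h1 : (scalarSection X U).FiniteType := by
    have h := LocallyOfFiniteType.finiteType_appLE (X ↘ SpecC) (isAffineOpen_top SpecC) hU
      (show U ≤ (X ↘ SpecC) ⁻¹ᵁ ⊤ from le_top)
    have h2 : scalarSection X U =
        ((X ↘ SpecC).appLE ⊤ U le_top).hom.comp (Scheme.ΓSpecIso (.of ℂ)).inv.hom := rfl
    rw [h2]
    refine h.comp (RingHom.FiniteType.of_surjective _ ?_)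
    exact (Scheme.ΓSpecIso (.of ℂ)).symm.commRingCatIsoToRingEquiv.surjective
  let _ : Algebra ℂ Γ(X, U) := (scalarSection X U).toAlgebra
  have h2 : Algebra.FiniteType ℂ Γ(X, U) := h1
  let g : Γ(X, U) →ₐ[ℂ] X.functionField :=
    { (X.germToFunctionField U).hom with
      commutes' := fun z => germ_scalarSection X U _ z }
  have h3 : regularRing X U = (⊤ : Subalgebra ℂ Γ(X, U)).map g := by
    ext z
    simp only [mem_regularRing, Subalgebra.mem_map]
    exact ⟨fun ⟨s, hs⟩ => ⟨s, trivial, hs⟩, fun ⟨s, _, hs⟩ => ⟨s, hs⟩⟩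
  rw [h3]
  exact h2.out.map g

/-- Stalks at different points are different types. As subrings of the function field they can be
compared with each other and with valuation rings. -/
lemma localRing_eq_atPrime {U : X.Opens} [Nonempty U] (hU : IsAffineOpen U) (p : X) (hp : p ∈ U)
    (P : Ideal (regularRing X U)) [P.IsPrime]
    (hP : (hU.primeIdealOf ⟨p, hp⟩).asIdeal = P.comap (sectionEquiv U)) :
    localRing X p = atPrime (regularRing X U) P := by
  let x : U := ⟨p, hp⟩
  let _ : Algebra Γ(X, U) (X.presheaf.stalk p) := (X.presheaf.germ U p hp).hom.toAlgebra
  have : IsLocalization.AtPrime (X.presheaf.stalk p) (hU.primeIdealOf x).asIdeal :=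
    hU.isLocalization_stalk x
  ext z
  rw [mem_localRing, mem_atPrime]
  constructor
  · rintro ⟨s, rfl⟩
    obtain ⟨a, ⟨b, hb⟩, h⟩ := IsLocalization.exists_mk'_eq (hU.primeIdealOf x).asIdeal.primeCompl s
    refine ⟨sectionEquiv U a, sectionEquiv U b, fun hm => hb ?_, ?_⟩
    · rw [hP]; exact hm
    · rw [coe_sectionEquiv, coe_sectionEquiv, ← X.algebraMap_germ_eq_germToFunctionField hp,
        ← X.algebraMap_germ_eq_germToFunctionField hp, ← map_mul]
      congr 1
      rw [← h]
      exact IsLocalization.mk'_spec _ a ⟨b, hb⟩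
  · rintro ⟨a, b, hb, h⟩
    obtain ⟨a, rfl⟩ := (sectionEquiv U).surjective a
    obtain ⟨b, rfl⟩ := (sectionEquiv U).surjective b
    have hb' : b ∈ (hU.primeIdealOf x).asIdeal.primeCompl := by
      intro hm
      rw [SetLike.mem_coe, hP] at hm
      exact hb hm
    refine ⟨IsLocalization.mk' (X.presheaf.stalk p) a ⟨b, hb'⟩, ?_⟩
    have h3 := congr(algebraMap _ X.functionField
      $(IsLocalization.mk'_spec (X.presheaf.stalk p) a ⟨b, hb'⟩))
    have h4 : algebraMap (X.presheaf.stalk p) X.functionField (X.presheaf.germ U p hp b) ≠ 0 := by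
      rw [X.algebraMap_germ_eq_germToFunctionField hp, ← coe_sectionEquiv]
      intro h0
      refine hb ?_
      rw [show sectionEquiv U b = 0 from Subtype.ext h0]
      exact P.zero_mem
    refine mul_right_cancel₀ h4 ?_
    rw [← map_mul]
    refine h3.trans ?_
    refine (X.algebraMap_germ_eq_germToFunctionField hp a).trans ?_
    rw [X.algebraMap_germ_eq_germToFunctionField hp]
    exact h.symm

/-- Every prime ideal of an affine open subset is a point. -/
lemma exists_localRing_eq {U : X.Opens} [Nonempty U] (hU : IsAffineOpen U)
    (P : Ideal (regularRing X U)) [P.IsPrime] :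
    ∃ p ∈ U, localRing X p = atPrime (regularRing X U) P := by
  let y : PrimeSpectrum Γ(X, U) := ⟨P.comap (sectionEquiv U), inferInstance⟩
  have hy : hU.fromSpec y ∈ U := by
    rw [← SetLike.mem_coe, ← hU.range_fromSpec]
    exact ⟨y, rfl⟩
  refine ⟨hU.fromSpec y, hy, localRing_eq_atPrime hU _ hy P ?_⟩
  have h : hU.primeIdealOf ⟨hU.fromSpec y, hy⟩ = y :=
    hU.fromSpec.isOpenEmbedding.injective (hU.fromSpec_primeIdealOf _)
  rw [h]

/-- Every point of an affine open subset is a prime ideal. -/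
lemma exists_prime_localRing_eq {U : X.Opens} [Nonempty U] (hU : IsAffineOpen U) (p : X)
    (hp : p ∈ U) : ∃ (P : Ideal (regularRing X U)) (_ : P.IsPrime),
      localRing X p = atPrime (regularRing X U) P ∧ (IsClosed {p} → P.IsMaximal) := by
  refine ⟨(hU.primeIdealOf ⟨p, hp⟩).asIdeal.comap (sectionEquiv U).symm, inferInstance,
    localRing_eq_atPrime hU p hp _ ?_, fun hc => ?_⟩
  · ext z
    simp [Ideal.mem_comap]
  · have := hU.primeIdealOf_isMaximal_of_isClosed ⟨p, hp⟩ hc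
    exact Ideal.comap_isMaximal_of_equiv (sectionEquiv U).symm

end

/-! ### Smooth varieties are normal -/

/-- An étale domain over a normal domain is normal. -/
theorem isIntegrallyClosed_of_etale (R S : Type) [CommRing R] [IsDomain R] [IsIntegrallyClosed R]
    [CommRing S] [IsDomain S] [Algebra R S] [Algebra.Etale R S] : IsIntegrallyClosed S := by
  -- `T` is the fraction field of `S`: it is a localization of `S`, and it is a domain that is
  -- étale, hence finite, over the field `F`.
  let F := FractionRing R
  let T := S ⊗[R] F
  have hle : Algebra.algebraMapSubmonoid S (nonZeroDivisors R) ≤ nonZeroDivisors S := by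
    rintro _ ⟨r, hr, rfl⟩
    exact mem_nonZeroDivisors_of_ne_zero ((map_ne_zero_iff _
      (FaithfulSMul.algebraMap_injective R S)).mpr (nonZeroDivisors.ne_zero hr))
  have hloc : IsLocalization (Algebra.algebraMapSubmonoid S (nonZeroDivisors R)) T := inferInstance
  have hTdom : IsDomain T := IsLocalization.isDomain_of_le_nonZeroDivisors T hle
  let e : F ⊗[R] S ≃+* T := (Algebra.TensorProduct.comm R F S).toRingEquiv
  have : IsDomain (F ⊗[R] S) := e.toMulEquiv.isDomain _
  have : Module.Finite F (F ⊗[R] S) := Algebra.FormallyUnramified.finite_of_free _ _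
  have hf : IsField T := e.symm.toMulEquiv.isField
    (isField_of_isIntegral_of_isField' (R := F) (Field.toIsField F))
  have hinj : Function.Injective (algebraMap S T) := IsLocalization.injective T hle
  have : IsFractionRing S T := by
    let _ : Field T := hf.toField
    have : FaithfulSMul S T := (faithfulSMul_iff_algebraMap_injective _ _).mpr hinj
    refine IsFractionRing.of_field S T fun z => ?_
    obtain ⟨a, b, rfl⟩ := IsLocalization.exists_mk'_eq
      (Algebra.algebraMapSubmonoid S (nonZeroDivisors R)) z
    refine ⟨a, b, ?_⟩
    rw [eq_div_iff ((map_ne_zero_iff _ hinj).mpr (nonZeroDivisors.ne_zero (hle b.2)))]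
    exact IsLocalization.mk'_spec T a b
  refine (isIntegrallyClosed_iff T).mpr fun {x} hx => ?_
  -- Integral closure commutes with smooth base change, so `x` comes from `S ⊗` (integral closure of
  -- `R` in `F`). The second factor is `R`, which leaves an element of `S`.
  obtain ⟨w, hw⟩ := (TensorProduct.toIntegralClosure_bijective_of_smooth (R := R) (S := S)
    (B := F)).2 ⟨x, hx⟩
  have key : ∀ w, ∃ y, algebraMap S T y = (TensorProduct.toIntegralClosure R S F w : T) := by
    intro w
    induction w with
    | zero => exact ⟨0, by simp⟩
    | add a b ha hb =>
      obtain ⟨a', ha⟩ := ha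
      obtain ⟨b', hb⟩ := hb
      exact ⟨a' + b', by rw [map_add, ha, hb, map_add]; rfl⟩
    | tmul s y =>
      obtain ⟨r, hr⟩ := IsIntegrallyClosed.isIntegral_iff.mp y.2
      refine ⟨r • s, ?_⟩
      change (r • s) ⊗ₜ[R] (1 : F) = s ⊗ₜ[R] (y : F)
      rw [TensorProduct.smul_tmul, ← hr, Algebra.algebraMap_eq_smul_one]
  obtain ⟨y, hy⟩ := key w
  exact ⟨y, by rw [hy, hw]⟩

/-- A smooth domain over a field is normal. -/
theorem isIntegrallyClosed_of_smooth (k S : Type) [Field k] [CommRing S] [IsDomain S] [Algebra k S]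
    [Algebra.Smooth k S] : IsIntegrallyClosed S := by
  refine IsIntegrallyClosed.of_localization_maximal fun p _ hp => ?_
  have hpp : p.IsPrime := hp.isPrime
  -- Near `p` the smooth algebra is étale over a polynomial ring, which is normal.
  obtain ⟨f, hf, n, _, _, _⟩ :=
    Algebra.IsSmoothAt.exists_isStandardEtale_mvPolynomial (R := k) (p := p)
  have hf0 : f ≠ 0 := by rintro rfl; exact hf p.zero_mem
  have : IsDomain (Localization.Away f) := IsLocalization.isDomain_localization
    (powers_le_nonZeroDivisors_of_noZeroDivisors hf0)
  have : IsIntegrallyClosed (Localization.Away f) :=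
    isIntegrallyClosed_of_etale (MvPolynomial (Fin n) k) _
  have hd : Disjoint (Submonoid.powers f : Set S) p := by
    rw [Set.disjoint_left]
    rintro _ ⟨m, rfl⟩ h
    exact hf (hpp.mem_of_pow_mem m h)
  let q := p.map (algebraMap S (Localization.Away f))
  have hq : q.IsPrime := IsLocalization.isPrime_of_isPrime_disjoint (Submonoid.powers f) _ p hpp hd
  have hpq : q.comap (algebraMap S (Localization.Away f)) = p :=
    IsLocalization.under_map_of_isPrime_disjoint (Submonoid.powers f) _ hpp hd
  have h1 : IsIntegrallyClosed (Localization.AtPrime q) :=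
    isIntegrallyClosed_of_isLocalization _ q.primeCompl q.primeCompl_le_nonZeroDivisors
  have e := (IsLocalization.localizationLocalizationAtPrimeIsoLocalization
    (Submonoid.powers f) q).symm.toRingEquiv
  have h2 := IsIntegrallyClosed.of_equiv e
  have h3 : ∀ (p' : Ideal S) [p'.IsPrime], p' = p → IsIntegrallyClosed (Localization.AtPrime p') →
      IsIntegrallyClosed (Localization.AtPrime p) := by
    rintro p' _ rfl h
    exact h
  exact h3 _ hpq h2

/-! ### Local rings of a variety: affine neighbourhoods, normality, maximal ideals -/

lemma exists_affine {X : Scheme.{0}} (p : X) : ∃ (U : X.Opens) (_ : IsAffineOpen U), p ∈ U := by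
  obtain ⟨_, ⟨U, hU, rfl⟩, hxU, -⟩ :=
    X.isBasis_affineOpens.exists_subset_of_mem_open (Set.mem_univ p) isOpen_univ
  exact ⟨U, hU, hxU⟩

lemma fromSpecStalk_over {X : Scheme.{0}} [X.Over SpecC] (p : X) :
    X.fromSpecStalk p ≫ X ↘ SpecC = Spec.map ((Scheme.ΓSpecIso (.of ℂ)).inv ≫ (X ↘ SpecC).appTop ≫
      X.presheaf.germ ⊤ p trivial) := by
  rw [← cancel_mono (SpecC.toSpecΓ), Category.assoc, Scheme.toSpecΓ_naturality,
    Scheme.fromSpecStalk_toSpecΓ_assoc, ← Spec.map_comp, ← SpecMap_ΓSpecIso_hom,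
    ← Spec.map_comp, Iso.hom_inv_id_assoc]

variable {X : Scheme.{0}} [X.Over SpecC] [IsIntegral X]

lemma isIntegrallyClosed_stalk [Smooth (X ↘ SpecC)] (p : X) :
    IsIntegrallyClosed (X.presheaf.stalk p) := by
  obtain ⟨U, hU, hp⟩ := exists_affine p
  have : Nonempty U := ⟨⟨p, hp⟩⟩
  have h1 : (scalarSection X U).Smooth := by
    have h := Smooth.smooth_appLE (X ↘ SpecC) (isAffineOpen_top SpecC) hU
      (show U ≤ (X ↘ SpecC) ⁻¹ᵁ ⊤ from le_top)
    have h2 : scalarSection X U =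
        ((X ↘ SpecC).appLE ⊤ U le_top).hom.comp (Scheme.ΓSpecIso (.of ℂ)).inv.hom := rfl
    rw [h2]
    exact RingHom.Smooth.comp (RingHom.Smooth.of_bijective
      (Scheme.ΓSpecIso (.of ℂ)).symm.commRingCatIsoToRingEquiv.bijective) h
  let _ : Algebra ℂ Γ(X, U) := (scalarSection X U).toAlgebra
  have : Algebra.Smooth ℂ Γ(X, U) := h1
  have := isIntegrallyClosed_of_smooth ℂ Γ(X, U)
  let x : U := ⟨p, hp⟩
  let _ : Algebra Γ(X, U) (X.presheaf.stalk p) := (X.presheaf.germ U p hp).hom.toAlgebra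
  have : IsLocalization.AtPrime (X.presheaf.stalk p) (hU.primeIdealOf x).asIdeal :=
    hU.isLocalization_stalk x
  exact isIntegrallyClosed_of_isLocalization _ (hU.primeIdealOf x).asIdeal.primeCompl
    (Ideal.primeCompl_le_nonZeroDivisors _)

instance (p : X) : IsLocalRing (localRing X p) := IsLocalRing.of_surjective' (stalkEquiv p).toRingHom (stalkEquiv p).surjective

lemma isIntegrallyClosed_localRing [Smooth (X ↘ SpecC)] (p : X) :
    IsIntegrallyClosed (localRing X p) := by
  have := isIntegrallyClosed_stalk p
  exact IsIntegrallyClosed.of_equiv (stalkEquiv p)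

lemma isNoetherianRing_localRing [LocallyOfFiniteType (X ↘ SpecC)] (p : X) :
    IsNoetherianRing (localRing X p) := by
  have : IsLocallyNoetherian X := LocallyOfFiniteType.isLocallyNoetherian (X ↘ SpecC)
  exact isNoetherianRing_of_ringEquiv _ (stalkEquiv p)

instance (p : X) : IsFractionRing (localRing X p) X.functionField := by
  refine IsFractionRing.of_field _ _ fun z => ?_
  obtain ⟨a, b, _, rfl⟩ := IsFractionRing.div_surjective (A := X.presheaf.stalk p) z
  exact ⟨stalkEquiv p a, stalkEquiv p b, rfl⟩

lemma inv_mem_localRing {p : X} {z : X.functionField} (hz : z ∈ localRing X p) (hz0 : z ≠ 0) :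
    z⁻¹ ∈ localRing X p ↔ (⟨z, hz⟩ : localRing X p) ∉ IsLocalRing.maximalIdeal (localRing X p) := by
  rw [IsLocalRing.mem_maximalIdeal, mem_nonunits_iff, not_not]
  constructor
  · intro h
    exact IsUnit.of_mul_eq_one ⟨z⁻¹, h⟩ (Subtype.ext (mul_inv_cancel₀ hz0))
  · intro h
    obtain ⟨w, hw⟩ := h.exists_right_inv
    have : z * w = 1 := congr(($hw : X.functionField))
    rw [← eq_inv_of_mul_eq_one_right this]
    exact w.2

/-! ### Centers of valuations -/

lemma fromSpecStalk_genericPoint_over :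
    X.fromSpecStalk (genericPoint X) ≫ X ↘ SpecC =
      Spec.map (CommRingCat.ofHom (algebraMap ℂ X.functionField)) :=
  fromSpecStalk_over _

/-- A valuation ring of the function field of a proper variety dominates a local ring. -/
theorem exists_center (hX : IsProper (X ↘ SpecC)) (V : Subalgebra ℂ X.functionField)
    (hV : ∀ x, x ∈ V ∨ x⁻¹ ∈ V) :
    ∃ p : X, localRing X p ≤ V ∧ ∀ z ∈ localRing X p, z⁻¹ ∈ V → z⁻¹ ∈ localRing X p := by
  let O : ValuationSubring X.functionField := { V.toSubring with mem_or_inv_mem' := hV }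
  have hO : ∀ z, z ∈ O ↔ z ∈ V := fun z => Iff.rfl
  let c : ℂ →+* O := (algebraMap ℂ X.functionField).codRestrict O.toSubring
    fun z => V.algebraMap_mem z
  have hex : ValuativeCriterion.Existence (X ↘ SpecC) := by
    have h : UniversallyClosed (X ↘ SpecC) := inferInstance
    rw [UniversallyClosed.eq_valuativeCriterion] at h
    exact h.1
  let sq : ValuativeCommSq (X ↘ SpecC) :=
    { R := O
      K := X.functionField
      i₁ := X.fromSpecStalk (genericPoint X)
      i₂ := Spec.map (CommRingCat.ofHom c)
      commSq := ⟨by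
        rw [fromSpecStalk_genericPoint_over, ← Spec.map_comp]
        rfl⟩ }
  obtain ⟨⟨l, hl1, hl2⟩⟩ := hex sq
  change Spec (.of O) ⟶ X at l
  let p := l (IsLocalRing.closedPoint O)
  let g : X.presheaf.stalk p ⟶ CommRingCat.of O := Scheme.stalkClosedPointTo (R := .of O) l
  have hg : g ≫ CommRingCat.ofHom (algebraMap O X.functionField) =
      X.presheaf.stalkSpecializes ((genericPoint_spec X).specializes trivial) := by
    apply Spec.map_injective
    rw [← cancel_mono (X.fromSpecStalk p), Spec.map_comp, Category.assoc]
    have h1 : Spec.map g ≫ X.fromSpecStalk p = l :=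
      Scheme.Spec_stalkClosedPointTo_fromSpecStalk (R := .of O) l
    rw [h1, Scheme.SpecMap_stalkSpecializes_fromSpecStalk]
    exact hl1
  have hg' : ∀ s, ((g.hom s : O) : X.functionField) = algebraMap _ X.functionField s :=
    fun s => congr($(hg).hom s)
  refine ⟨p, ?_, ?_⟩
  · rintro _ ⟨s, rfl⟩
    exact (hg' s) ▸ (g.hom s).2
  · rintro _ ⟨s, rfl⟩ hs
    have hloc : IsLocalHom g.hom := Scheme.isLocalHom_stalkClosedPointTo' (R := O) l
    change (algebraMap (X.presheaf.stalk p) X.functionField s)⁻¹ ∈ V at hs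
    change (algebraMap (X.presheaf.stalk p) X.functionField s)⁻¹ ∈ localRing X p
    by_cases h0 : algebraMap (X.presheaf.stalk p) X.functionField s = 0
    · rw [h0, inv_zero]; exact zero_mem _
    have hu : IsUnit (g.hom s) := by
      refine IsUnit.of_mul_eq_one (⟨_, hs⟩ : O) (Subtype.ext ?_)
      change (g.hom s : X.functionField) * _ = 1
      rw [hg', mul_inv_cancel₀ h0]
    obtain ⟨w, hw⟩ := (isUnit_of_map_unit g.hom s hu).exists_right_inv
    refine ⟨w, eq_inv_of_mul_eq_one_right ?_⟩
    erw [← map_mul, hw, map_one]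

/-- At a closed point, every function is a constant up to the maximal ideal. -/
lemma exists_sub_mem_maximalIdeal [LocallyOfFiniteType (X ↘ SpecC)] {p : X} (hp : IsClosed {p})
    (z : localRing X p) :
    ∃ c : ℂ, z - algebraMap ℂ _ c ∈ IsLocalRing.maximalIdeal (localRing X p) := by
  obtain ⟨U, hU, hpU⟩ := exists_affine p
  have : Nonempty U := ⟨⟨p, hpU⟩⟩
  obtain ⟨P, hP, hloc, hmax⟩ := exists_prime_localRing_eq hU p hpU
  have hmax := hmax hp
  have hfg := (regularRing_fg (X := X) hU)
  have : Algebra.FiniteType ℂ (regularRing X U) := (regularRing X U).fg_iff_finiteType.mp hfg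
  -- Nullstellensatz: the residue field at a maximal ideal is finite over ℂ, hence ℂ.
  have hconst : ∀ a : regularRing X U, ∃ c : ℂ, a - algebraMap ℂ _ c ∈ P := by
    intro a
    let _ : Field (regularRing X U ⧸ P) := Ideal.Quotient.field P
    have : Module.Finite ℂ (regularRing X U ⧸ P) := finite_of_finite_type_of_isJacobsonRing ℂ _
    have : Algebra.IsIntegral ℂ (regularRing X U ⧸ P) := Algebra.IsIntegral.of_finite _ _
    obtain ⟨c, hc⟩ := (IsAlgClosed.algebraMap_bijective_of_isIntegral (k := ℂ)
      (K := regularRing X U ⧸ P)).2 (Ideal.Quotient.mk P a)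
    refine ⟨c, ?_⟩
    rw [← Ideal.Quotient.eq_zero_iff_mem, map_sub, ← hc]
    exact sub_self _
  obtain ⟨a, b, hb, hab⟩ := mem_atPrime.mp (hloc.le z.2)
  obtain ⟨ca, hca⟩ := hconst a
  obtain ⟨cb, hcb⟩ := hconst b
  have hcb0 : cb ≠ 0 := by
    rintro rfl
    rw [map_zero, sub_zero] at hcb
    exact hb hcb
  refine ⟨ca / cb, ?_⟩
  by_contra hn
  have hne : z - algebraMap ℂ _ (ca / cb) ≠ 0 := fun h => hn (h ▸ zero_mem _)
  have hne' : ((z - algebraMap ℂ _ (ca / cb) : localRing X p) : X.functionField) ≠ 0 :=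
    fun h => hne (Subtype.ext h)
  have hinv := (inv_mem_localRing (z - algebraMap ℂ _ (ca / cb) : localRing X p).2 hne').mpr hn
  obtain ⟨a', b', hb', hab'⟩ := mem_atPrime.mp (hloc.le hinv)
  have h1 : (a - algebraMap ℂ _ (ca / cb) * b) * a' = b * b' := by
    apply Subtype.ext
    change ((z : X.functionField) - algebraMap ℂ _ (ca / cb)) ≠ 0 at hne'
    change ((z : X.functionField) - algebraMap ℂ _ (ca / cb))⁻¹ * b' = a' at hab'
    change ((a : X.functionField) - algebraMap ℂ _ (ca / cb) * b) * a' = b * b'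
    rw [← hab', ← hab]
    field_simp
  have h2 : a - algebraMap ℂ _ (ca / cb) * b ∈ P := by
    have h3 : a - algebraMap ℂ _ (ca / cb) * b =
        (a - algebraMap ℂ _ ca) - algebraMap ℂ _ (ca / cb) * (b - algebraMap ℂ _ cb) := by
      have : (algebraMap ℂ (regularRing X U)) (ca / cb) * algebraMap ℂ _ cb =
          algebraMap ℂ _ ca := by
        rw [← map_mul, div_mul_cancel₀ _ hcb0]
      rw [mul_sub, this]
      ring
    rw [h3]
    exact sub_mem hca (Ideal.mul_mem_left _ _ hcb)
  have h3 : b * b' ∈ P := h1 ▸ P.mul_mem_right _ h2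
  exact (hP.mem_or_mem h3).elim hb hb'

/-! ### Holomorphic two-forms on K3 surfaces -/

section
variable {K : Type} [Field K] [Algebra ℂ K]

/-- If the forms of a subring are the multiples of `ω`, so are the forms of its localizations. -/
lemma exists_smul_of_mem_formsOf {R V : Subalgebra ℂ K} {ω : TwoForm K} (hRV : R ≤ V)
    (hV : ∀ z ∈ V, ∃ a ∈ R, ∃ b ∈ R, b ≠ 0 ∧ b⁻¹ ∈ V ∧ z = a / b)
    (hω : ∀ a ∈ R, ∀ b ∈ R, ∃ f ∈ R, wedge a b = f • ω) {η : TwoForm K} (hη : η ∈ formsOf V) :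
    ∃ f ∈ V, η = f • ω := by
  induction hη using AddSubgroup.closure_induction with
  | mem x hx =>
    obtain ⟨f, hf, z, hz, w, hw, rfl⟩ := hx
    obtain ⟨a, ha, b, hb, hb0, hbV, rfl⟩ := hV z hz
    obtain ⟨c, hc, d, hd, hd0, hdV, rfl⟩ := hV w hw
    obtain ⟨f1, h1, e1⟩ := hω a ha c hc
    obtain ⟨f2, h2, e2⟩ := hω a ha d hd
    obtain ⟨f3, h3, e3⟩ := hω b hb c hc
    obtain ⟨f4, h4, e4⟩ := hω b hb d hd
    refine ⟨f * (b⁻¹ * (d⁻¹ * f1) - b⁻¹ * ((c * d⁻¹ * d⁻¹) * f2) -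
      ((a * b⁻¹ * b⁻¹) * (d⁻¹ * f3) - (a * b⁻¹ * b⁻¹) * ((c * d⁻¹ * d⁻¹) * f4))), ?_, ?_⟩
    · have ha' : a * b⁻¹ * b⁻¹ ∈ V := mul_mem (mul_mem (hRV ha) hbV) hbV
      have hc' : c * d⁻¹ * d⁻¹ ∈ V := mul_mem (mul_mem (hRV hc) hdV) hdV
      exact mul_mem hf (sub_mem (sub_mem (mul_mem hbV (mul_mem hdV (hRV h1)))
        (mul_mem hbV (mul_mem hc' (hRV h2)))) (sub_mem (mul_mem ha' (mul_mem hdV (hRV h3)))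
        (mul_mem ha' (mul_mem hc' (hRV h4)))))
    · rw [wedge_eq, D_div _ _ hb0, D_div _ _ hd0]
      simp only [map_sub, map_smul, LinearMap.sub_apply, LinearMap.smul_apply, ← wedge_eq, e1, e2,
        e3, e4, smul_smul, ← sub_smul]
      congr 1
      field_simp
      ring
  | zero => exact ⟨0, zero_mem _, by simp⟩
  | add x y _ _ hx hy =>
    obtain ⟨f, hf, rfl⟩ := hx
    obtain ⟨g, hg, rfl⟩ := hy
    exact ⟨f + g, add_mem hf hg, by rw [add_smul]⟩
  | neg x _ hx =>
    obtain ⟨f, hf, rfl⟩ := hx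
    exact ⟨-f, neg_mem hf, (neg_smul f ω).symm⟩

lemma atPrime_frac {A : Subalgebra ℂ K} {P : Ideal A} [P.IsPrime] {z : K} (hz : z ∈ atPrime A P) :
    ∃ a ∈ A, ∃ b ∈ A, b ≠ 0 ∧ b⁻¹ ∈ atPrime A P ∧ z = a / b := by
  obtain ⟨a, b, hb, h⟩ := hz
  have hb0 : (b : K) ≠ 0 := by
    intro h0
    rw [show b = 0 from Subtype.ext h0] at hb
    exact hb P.zero_mem
  exact ⟨a, a.2, b, b.2, hb0, ⟨1, b, hb, inv_mul_cancel₀ hb0⟩, (eq_div_iff hb0).mpr h⟩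

lemma atPrime_mem_or_inv_mem {A : Subalgebra ℂ K} [IsFractionRing A K] (P : Ideal A) [P.IsPrime]
    (hP : ValuationRing (Localization.AtPrime P)) (x : K) :
    x ∈ atPrime A P ∨ x⁻¹ ∈ atPrime A P := by
  have key : ∀ r s c : A, ∀ d : P.primeCompl, s ≠ 0 →
      algebraMap A (Localization.AtPrime P) r * IsLocalization.mk' _ c d =
        algebraMap A (Localization.AtPrime P) s → (s : K) / r ∈ atPrime A P := by
    intro r s c d hs h
    rw [mul_comm, ← IsLocalization.mk'_one (M := P.primeCompl) _ r, ← IsLocalization.mk'_mul,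
      mul_one, IsLocalization.mk'_eq_iff_eq_mul, ← map_mul] at h
    have h1 : c * r = s * d := IsLocalization.injective _ P.primeCompl_le_nonZeroDivisors h
    have hr : r ≠ 0 := by
      rintro rfl
      rw [mul_zero] at h1
      refine mul_ne_zero hs ?_ h1.symm
      rintro h0
      exact d.2 (h0 ▸ P.zero_mem)
    refine ⟨c, d, d.2, ?_⟩
    have hr' : (r : K) ≠ 0 := fun h => hr (Subtype.ext h)
    have h2 : (c : K) * r = s * d := congr(($h1 : K))
    field_simp
    rw [← h2, mul_comm]
  obtain ⟨r, s, hs, rfl⟩ := IsFractionRing.div_surjective (A := A) x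
  have hs0 : s ≠ 0 := nonZeroDivisors.ne_zero hs
  change (r : K) / s ∈ _ ∨ ((r : K) / s)⁻¹ ∈ _
  rw [inv_div]
  by_cases hr0 : r = 0
  · left; rw [hr0]; simp
  obtain ⟨c, hc⟩ := ValuationRing.cond (algebraMap A (Localization.AtPrime P) r)
    (algebraMap A (Localization.AtPrime P) s)
  obtain ⟨c, d, rfl⟩ := IsLocalization.exists_mk'_eq P.primeCompl c
  rcases hc with hc | hc
  · exact Or.inr (key r s c d hs0 hc)
  · exact Or.inl (key s r c d hr0 hc)

/-- The valuation rings containing the constants intersect in the integral closure of ℂ in `K`,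
which is ℂ because ℂ is algebraically closed. -/
lemma exists_const_of_forall_valuation (g : K)
    (h : ∀ V : Subalgebra ℂ K, (∀ x, x ∈ V ∨ x⁻¹ ∈ V) → g ∈ V) : ∃ c : ℂ, g = algebraMap ℂ K c := by
  have h1 : g ∈ (integralClosure (Subring.closure (Set.range (algebraMap ℂ K))) K).toSubring := by
    rw [← iInf_valuationSubring_superset, Subring.mem_iInf]
    rintro ⟨V, hV⟩
    exact h { V.toSubring with algebraMap_mem' := fun z => hV ⟨z, rfl⟩ } V.mem_or_inv_mem
  have h2 : Subring.closure (Set.range (algebraMap ℂ K)) = (algebraMap ℂ K).range :=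
    le_antisymm (Subring.closure_le.mpr fun _ h => h) fun _ h => Subring.subset_closure h
  rw [h2] at h1
  have h3 : IsIntegral ℂ g := by
    obtain ⟨p, hp, hpg⟩ := h1
    have hsur : Function.Surjective (algebraMap ℂ K).rangeRestrict :=
      (algebraMap ℂ K).rangeRestrict_surjective
    obtain ⟨q, hq, -, hqm⟩ := Polynomial.lifts_and_degree_eq_and_monic
      ((Polynomial.mem_lifts _).mpr (Polynomial.map_surjective _ hsur p)) hp
    refine ⟨q, hqm, ?_⟩
    rw [← hq, Polynomial.eval₂_map] at hpg
    exact hpg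
  have hdeg : (minpoly ℂ g).degree = 1 :=
    IsAlgClosed.degree_eq_one_of_irreducible ℂ (minpoly.irreducible h3)
  obtain ⟨c, hc⟩ := minpoly.mem_range_of_degree_eq_one ℂ g hdeg
  exact ⟨c, hc.symm⟩

end

section

variable {X : Scheme.{0}} [X.Over SpecC] [IsIntegral X]

lemma exists_const_of_forall_mem_localRing (hX : IsProper (X ↘ SpecC)) (g : X.functionField)
    (h : ∀ p, g ∈ localRing X p) : ∃ c : ℂ, g = algebraMap ℂ _ c := by
  refine exists_const_of_forall_valuation g fun V hV => ?_
  obtain ⟨p, hp, -⟩ := exists_center hX V hV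
  exact hp (h p)

lemma localRing_frac (p : X) (z : X.functionField) :
    ∃ a ∈ localRing X p, ∃ b ∈ localRing X p, b ≠ 0 ∧ z = a / b := by
  obtain ⟨a, b, hb, rfl⟩ := IsFractionRing.div_surjective (A := localRing X p) z
  refine ⟨a, a.2, b, b.2, fun h => nonZeroDivisors.ne_zero hb (Subtype.ext h), rfl⟩

/-- `ω` generates the two-forms at every point. -/
def IsCanonicalGenerator (X : Scheme.{0}) [X.Over SpecC] [IsIntegral X]
    (ω : TwoForm X.functionField) : Prop :=
  ∀ (p : X) (η : TwoForm X.functionField), η ∈ localTwoForms X p ↔ ∃ f ∈ localRing X p, η = f • ω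

lemma exists_isCanonicalGenerator (h : IsK3Surface X) : ∃ ω, IsCanonicalGenerator X ω := by
  obtain ⟨ω, hω⟩ := h.canonical_trivial
  refine ⟨ω, fun p η => ?_⟩
  rw [← SetLike.mem_coe, hω p]
  constructor
  · rintro ⟨f, rfl⟩
    exact ⟨_, ⟨f, rfl⟩, rfl⟩
  · rintro ⟨_, ⟨f, rfl⟩, rfl⟩
    exact ⟨f, rfl⟩

namespace IsCanonicalGenerator

variable {ω₀ : TwoForm X.functionField}

lemma wedge_eq_smul (h : IsCanonicalGenerator X ω₀) {p : X} {a b : X.functionField}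
    (ha : a ∈ localRing X p) (hb : b ∈ localRing X p) :
    ∃ f ∈ localRing X p, wedge a b = f • ω₀ := by
  refine (h p _).mp ?_
  rw [localTwoForms_eq]
  simpa using smul_wedge_mem_formsOf (one_mem _) ha hb

lemma exists_smul (h : IsCanonicalGenerator X ω₀) (f t x : X.functionField) :
    ∃ g : X.functionField, f • wedge t x = g • ω₀ := by
  have h1 : wedge t x ∈ Submodule.span X.functionField {ω₀} := by
    refine wedge_mem_span_of_frac (localRing_frac (genericPoint X)) (fun a ha b hb => ?_) t x
    obtain ⟨f, -, hf⟩ := h.wedge_eq_smul ha hb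
    exact Submodule.mem_span_singleton.mpr ⟨f, hf.symm⟩
  obtain ⟨g, hg⟩ := Submodule.mem_span_singleton.mp h1
  exact ⟨f * g, by rw [← hg, smul_smul]⟩

lemma mem_formsOf (h : IsCanonicalGenerator X ω₀) (p : X) : ω₀ ∈ formsOf (localRing X p) := by
  rw [← localTwoForms_eq]
  exact (h p _).mpr ⟨1, one_mem _, (one_smul _ _).symm⟩

/-- A form that is regular at all valuation rings is regular at all points. -/
lemma mem_localRing_of_forall_valuation [Smooth (X ↘ SpecC)] (h : IsCanonicalGenerator X ω₀)
    (h0 : ω₀ ≠ 0) {g : X.functionField}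
    (hg : ∀ V : Subalgebra ℂ X.functionField, (∀ x, x ∈ V ∨ x⁻¹ ∈ V) → g • ω₀ ∈ formsOf V)
    (p : X) : g ∈ localRing X p := by
  have := isIntegrallyClosed_localRing (X := X) p
  have := isNoetherianRing_localRing (X := X) p
  by_contra hn
  -- A function outside the normal ring 𝒪_p has a pole along some `P` whose localization is a
  -- discrete valuation ring. There the regular forms are the regular multiples of `ω₀`, so the
  -- assumption on `g • ω₀` rules out the pole.
  obtain ⟨P, hP, -, hprinc, hgP⟩ := exists_dvr_notMem (R := localRing X p) g (by
    rintro ⟨z, rfl⟩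
    exact hn z.2)
  have hval : ValuationRing (Localization.AtPrime P) :=
    ((tfae_of_isNoetherianRing_of_isLocalRing_of_isDomain (Localization.AtPrime P)).out 4 1).mp
      hprinc
  have hreg := hg (atPrime _ P) (atPrime_mem_or_inv_mem P hval)
  obtain ⟨f, hf, hfe⟩ := exists_smul_of_mem_formsOf (le_atPrime (localRing X p) P)
    (fun z hz => atPrime_frac hz) (fun a ha b hb => h.wedge_eq_smul ha hb) hreg
  rw [smul_left_injective _ h0 hfe] at hgP
  obtain ⟨a, b, hb, hab⟩ := hf
  exact hgP a b hb hab

end IsCanonicalGenerator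

/-- The holomorphic two-forms of a K3 surface are the multiples of a form that is regular at all
valuation rings. -/
theorem mem_holomorphicTwoForms_iff (hX : IsK3Surface X) {f t x : X.functionField}
    (h0 : f • wedge t x ≠ 0)
    (hreg : ∀ V : Subalgebra ℂ X.functionField, (∀ x, x ∈ V ∨ x⁻¹ ∈ V) →
      f • wedge t x ∈ formsOf V) (η : TwoForm X.functionField) :
    η ∈ holomorphicTwoForms X ↔ ∃ a : ℂ, η = algebraMap ℂ X.functionField a • f • wedge t x := by
  obtain ⟨ω₀, hω₀⟩ := exists_isCanonicalGenerator hX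
  have := hX.isProper
  have := hX.smooth
  have : Smooth (X ↘ SpecC) := SmoothOfRelativeDimension.smooth 2 _
  obtain ⟨g, hg⟩ := hω₀.exists_smul f t x
  rw [hg] at h0 hreg ⊢
  have hω0 : ω₀ ≠ 0 := by rintro rfl; simp at h0
  have hg0 : g ≠ 0 := by rintro rfl; simp at h0
  -- The given form is `g ω₀` with `g` regular at every point, so `g` is a nonzero constant and the
  -- form is itself a canonical generator.
  obtain ⟨c, hc⟩ := exists_const_of_forall_mem_localRing hX.isProper g
    (hω₀.mem_localRing_of_forall_valuation hω0 hreg)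
  have hc0 : c ≠ 0 := by rintro rfl; rw [map_zero] at hc; exact hg0 hc
  rw [holomorphicTwoForms, AddSubgroup.mem_iInf]
  constructor
  · intro hη
    obtain ⟨k, -, hk⟩ := (hω₀ (genericPoint X) η).mp (hη _)
    have hk' : ∀ p, k ∈ localRing X p := fun p => by
      obtain ⟨k', hk', e⟩ := (hω₀ p η).mp (hη p)
      rw [hk] at e
      rwa [smul_left_injective _ hω0 e]
    obtain ⟨d, hd⟩ := exists_const_of_forall_mem_localRing hX.isProper k hk'
    refine ⟨d / c, ?_⟩
    rw [hk, hc, hd, smul_smul, ← map_mul, div_mul_cancel₀ _ hc0]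
  · rintro ⟨a, rfl⟩ p
    refine (hω₀ p _).mpr ⟨algebraMap ℂ _ (a * c), Subalgebra.algebraMap_mem _ _, ?_⟩
    rw [smul_smul, hc, map_mul]

end

/-! ### Symplectic birational automorphisms of K3 surfaces are biregular -/

section

variable {X : Scheme.{0}} [X.Over SpecC] [IsIntegral X]

lemma mem_maximalIdeal_iff {p : X} {A : Subalgebra ℂ X.functionField} {P : Ideal A} [P.IsPrime]
    (hp : localRing X p = atPrime A P) (s : localRing X p) {a b : A} (hb : b ∉ P)
    (h : (s : X.functionField) * b = a) :
    s ∈ IsLocalRing.maximalIdeal (localRing X p) ↔ a ∈ P := by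
  have hb0 : (b : X.functionField) ≠ 0 := by
    intro h0
    rw [show b = 0 from Subtype.ext h0] at hb
    exact hb P.zero_mem
  by_cases hs0 : (s : X.functionField) = 0
  · rw [hs0, zero_mul] at h
    rw [show s = 0 from Subtype.ext hs0, show a = 0 from Subtype.ext h.symm]
    simp
  have h1 := inv_mem_localRing s.2 hs0
  rw [← not_iff_not]
  refine h1.symm.trans ?_
  constructor
  · intro hs ha
    obtain ⟨a', b', hb', h'⟩ := mem_atPrime.mp (hp.le hs)
    have h2 : a * a' = b * b' := by
      apply Subtype.ext
      change (a : X.functionField) * a' = b * b'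
      rw [← h, ← h']
      field_simp
    exact (Ideal.IsPrime.mem_or_mem ‹P.IsPrime› (h2 ▸ P.mul_mem_right a' ha)).elim hb hb'
  · intro ha
    refine hp.ge ⟨b, a, ha, ?_⟩
    rw [← h]
    field_simp

/-- On a smooth surface, the local ring of a point that is not closed is a valuation ring with
principal maximal ideal. -/
lemma isPrincipal_maximalIdeal_of_lt [Smooth (X ↘ SpecC)]
    (htr : Algebra.trdeg ℂ X.functionField ≤ 2) {U : X.Opens} [Nonempty U] (hU : IsAffineOpen U)
    {P P' : Ideal (regularRing X U)} [P.IsPrime] [P'.IsPrime] (hlt : P < P') {p : X}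
    (hp : localRing X p = atPrime _ P) :
    (IsLocalRing.maximalIdeal (localRing X p)).IsPrincipal ∧
      ∀ x, x ∈ localRing X p ∨ x⁻¹ ∈ localRing X p := by
  have := isIntegrallyClosed_localRing (X := X) p
  have := isNoetherianRing_localRing (X := X) p
  have : Algebra.FiniteType ℂ (regularRing X U) :=
    (regularRing X U).fg_iff_finiteType.mp (regularRing_fg hU)
  have hle : regularRing X U ≤ localRing X p := hp ▸ le_atPrime _ _
  have htfae := tfae_of_isNoetherianRing_of_isLocalRing_of_isDomain (localRing X p)
  -- A nonzero prime `N` of 𝒪_p contracts to a nonzero prime inside `P`. In dimension two a strict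
  -- inclusion below `P < P'` is impossible, so the contraction is `P`. A normal Noetherian local
  -- domain with a single nonzero prime is a discrete valuation ring.
  have h4 : IsIntegrallyClosed (localRing X p) ∧ ∀ N : Ideal (localRing X p), N ≠ ⊥ → N.IsPrime →
      N = IsLocalRing.maximalIdeal (localRing X p) := by
    refine ⟨inferInstance, fun N hN hNp => ?_⟩
    refine le_antisymm (IsLocalRing.le_maximalIdeal hNp.ne_top) ?_
    let i : regularRing X U →+* localRing X p := (Subalgebra.inclusion hle).toRingHom
    have hN1 : N.comap i ≤ P := by
      intro a ha
      have hm : i a ∈ IsLocalRing.maximalIdeal (localRing X p) :=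
        IsLocalRing.le_maximalIdeal hNp.ne_top ha
      exact (mem_maximalIdeal_iff hp (i a) (b := 1)
        (fun h => Ideal.IsPrime.ne_top ‹P.IsPrime› ((Ideal.eq_top_iff_one P).mpr h))
        (by simp [i])).mp hm
    have hN2 : N.comap i ≠ ⊥ := by
      obtain ⟨s, hs, hs0⟩ := Submodule.exists_mem_ne_zero_of_ne_bot hN
      obtain ⟨a, b, hb, hab⟩ := mem_atPrime.mp (hp.le s.2)
      have hia : i a = s * i b := Subtype.ext hab.symm
      have hmem : a ∈ N.comap i := by
        rw [Ideal.mem_comap, hia]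
        exact N.mul_mem_right _ hs
      intro hbot
      rw [hbot, Ideal.mem_bot] at hmem
      rw [hmem] at hab
      rcases mul_eq_zero.mp hab with h | h
      · exact hs0 (Subtype.ext h)
      · rw [show b = 0 from Subtype.ext h] at hb
        exact hb P.zero_mem
    have hNP : N.comap i = P := by
      by_contra hne
      exact hN2 (eq_bot_of_prime_chain (k := ℂ) (K := X.functionField) htr
        (lt_of_le_of_ne hN1 hne) hlt)
    intro s hs
    obtain ⟨a, b, hb, hab⟩ := mem_atPrime.mp (hp.le s.2)
    have ha := (mem_maximalIdeal_iff hp s hb hab).mp hs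
    have hia : s * i b = i a := Subtype.ext hab
    rw [← hNP] at ha hb
    have : s * i b ∈ N := hia ▸ ha
    exact (hNp.mem_or_mem this).resolve_right hb
  refine ⟨(htfae.out 3 4).mp h4, fun x => ?_⟩
  have hval : ValuationRing (localRing X p) := (htfae.out 3 1).mp h4
  obtain ⟨z, hz⟩ | ⟨z, hz⟩ := ValuationRing.isInteger_or_isInteger (localRing X p) x
  · exact Or.inl (hz ▸ z.2)
  · exact Or.inr (hz ▸ z.2)

/-- Two-forms at a closed point vanish along a divisor whose local ring dominates it. -/
lemma exists_formPullback_eq_smul [LocallyOfFiniteType (X ↘ SpecC)] {ω₀ : TwoForm X.functionField}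
    (hω₀ : IsCanonicalGenerator X ω₀) {x z : X} (hx : IsClosed {x})
    (τ : X.functionField →ₐ[ℂ] X.functionField) {π : X.functionField} (hπ : π ∈ localRing X z)
    (hR : ∀ r ∈ localRing X x, τ r ∈ localRing X z)
    (hm : ∀ r ∈ IsLocalRing.maximalIdeal (localRing X x), ∃ w ∈ localRing X z, τ r = π * w)
    {η : TwoForm X.functionField} (hη : η ∈ formsOf (localRing X x)) :
    ∃ w ∈ localRing X z, formPullback τ η = (π * w) • ω₀ := by
  induction hη using AddSubgroup.closure_induction with
  | mem y hy =>
    obtain ⟨f, hf, a, ha, b, hb, rfl⟩ := hy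
    -- Since `a` is a constant plus an element of the maximal ideal, `τ a = π a' + c` and `d(τ a) =
    -- π da' + a' dπ`; similarly for `b`. The only term of the product without a factor `π` is `a'
    -- b' dπ ∧ dπ = 0`.
    obtain ⟨c, hc⟩ := exists_sub_mem_maximalIdeal hx ⟨a, ha⟩
    obtain ⟨d, hd⟩ := exists_sub_mem_maximalIdeal hx ⟨b, hb⟩
    obtain ⟨a', ha', ea⟩ := hm _ hc
    obtain ⟨b', hb', eb⟩ := hm _ hd
    have ea : τ a = π * a' + algebraMap ℂ _ c := by
      rw [← ea, ← τ.commutes c, ← map_add]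
      congr 1
      exact (sub_add_cancel a (algebraMap ℂ _ c)).symm
    have eb : τ b = π * b' + algebraMap ℂ _ d := by
      rw [← eb, ← τ.commutes d, ← map_add]
      congr 1
      exact (sub_add_cancel b (algebraMap ℂ _ d)).symm
    obtain ⟨f1, h1, e1⟩ := hω₀.wedge_eq_smul ha' hb'
    obtain ⟨f2, h2, e2⟩ := hω₀.wedge_eq_smul hπ hb'
    obtain ⟨f3, h3, e3⟩ := hω₀.wedge_eq_smul ha' hπ
    refine ⟨τ f * (π * f1 + b' * f3 + a' * f2), mul_mem (hR f hf) (add_mem (add_mem (mul_mem hπ h1)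
      (mul_mem hb' h3)) (mul_mem ha' h2)), ?_⟩
    rw [formPullback_smul_wedge, ea, eb, wedge_eq]
    simp only [map_add, Derivation.map_algebraMap, add_zero, Derivation.leibniz, map_smul,
      LinearMap.add_apply, LinearMap.smul_apply, ← wedge_eq, e1, e2, e3]
    rw [show wedge π π = 0 from wedgeB_self _]
    simp only [smul_zero, add_zero, smul_smul, ← add_smul]
    congr 1
    ring
  | zero => exact ⟨0, zero_mem _, by simp⟩
  | add x y _ _ hx hy =>
    obtain ⟨f, hf, ef⟩ := hx
    obtain ⟨g, hg, eg⟩ := hy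
    exact ⟨f + g, add_mem hf hg, by rw [map_add, ef, eg, ← add_smul, mul_add]⟩
  | neg x _ hx =>
    obtain ⟨f, hf, ef⟩ := hx
    refine ⟨-f, neg_mem hf, ?_⟩
    rw [map_neg, ef, mul_neg]
    exact (neg_smul (π * f) ω₀).symm

/-- An automorphism of the function field of a K3 surface that preserves the two-form is regular
at every closed point. -/
theorem exists_forall_mem_localRing [Smooth (X ↘ SpecC)] [hprop : IsProper (X ↘ SpecC)]
    (htr : Algebra.trdeg ℂ X.functionField ≤ 2)
    {ω₀ : TwoForm X.functionField} (hω₀ : IsCanonicalGenerator X ω₀) (hω0 : ω₀ ≠ 0)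
    (σ τ : X.functionField →ₐ[ℂ] X.functionField) (hστ : ∀ z, σ (τ z) = z)
    (hτ : formPullback τ ω₀ = ω₀) {x : X} (hx : IsClosed {x}) :
    ∃ (U : X.Opens) (_ : Nonempty U) (_ : IsAffineOpen U),
      ∀ a ∈ regularRing X U, σ a ∈ localRing X x := by
  have := isIntegrallyClosed_localRing (X := X) x
  let R := localRing X x
  let m := IsLocalRing.maximalIdeal (localRing X x)
  -- A valuation ring `V` dominating 𝒪_x, carried over by `σ`, has a centre `q`: this is a candidate
  -- for the image of `x`, and it picks the affine target `U`.
  obtain ⟨V, hRV, hmV⟩ := Ideal.image_subset_nonunits_valuationSubring (A := R.toSubring)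
    (IsLocalRing.maximalIdeal (localRing X x)) (Ideal.IsPrime.ne_top inferInstance)
  let V' : Subalgebra ℂ X.functionField :=
    { V.toSubring.comap σ.toRingHom with
      algebraMap_mem' := fun z => by
        change σ (algebraMap ℂ _ z) ∈ V
        rw [σ.commutes]
        exact hRV (R.algebraMap_mem z) }
  have hV' : ∀ z, z ∈ V' ↔ σ z ∈ V := fun z => Iff.rfl
  obtain ⟨q, hqV, -⟩ := exists_center hprop V' fun z => by
    rw [hV', hV', map_inv₀]
    exact V.mem_or_inv_mem _
  obtain ⟨U, hU, hqU⟩ := exists_affine q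
  have hUne : Nonempty U := ⟨⟨q, hqU⟩⟩
  refine ⟨U, hUne, hU, ?_⟩
  let A := regularRing X U
  have hAV : ∀ a ∈ A, σ a ∈ V := fun a ha => by
    obtain ⟨P, hP, hloc, -⟩ := exists_prime_localRing_eq hU q hqU
    exact hqV (hloc ▸ le_atPrime _ _ ha)
  obtain ⟨S, hS⟩ := regularRing_fg (X := X) hU
  -- `B = 𝒪_x[σ(A)]` is the ring of the graph of the rational map over a neighbourhood of `x`. The
  -- map is regular at `x` with values in `U` once `B = 𝒪_x`.
  let B : Subalgebra R X.functionField := Algebra.adjoin R (σ '' S)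
  have hBfg : B.FG := by
    classical
    exact ⟨S.image σ, by rw [Finset.coe_image]⟩
  have hRB : ∀ r ∈ R, r ∈ B := fun r hr => B.algebraMap_mem ⟨r, hr⟩
  have hAB : ∀ a ∈ A, σ a ∈ B := by
    intro a ha
    change a ∈ regularRing X U at ha
    rw [← hS] at ha
    induction ha using Algebra.adjoin_induction with
    | mem s hs => exact Algebra.subset_adjoin ⟨s, hs, rfl⟩
    | algebraMap c => rw [σ.commutes]; exact hRB _ (R.algebraMap_mem c)
    | add a b _ _ ha hb => rw [map_add]; exact add_mem ha hb
    | mul a b _ _ ha hb => rw [map_mul]; exact mul_mem ha hb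
  have hBV : ∀ b ∈ B, b ∈ V := by
    intro b hb
    induction hb using Algebra.adjoin_induction with
    | mem s hs =>
      obtain ⟨s, hs, rfl⟩ := hs
      refine hAV s ?_
      change s ∈ regularRing X U
      rw [← hS]
      exact Algebra.subset_adjoin hs
    | algebraMap c => exact hRV c.2
    | add a b _ _ ha hb => exact add_mem ha hb
    | mul a b _ _ ha hb => exact mul_mem ha hb
  let iB : B →+* V := B.subtype.codRestrict V.toSubring fun b => hBV b b.2
  let P : Ideal B := (IsLocalRing.maximalIdeal V).comap iB
  -- The maximal ideal of `V` cuts out a prime of `B` over the closed point, as Zariski's main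
  -- theorem requires.
  have hmP : ∀ r : R, r ∈ m → algebraMap R B r ∈ P := by
    intro r hr
    have h1 : (r : X.functionField) ∈ V.nonunits := hmV ⟨r, hr, rfl⟩
    rw [← SetLike.mem_coe, ← ValuationSubring.image_maximalIdeal] at h1
    obtain ⟨w, hw, hwr⟩ := h1
    change iB (algebraMap R B r) ∈ IsLocalRing.maximalIdeal V
    rwa [show iB (algebraMap R B r) = w from Subtype.ext hwr.symm]
  have hP : P.under R = IsLocalRing.maximalIdeal R := by
    refine ((IsLocalRing.maximalIdeal.isMaximal R).eq_of_le
      (Ideal.IsPrime.ne_top inferInstance) ?_).symm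
    exact fun r hr => hmP r hr
  rcases eq_bot_or_exists_primes_lt B hBfg P hP with hbot | ⟨Q, Q', hQ, hQ', hlt, hQR⟩
  · intro a ha
    obtain ⟨r, hr⟩ := Algebra.mem_bot.mp (hbot ▸ hAB a ha)
    rw [← hr]
    exact r.2
  exfalso
  have hmQ : ∀ r : R, r ∈ m → algebraMap R B r ∈ Q := fun r hr => by
    change r ∈ Q.under R
    rw [hQR]
    exact hr
  let i : A →+* B :=
    { toFun := fun a => ⟨σ a, hAB a a.2⟩
      map_zero' := Subtype.ext (map_zero σ)
      map_one' := Subtype.ext (map_one σ)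
      map_add' := fun a b => Subtype.ext (map_add σ _ _)
      map_mul' := fun a b => Subtype.ext (map_mul σ _ _) }
  have hi : ∀ a : A, (i a : X.functionField) = σ a := fun a => rfl
  -- `B = σ(A) + Q`, because 𝒪_x is ℂ plus its maximal ideal, which lies in `Q`. Hence the inclusion
  -- `Q < Q'` stays strict after contraction to `A`.
  have happ : ∀ b (hb : b ∈ B), ∃ a : A, (⟨b, hb⟩ : B) - i a ∈ Q := by
    intro b hb
    induction hb using Algebra.adjoin_induction with
    | mem s hs =>
      obtain ⟨s, hs', rfl⟩ := hs
      have : s ∈ A := by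
        change s ∈ regularRing X U
        rw [← hS]
        exact Algebra.subset_adjoin hs'
      refine ⟨⟨s, this⟩, ?_⟩
      convert! Q.zero_mem
      exact sub_self _
    | algebraMap r =>
      obtain ⟨c, hc⟩ := exists_sub_mem_maximalIdeal hx r
      refine ⟨algebraMap ℂ A c, ?_⟩
      convert! hmQ _ hc using 1
      apply Subtype.ext
      change (r : X.functionField) - σ (algebraMap ℂ _ c) = r - algebraMap ℂ _ c
      rw [σ.commutes]
    | add a b ha hb iha ihb =>
      obtain ⟨a', ha'⟩ := iha
      obtain ⟨b', hb'⟩ := ihb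
      refine ⟨a' + b', ?_⟩
      convert! Q.add_mem ha' hb' using 1
      rw [map_add]
      apply Subtype.ext
      change (a + b : X.functionField) - (i a' + i b') = (a - i a') + (b - i b')
      ring
    | mul a b ha hb iha ihb =>
      obtain ⟨a', ha'⟩ := iha
      obtain ⟨b', hb'⟩ := ihb
      refine ⟨a' * b', ?_⟩
      convert! Q.add_mem (Q.mul_mem_left ⟨a, ha⟩ hb') (Q.mul_mem_right (i b') ha') using 1
      rw [map_mul]
      apply Subtype.ext
      change (a * b : X.functionField) - (i a' * i b') = a * (b - i b') + (a - i a') * i b'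
      ring
  let P₁ := Q.comap i
  let P₂ := Q'.comap i
  have hP12 : P₁ < P₂ := by
    refine lt_of_le_of_ne (Ideal.comap_mono hlt.le) fun heq => ?_
    obtain ⟨b, hb, hbQ⟩ := Set.exists_of_ssubset hlt
    obtain ⟨a, ha⟩ := happ b b.2
    have h1 : a ∈ P₂ := by
      change i a ∈ Q'
      have := Q'.sub_mem hb (hlt.le ha)
      rwa [sub_sub_cancel] at this
    rw [← heq] at h1
    refine hbQ ?_
    have := Q.add_mem ha (show i a ∈ Q from h1)
    rwa [sub_add_cancel] at this
  have hP1p : P₁.IsPrime := Ideal.IsPrime.comap i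
  have hP2p : P₂.IsPrime := Ideal.IsPrime.comap i
  -- As `P₁` lies strictly below `P₂`, the point `z` is not closed. It is the generic point of a
  -- curve with discrete valuation ring 𝒪_z, and `hR` and `hm` say that the inverse map contracts
  -- this curve to `x`.
  obtain ⟨z, hzU, hz⟩ := exists_localRing_eq hU P₁
  obtain ⟨⟨π, hπ⟩, hval⟩ := isPrincipal_maximalIdeal_of_lt htr hU hP12 hz
  have hπm : π ∈ IsLocalRing.maximalIdeal (localRing X z) := by
    rw [hπ]; exact Submodule.mem_span_singleton_self π
  have hR : ∀ r ∈ R, τ r ∈ localRing X z := by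
    intro r hr
    rcases hval (τ r) with h | h
    · exact h
    by_cases hr0 : r = 0
    · rw [hr0, map_zero]; exact zero_mem _
    have hτr : (τ r)⁻¹ ≠ 0 := inv_ne_zero ((map_ne_zero τ).mpr hr0)
    -- Otherwise `(τ r)⁻¹ = a/b` with `a ∈ P₁` and `b ∉ P₁`. Applying `σ` gives `σ b = r · σ a ∈ Q`,
    -- that is `b ∈ P₁`.
    rw [← inv_inv (τ r), inv_mem_localRing h hτr]
    intro hmem
    obtain ⟨a, b, hb, hab⟩ := mem_atPrime.mp (hz.le h)
    have ha := (mem_maximalIdeal_iff hz ⟨_, h⟩ hb hab).mp hmem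
    refine hb ?_
    change i b ∈ Q
    rw [show i b = algebraMap R B ⟨r, hr⟩ * i a from Subtype.ext ?_]
    · exact Q.mul_mem_left _ ha
    change σ b = r * σ a
    rw [← hab, map_mul, map_inv₀, hστ]
    field_simp
  have hm : ∀ r ∈ IsLocalRing.maximalIdeal (localRing X x),
      ∃ w ∈ localRing X z, τ r = π * w := by
    intro r hr
    have h := hR r r.2
    have hmem : (⟨τ r, h⟩ : localRing X z) ∈ IsLocalRing.maximalIdeal (localRing X z) := by
      obtain ⟨a, b, hb, hab⟩ := mem_atPrime.mp (hz.le h)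
      refine (mem_maximalIdeal_iff hz ⟨_, h⟩ hb hab).mpr ?_
      change i a ∈ Q
      rw [show i a = algebraMap R B r * i b from Subtype.ext ?_]
      · exact Q.mul_mem_right _ (hmQ r hr)
      change σ a = r * σ b
      rw [← hab, map_mul, hστ]
    rw [hπ] at hmem
    obtain ⟨w, hw⟩ := Submodule.mem_span_singleton.mp hmem
    refine ⟨w, w.2, ?_⟩
    rw [mul_comm]
    exact congr(($hw : X.functionField)).symm
  -- The pullback of `ω₀` is divisible by `π`, but it equals `ω₀`, so `π` would be a unit.
  obtain ⟨w, hw, he⟩ := exists_formPullback_eq_smul hω₀ hx τ π.2 hR hm (hω₀.mem_formsOf x)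
  rw [hτ] at he
  have h1 : (1 : X.functionField) = π * w := by
    refine smul_left_injective _ hω0 ?_
    simpa using he
  refine (IsLocalRing.mem_maximalIdeal π).mp hπm ?_
  exact IsUnit.of_mul_eq_one ⟨w, hw⟩ (Subtype.ext h1.symm)

end

/-! ### Rational maps and their comorphisms -/

instance isDominant_fromSpecStalk_genericPoint (X : Scheme.{0}) [IsIntegral X] :
    IsDominant (X.fromSpecStalk (genericPoint X)) := by
  refine ⟨?_⟩
  rw [DenseRange, dense_iff_closure_eq, ← Set.univ_subset_iff, ← genericPoint_closure (α := X)]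
  refine closure_mono (Set.singleton_subset_iff.mpr ?_)
  exact ⟨_, Scheme.fromSpecStalk_closedPoint⟩

lemma hom_ext_of_genericPoint {X Y : Scheme.{0}} [IsIntegral X] [Y.IsSeparated] {f g : X ⟶ Y}
    (h : X.fromSpecStalk (genericPoint X) ≫ f = X.fromSpecStalk (genericPoint X) ≫ g) : f = g :=
  ext_of_isDominant (X.fromSpecStalk (genericPoint X)) h

lemma isSeparated_of_over (X : Scheme.{0}) [X.Over SpecC] [IsSeparated (X ↘ SpecC)] :
    X.IsSeparated :=
  ⟨by rw [← Limits.terminal.comp_from (X ↘ SpecC)]; infer_instance⟩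

lemma fromFunctionField_eq {X Y : Scheme.{0}} [IsIntegral X] (f : X.PartialMap Y) {x : X}
    (hx : x ∈ f.domain) : f.fromFunctionField =
      Spec.map (X.presheaf.stalkSpecializes ((genericPoint_spec X).specializes trivial)) ≫
        f.fromSpecStalkOfMem hx := by
  rw [Scheme.PartialMap.fromFunctionField, Scheme.PartialMap.fromSpecStalkOfMem,
    Scheme.PartialMap.fromSpecStalkOfMem, ← Category.assoc]
  congr 1
  rw [← cancel_mono f.domain.ι, Scheme.Opens.fromSpecStalkOfMem_ι, Category.assoc,
    Scheme.Opens.fromSpecStalkOfMem_ι, Scheme.SpecMap_stalkSpecializes_fromSpecStalk]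

lemma exists_hom_of_domain_eq_top {X Y : Scheme.{0}} (f : X.PartialMap Y) (hf : f.domain = ⊤) :
    ∃ g : X ⟶ Y, g.toRationalMap = f.toRationalMap := by
  obtain ⟨U, hU, f⟩ := f
  subst hf
  refine ⟨X.topIso.inv ≫ f, ?_⟩
  have h : (X.topIso.inv ≫ f).toPartialMap = ⟨⊤, hU, f⟩ :=
    Scheme.PartialMap.ext _ _ rfl (by simp [Scheme.Hom.toPartialMap])
  exact congr(Scheme.PartialMap.toRationalMap $h)

section

variable {X Y : Scheme.{0}} [X.Over SpecC] [Y.Over SpecC] [IsIntegral X] [IsIntegral Y]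

lemma SpecMap_comp_fromSpecStalk_over (σ : Y.functionField →ₐ[ℂ] X.functionField) :
    (Spec.map (CommRingCat.ofHom σ.toRingHom) ≫ Y.fromSpecStalk (genericPoint Y)) ≫ Y ↘ SpecC =
      X.fromSpecStalk (genericPoint X) ≫ X ↘ SpecC := by
  rw [Category.assoc, fromSpecStalk_genericPoint_over, fromSpecStalk_genericPoint_over,
    ← Spec.map_comp, ← CommRingCat.ofHom_comp]
  congr 2
  exact σ.comp_algebraMap

lemma isComorphism_toRationalMap_iff (g : X ⟶ Y) (σ : Y.functionField →ₐ[ℂ] X.functionField) :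
    IsComorphism g.toRationalMap σ ↔ X.fromSpecStalk (genericPoint X) ≫ g =
      Spec.map (CommRingCat.ofHom σ.toRingHom) ≫ Y.fromSpecStalk (genericPoint Y) := by
  rw [IsComorphism, ← Scheme.PartialMap.fromSpecStalkOfMem_toPartialMap]
  rfl

lemma exists_isComorphism [LocallyOfFiniteType (Y ↘ SpecC)]
    (σ : Y.functionField →ₐ[ℂ] X.functionField) : ∃ f : X ⤏ Y, IsComorphism f σ :=
  ⟨_, Scheme.RationalMap.fromFunctionField_ofFunctionField (X ↘ SpecC) (Y ↘ SpecC) _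
    (SpecMap_comp_fromSpecStalk_over σ)⟩

/-- The inclusion of `σ(𝒪(U))` in 𝒪_x is a morphism from the spectrum of 𝒪_x to `U`, which spreads
out to a neighbourhood of `x`. It agrees with `f` at the generic point, hence as a rational map. -/
lemma mem_domain_of_isComorphism [LocallyOfFiniteType (Y ↘ SpecC)] {f : X ⤏ Y}
    {σ : Y.functionField →ₐ[ℂ] X.functionField} (hf : IsComorphism f σ) (x : X) {U : Y.Opens}
    [Nonempty U] (hU : IsAffineOpen U) (h : ∀ a ∈ regularRing Y U, σ a ∈ localRing X x) :
    x ∈ f.domain := by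
  let ρ : Γ(Y, U) →+* X.presheaf.stalk x := (stalkEquiv x).symm.toRingHom.comp
    ((σ.toRingHom.comp (Y.germToFunctionField U).hom).codRestrict (localRing X x).toSubring
      fun s => h _ ⟨s, rfl⟩)
  let s : X.presheaf.stalk x ⟶ X.functionField :=
    X.presheaf.stalkSpecializes ((genericPoint_spec X).specializes trivial)
  let ρ' : Γ(Y, U) ⟶ X.presheaf.stalk x := CommRingCat.ofHom ρ
  have hρ : ρ' ≫ s = Y.germToFunctionField U ≫ CommRingCat.ofHom σ.toRingHom := by
    ext a
    change algebraMap _ X.functionField ((stalkEquiv x).symm _) = _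
    rw [← coe_stalkEquiv, RingEquiv.apply_symm_apply]
    rfl
  let m : Spec (X.presheaf.stalk x) ⟶ Y := Spec.map ρ' ≫ hU.fromSpec
  have hm : Spec.map s ≫ m =
      Spec.map (CommRingCat.ofHom σ.toRingHom) ≫ Y.fromSpecStalk (genericPoint Y) := by
    let σ' : Y.functionField ⟶ X.functionField := CommRingCat.ofHom σ.toRingHom
    have h1 : Spec.map σ' ≫ Spec.map (Y.germToFunctionField U) = Spec.map s ≫ Spec.map ρ' := by
      rw [← Spec.map_comp, ← Spec.map_comp]
      exact congr(Spec.map $hρ.symm)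
    change Spec.map s ≫ Spec.map ρ' ≫ hU.fromSpec = Spec.map σ' ≫ _
    rw [← Category.assoc, ← h1, Category.assoc]
    congr 1
    exact hU.fromSpecStalk_eq_fromSpecStalk _
  have hs : Spec.map s ≫ X.fromSpecStalk x = X.fromSpecStalk (genericPoint X) :=
    Scheme.SpecMap_stalkSpecializes_fromSpecStalk _
  have hover : m ≫ Y ↘ SpecC = X.fromSpecStalk x ≫ X ↘ SpecC := by
    have h1 : Function.Injective s.hom :=
      IsFractionRing.injective (X.presheaf.stalk x) X.functionField
    have h2 : Spec.map s ≫ m ≫ Y ↘ SpecC = Spec.map s ≫ X.fromSpecStalk x ≫ X ↘ SpecC := by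
      rw [← Category.assoc, hm, SpecMap_comp_fromSpecStalk_over, ← Category.assoc, hs]
    obtain ⟨a, ha⟩ := Spec.map_surjective (m ≫ Y ↘ SpecC)
    obtain ⟨b, hb⟩ := Spec.map_surjective (X.fromSpecStalk x ≫ X ↘ SpecC)
    rw [← ha, ← hb, ← Spec.map_comp, ← Spec.map_comp] at h2
    rw [← ha, ← hb]
    congr 1
    ext z
    exact h1 congr($(Spec.map_injective h2).hom z)
  rw [Scheme.RationalMap.mem_domain]
  refine ⟨Scheme.PartialMap.ofFromSpecStalk (X ↘ SpecC) (Y ↘ SpecC) m hover,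
    Scheme.PartialMap.mem_domain_ofFromSpecStalk _ _ _ _, ?_⟩
  apply Scheme.RationalMap.eq_of_fromFunctionField_eq
  have h3 := fromFunctionField_eq _
    (Scheme.PartialMap.mem_domain_ofFromSpecStalk (X ↘ SpecC) (Y ↘ SpecC) m hover)
  rw [Scheme.PartialMap.fromSpecStalkOfMem_ofFromSpecStalk] at h3
  exact (h3.trans hm).trans hf.symm

/-- A comorphism that is regular at all closed points comes from a morphism. -/
theorem exists_hom_isComorphism [LocallyOfFiniteType (Y ↘ SpecC)] [IsSeparated (Y ↘ SpecC)]
    [QuasiCompact (X ↘ SpecC)] (σ : Y.functionField →ₐ[ℂ] X.functionField)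
    (h : ∀ x : X, IsClosed {x} → ∃ (U : Y.Opens) (_ : Nonempty U) (_ : IsAffineOpen U),
      ∀ a ∈ regularRing Y U, σ a ∈ localRing X x) :
    ∃ g : X ⟶ Y, g ≫ Y ↘ SpecC = X ↘ SpecC ∧ IsComorphism g.toRationalMap σ := by
  have : Y.IsSeparated := isSeparated_of_over Y
  obtain ⟨f, hf⟩ := exists_isComorphism σ
  have hdom : f.domain = ⊤ := by
    have : CompactSpace X := QuasiCompact.compactSpace_of_compactSpace (X ↘ SpecC)
    -- The domain is open and every point specializes to a closed one, so it suffices that it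
    -- contains the closed points.
    refine top_le_iff.mp fun x _ => ?_
    obtain ⟨y, hyc, hy⟩ := IsClosed.exists_closed_singleton (isClosed_closure (s := {x}))
      ⟨x, subset_closure rfl⟩
    obtain ⟨U, _, hU, hUa⟩ := h y hy
    exact (specializes_iff_mem_closure.mpr hyc).mem_open f.domain.2
      (mem_domain_of_isComorphism hf y hU hUa)
  obtain ⟨g, hg⟩ := exists_hom_of_domain_eq_top f.toPartialMap hdom
  rw [Scheme.RationalMap.toRationalMap_toPartialMap] at hg
  have hcom : IsComorphism g.toRationalMap σ := hg ▸ hf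
  refine ⟨g, ?_, hcom⟩
  apply hom_ext_of_genericPoint
  rw [← Category.assoc, (isComorphism_toRationalMap_iff g σ).mp hcom,
    SpecMap_comp_fromSpecStalk_over]

end

section

variable {X : Scheme.{0}} [X.Over SpecC] [IsIntegral X]

/-- The automorphism with a given pair of mutually inverse comorphisms. -/
lemma exists_autC [IsSeparated (X ↘ SpecC)] {σ τ : X.functionField →ₐ[ℂ] X.functionField}
    (h1 : ∀ z, σ (τ z) = z) (h2 : ∀ z, τ (σ z) = z) {f g : X ⟶ X}
    (hf : f ≫ X ↘ SpecC = X ↘ SpecC) (hg : g ≫ X ↘ SpecC = X ↘ SpecC)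
    (hfσ : IsComorphism f.toRationalMap σ) (hgτ : IsComorphism g.toRationalMap τ) :
    ∃ i : AutC X, autHom i = f := by
  have : X.IsSeparated := isSeparated_of_over X
  rw [isComorphism_toRationalMap_iff] at hfσ hgτ
  have key : ∀ {σ τ : X.functionField →ₐ[ℂ] X.functionField} {f g : X ⟶ X},
      (∀ z, σ (τ z) = z) → X.fromSpecStalk (genericPoint X) ≫ f =
      Spec.map (CommRingCat.ofHom σ.toRingHom) ≫ X.fromSpecStalk (genericPoint X) →
      X.fromSpecStalk (genericPoint X) ≫ g =
      Spec.map (CommRingCat.ofHom τ.toRingHom) ≫ X.fromSpecStalk (genericPoint X) →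
      f ≫ g = 𝟙 X := by
    intro σ τ f g h hf hg
    apply hom_ext_of_genericPoint
    rw [← Category.assoc, hf, Category.assoc, hg, ← Category.assoc, ← Spec.map_comp,
      ← CommRingCat.ofHom_comp, Category.comp_id]
    have : σ.toRingHom.comp τ.toRingHom = RingHom.id _ := RingHom.ext h
    rw [this, CommRingCat.ofHom_id, Spec.map_id]
    exact Category.id_comp _
  refine ⟨⟨Over.homMk f hf, Over.homMk g hg, ?_, ?_⟩, rfl⟩
  · ext1
    exact key h1 hfσ hgτ
  · ext1
    exact key h2 hgτ hfσ

lemma autC_ext [IsSeparated (X ↘ SpecC)] {i j : AutC X}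
    {σ : X.functionField →ₐ[ℂ] X.functionField} (hi : IsComorphism (autHom i).toRationalMap σ)
    (hj : IsComorphism (autHom j).toRationalMap σ) : i = j := by
  have : X.IsSeparated := isSeparated_of_over X
  apply Iso.ext
  apply Over.OverMorphism.ext
  rw [isComorphism_toRationalMap_iff] at hi hj
  refine hom_ext_of_genericPoint (X := X) (Y := X) ?_
  exact hi.trans hj.symm

/-- In `Aut` the product `i * j` is "first `j`, then `i`", and pullback reverses the order. -/
lemma isComorphism_mul {i j : AutC X} {σ τ : X.functionField →ₐ[ℂ] X.functionField}
    (hi : IsComorphism (autHom i).toRationalMap σ) (hj : IsComorphism (autHom j).toRationalMap τ) :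
    IsComorphism (autHom (i * j)).toRationalMap (τ.comp σ) := by
  rw [isComorphism_toRationalMap_iff] at hi hj ⊢
  have : autHom (i * j) = autHom j ≫ autHom i := rfl
  rw [this, ← Category.assoc, hj, Category.assoc, hi, ← Category.assoc, ← Spec.map_comp,
    ← CommRingCat.ofHom_comp]
  rfl

lemma isComorphism_one : IsComorphism (autHom (1 : AutC X)).toRationalMap (AlgHom.id ℂ _) := by
  rw [isComorphism_toRationalMap_iff]
  have : autHom (1 : AutC X) = 𝟙 X := rfl
  rw [this, Category.comp_id]
  change _ = Spec.map (CommRingCat.ofHom (RingHom.id _)) ≫ _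
  rw [CommRingCat.ofHom_id, Spec.map_id]
  exact (Category.id_comp _).symm

lemma isComorphism_unique {Y : Scheme.{0}} [Y.Over SpecC] [IsIntegral Y] {f : X ⤏ Y}
    {σ τ : Y.functionField →ₐ[ℂ] X.functionField} (hσ : IsComorphism f σ) (hτ : IsComorphism f τ) :
    σ = τ := by
  have h := hσ.symm.trans hτ
  rw [cancel_mono] at h
  have := Spec.map_injective h
  ext z
  exact congr($(this).hom z)

end

/-! ### Nikulin involutions from automorphisms of the function field -/

section

variable {X : Scheme.{0}} [X.Over SpecC] [IsIntegral X]

/-- An involution of the function field of a K3 surface that preserves the two-form comes from a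
Nikulin involution. -/
theorem exists_isNikulinInvolution (hX : IsK3Surface X)
    (htr : Algebra.trdeg ℂ X.functionField ≤ 2) {f t x : X.functionField} (h0 : f • wedge t x ≠ 0)
    (hreg : ∀ V : Subalgebra ℂ X.functionField, (∀ x, x ∈ V ∨ x⁻¹ ∈ V) →
      f • wedge t x ∈ formsOf V)
    {σ : X.functionField →ₐ[ℂ] X.functionField} (hσσ : ∀ z, σ (σ z) = z)
    (hσ1 : σ ≠ AlgHom.id ℂ _) (hσ : formPullback σ (f • wedge t x) = f • wedge t x) :
    ∃ i : AutC X, IsNikulinInvolution i ∧ IsComorphism (autHom i).toRationalMap σ := by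
  have hiff := mem_holomorphicTwoForms_iff hX h0 hreg
  obtain ⟨ω₀, hω₀⟩ := exists_isCanonicalGenerator hX
  have := hX.isProper
  have := hX.smooth
  have : Smooth (X ↘ SpecC) := SmoothOfRelativeDimension.smooth 2 _
  have hω0 : ω₀ ≠ 0 := by
    rintro rfl
    obtain ⟨g, hg⟩ := hω₀.exists_smul f t x
    exact h0 (hg.trans (smul_zero g))
  have hhol : ∀ ω ∈ holomorphicTwoForms X, formPullback σ ω = ω := by
    intro ω hω
    obtain ⟨a, rfl⟩ := (hiff ω).mp hω
    rw [formPullback_smul, hσ, σ.commutes]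
  have hσω₀ : formPullback σ ω₀ = ω₀ := by
    refine hhol _ ((AddSubgroup.mem_iInf).mpr fun p => ?_)
    rw [localTwoForms_eq]
    exact hω₀.mem_formsOf p
  obtain ⟨g, hg, hgσ⟩ := exists_hom_isComorphism σ fun x hx =>
    exists_forall_mem_localRing htr hω₀ hω0 σ σ hσσ hσω₀ hx
  obtain ⟨i, rfl⟩ := exists_autC hσσ hσσ hg hg hgσ hgσ
  refine ⟨i, ⟨?_, ?_, σ, hgσ, hhol⟩, hgσ⟩
  · rintro rfl
    exact hσ1 (isComorphism_unique hgσ isComorphism_one)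
  · refine autC_ext (isComorphism_mul hgσ hgσ) ?_
    rw [show σ.comp σ = AlgHom.id ℂ _ from AlgHom.ext hσσ]
    exact isComorphism_one

end

/-! ### Birational equivalence from isomorphic function fields -/

section

variable {X Y : Scheme.{0}} [X.Over SpecC] [Y.Over SpecC] [IsIntegral X] [IsIntegral Y]

lemma SpecMap_fromSpecStalk_apply (σ : Y.functionField →ₐ[ℂ] X.functionField)
    (a : Spec X.functionField) :
    (Spec.map (CommRingCat.ofHom σ.toRingHom) ≫ Y.fromSpecStalk (genericPoint Y)) a =
      genericPoint Y := by
  rw [Scheme.Hom.comp_apply]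
  have : Spec.map (CommRingCat.ofHom σ.toRingHom) a =
      IsLocalRing.closedPoint Y.functionField :=
    Subsingleton.elim (α := PrimeSpectrum Y.functionField) _ _
  erw [this]
  exact Scheme.fromSpecStalk_closedPoint

/-- Varieties with isomorphic function fields are birational. -/
theorem birationalOver_of_algHom [LocallyOfFiniteType (X ↘ SpecC)]
    [LocallyOfFiniteType (Y ↘ SpecC)] [IsSeparated (X ↘ SpecC)] [IsSeparated (Y ↘ SpecC)]
    {σ : Y.functionField →ₐ[ℂ] X.functionField} {τ : X.functionField →ₐ[ℂ] Y.functionField}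
    (h1 : ∀ z, σ (τ z) = z) (h2 : ∀ z, τ (σ z) = z) :
    Scheme.BirationalOver (X ↘ SpecC) (Y ↘ SpecC) := by
  have : X.IsSeparated := isSeparated_of_over X
  have : Y.IsSeparated := isSeparated_of_over Y
  let sX := Spec.map (CommRingCat.ofHom σ.toRingHom) ≫ Y.fromSpecStalk (genericPoint Y)
  let sY := Spec.map (CommRingCat.ofHom τ.toRingHom) ≫ X.fromSpecStalk (genericPoint X)
  -- Both field maps spread out to morphisms `f` on `U` and `g` on `V`. Their composites are the
  -- inclusions, since this holds at the generic points. So `f` and `g` restrict to inverse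
  -- isomorphisms between `f⁻¹(V)` and `g⁻¹(U)`.
  obtain ⟨U, hU, f, hf, hfo⟩ := spread_out_of_isGermInjective' (X ↘ SpecC) (Y ↘ SpecC) sX
    (SpecMap_comp_fromSpecStalk_over σ)
  obtain ⟨V, hV, g, hg, hgo⟩ := spread_out_of_isGermInjective' (Y ↘ SpecC) (X ↘ SpecC) sY
    (SpecMap_comp_fromSpecStalk_over τ)
  have key : ∀ {X Y : Scheme.{0}} [X.Over SpecC] [Y.Over SpecC] [IsIntegral X] [IsIntegral Y]
      [X.IsSeparated] {σ : Y.functionField →ₐ[ℂ] X.functionField}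
      {τ : X.functionField →ₐ[ℂ] Y.functionField} (_ : ∀ z, σ (τ z) = z)
      {U : X.Opens} (hU : genericPoint X ∈ U) {V : Y.Opens} (hV : genericPoint Y ∈ V)
      {f : U.toScheme ⟶ Y} {g : V.toScheme ⟶ X}
      (_ : Spec.map (CommRingCat.ofHom σ.toRingHom) ≫ Y.fromSpecStalk (genericPoint Y) =
        U.fromSpecStalkOfMem _ hU ≫ f)
      (_ : Spec.map (CommRingCat.ofHom τ.toRingHom) ≫ X.fromSpecStalk (genericPoint X) =
        V.fromSpecStalkOfMem _ hV ≫ g),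
      IsDominant ((f ⁻¹ᵁ V).ι ≫ U.ι) ∧ (f ∣_ V) ≫ g = (f ⁻¹ᵁ V).ι ≫ U.ι := by
    intro X Y _ _ _ _ _ σ τ h1 U hU V hV f g hf hg
    let m := U.fromSpecStalkOfMem _ hU
    have hm : Set.range m ⊆ Set.range (f ⁻¹ᵁ V).ι := by
      rintro _ ⟨a, rfl⟩
      rw [Scheme.Opens.range_ι]
      change f (m a) ∈ V
      rw [← Scheme.Hom.comp_apply, ← hf, SpecMap_fromSpecStalk_apply]
      exact hV
    let m' : Spec X.functionField ⟶ (f ⁻¹ᵁ V) := IsOpenImmersion.lift (f ⁻¹ᵁ V).ι m hm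
    have hm' : m' ≫ (f ⁻¹ᵁ V).ι = m := IsOpenImmersion.lift_fac _ _ _
    have hmX : m' ≫ (f ⁻¹ᵁ V).ι ≫ U.ι = X.fromSpecStalk (genericPoint X) := by
      rw [← Category.assoc, hm']
      exact Scheme.Opens.fromSpecStalkOfMem_ι U _ hU
    have hd : IsDominant (m' ≫ (f ⁻¹ᵁ V).ι ≫ U.ι) := by
      rw [hmX]
      infer_instance
    have hd1 : IsDominant m' := IsDominant.of_comp_of_isOpenImmersion m' ((f ⁻¹ᵁ V).ι ≫ U.ι)
    refine ⟨IsDominant.of_comp m' _, ?_⟩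
    refine ext_of_isDominant m' ?_
    rw [hmX]
    have h3 : m' ≫ (f ∣_ V) = Spec.map (CommRingCat.ofHom σ.toRingHom) ≫
        V.fromSpecStalkOfMem _ hV := by
      rw [← cancel_mono V.ι, Category.assoc, morphismRestrict_ι, ← Category.assoc, hm', ← hf,
        Category.assoc, Scheme.Opens.fromSpecStalkOfMem_ι]
    rw [← Category.assoc, h3, Category.assoc, ← hg, ← Category.assoc, ← Spec.map_comp,
      ← CommRingCat.ofHom_comp, show σ.toRingHom.comp τ.toRingHom = RingHom.id _ from
      RingHom.ext h1, CommRingCat.ofHom_id, Spec.map_id]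
    exact Category.id_comp _
  obtain ⟨hd1, e1⟩ := key h1 hU hV hf hg
  obtain ⟨hd2, e2⟩ := key h2 hV hU hg hf
  have hr1 : Set.range (f ∣_ V) ⊆ Set.range (g ⁻¹ᵁ U).ι := by
    rintro _ ⟨a, rfl⟩
    rw [Scheme.Opens.range_ι]
    change g ((f ∣_ V) a) ∈ U
    rw [← Scheme.Hom.comp_apply, e1, Scheme.Hom.comp_apply]
    exact ((f ⁻¹ᵁ V).ι a).2
  have hr2 : Set.range (g ∣_ U) ⊆ Set.range (f ⁻¹ᵁ V).ι := by
    rintro _ ⟨a, rfl⟩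
    rw [Scheme.Opens.range_ι]
    change f ((g ∣_ U) a) ∈ V
    rw [← Scheme.Hom.comp_apply, e2, Scheme.Hom.comp_apply]
    exact ((g ⁻¹ᵁ U).ι a).2
  let F := IsOpenImmersion.lift (g ⁻¹ᵁ U).ι (f ∣_ V) hr1
  let G := IsOpenImmersion.lift (f ⁻¹ᵁ V).ι (g ∣_ U) hr2
  have hF : F ≫ (g ⁻¹ᵁ U).ι = f ∣_ V := IsOpenImmersion.lift_fac _ _ _
  have hG : G ≫ (f ⁻¹ᵁ V).ι = g ∣_ U := IsOpenImmersion.lift_fac _ _ _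
  have hFG : F ≫ G = 𝟙 _ := by
    rw [← cancel_mono ((f ⁻¹ᵁ V).ι ≫ U.ι), Category.assoc, reassoc_of% hG, morphismRestrict_ι,
      reassoc_of% hF, e1, Category.id_comp]
  have hGF : G ≫ F = 𝟙 _ := by
    rw [← cancel_mono ((g ⁻¹ᵁ U).ι ≫ V.ι), Category.assoc, reassoc_of% hF, morphismRestrict_ι,
      reassoc_of% hG, e2, Category.id_comp]
  have hFiso : IsIso F := ⟨G, hFG, hGF⟩
  have hb1 := Scheme.Hom.birationalOver ((f ⁻¹ᵁ V).ι ≫ U.ι) (X ↘ SpecC) _ rfl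
  have hb2 := Scheme.Hom.birationalOver (F ≫ (g ⁻¹ᵁ U).ι ≫ V.ι) (Y ↘ SpecC)
    (((f ⁻¹ᵁ V).ι ≫ U.ι) ≫ X ↘ SpecC) (by
      rw [reassoc_of% hF, morphismRestrict_ι, Category.assoc, Category.assoc, hfo])
  exact hb1.symm.trans hb2

end

/-! ### The function field of a quotient -/

lemma exists_algHom_of_range_le {K K' L : Type} [Field K] [Field K'] [Field L] [Algebra ℂ K]
    [Algebra ℂ K'] [Algebra ℂ L] (σ : K →ₐ[ℂ] L) (σ' : K' →ₐ[ℂ] L)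
    (h : ∀ z, σ z ∈ Set.range σ') : ∃ e : K →ₐ[ℂ] K', ∀ z, σ' (e z) = σ z := by
  choose e he using h
  have hinj := σ'.toRingHom.injective
  refine ⟨{ toFun := e
            map_one' := hinj (by simp [he])
            map_mul' := fun a b => hinj (by simp [he])
            map_zero' := hinj (by simp [he])
            map_add' := fun a b => hinj (by simp [he])
            commutes' := fun c => hinj (by simp [he]) }, he⟩

lemma appLE_scalarSection {X Y : Scheme.{0}} [X.Over SpecC] [Y.Over SpecC] (f : X ⟶ Y)
    (hf : f ≫ Y ↘ SpecC = X ↘ SpecC) (U : Y.Opens) (z : ℂ) :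
    f.app U (scalarSection Y U z) = scalarSection X (f ⁻¹ᵁ U) z := by
  have h : (Y ↘ SpecC).appLE ⊤ U (show U ≤ (Y ↘ SpecC) ⁻¹ᵁ ⊤ from le_top) ≫ f.app U =
      (X ↘ SpecC).appLE ⊤ (f ⁻¹ᵁ U) (show f ⁻¹ᵁ U ≤ (X ↘ SpecC) ⁻¹ᵁ ⊤ from le_top) := by
    rw [Scheme.Hom.app_eq_appLE, Scheme.Hom.appLE_comp_appLE]
    congr 1
  exact congr($(h).hom ((Scheme.ΓSpecIso (.of ℂ)).inv.hom z))

/-- A comorphism is specified only at the generic points; this ties it to the pullback of sections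
over open subsets. -/
lemma comorphism_germ {X Y : Scheme.{0}} [X.Over SpecC] [Y.Over SpecC] [IsIntegral X]
    [IsIntegral Y] {f : X ⟶ Y} {σ : Y.functionField →ₐ[ℂ] X.functionField}
    (hf : IsComorphism f.toRationalMap σ) {V : Y.Opens} (hV : genericPoint Y ∈ V) {W : X.Opens}
    (hW : genericPoint X ∈ W) (h : W ≤ f ⁻¹ᵁ V) (s : Γ(Y, V)) :
    σ (Y.presheaf.germ V _ hV s) = X.presheaf.germ W _ hW (f.appLE V W h s) := by
  rw [isComorphism_toRationalMap_iff] at hf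
  have hsp : genericPoint Y ⤳ f (genericPoint X) := (genericPoint_spec Y).specializes trivial
  let σ' : Y.functionField ⟶ X.functionField := CommRingCat.ofHom σ.toRingHom
  have h1 : Y.presheaf.stalkSpecializes hsp ≫ σ' = f.stalkMap (genericPoint X) := by
    apply Spec.map_injective
    rw [← cancel_mono (Y.fromSpecStalk (f (genericPoint X))),
      Scheme.SpecMap_stalkMap_fromSpecStalk, hf, Spec.map_comp, Category.assoc,
      Scheme.SpecMap_stalkSpecializes_fromSpecStalk]
    rfl
  have hfV : f (genericPoint X) ∈ V := h hW
  have h2 : Y.presheaf.germ V _ hV ≫ σ' = f.appLE V W h ≫ X.presheaf.germ W _ hW := by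
    rw [← Y.presheaf.germ_stalkSpecializes hfV hsp, Category.assoc, h1,
      Scheme.Hom.germ_stalkMap, Scheme.Hom.appLE, Category.assoc, X.presheaf.germ_res]
  exact congr($(h2).hom s)

section

variable {X Q : Scheme.{0}} [X.Over SpecC] [Q.Over SpecC] [IsIntegral X] [IsIntegral Q]

/-- The function field of a quotient is the field of invariant functions. -/
theorem exists_range_eq_invariants {G : Subgroup (AutC X)} {q : X ⟶ Q} (hq : IsQuotient G q)
    (hG : ∀ g ∈ G, ∃ τ, IsComorphism (autHom g).toRationalMap τ) :
    ∃ σ : Q.functionField →ₐ[ℂ] X.functionField, ∀ f, f ∈ Set.range σ ↔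
      ∀ g ∈ G, ∀ τ, IsComorphism (autHom g).toRationalMap τ → τ f = f := by
  obtain ⟨U, hU, hgU⟩ := exists_affine (genericPoint Q)
  have hUne : Nonempty U := ⟨⟨_, hgU⟩⟩
  let W := q ⁻¹ᵁ U
  have hWne : Nonempty W := by
    obtain ⟨w, hw⟩ := hq.surjective (genericPoint Q)
    exact ⟨⟨w, show q w ∈ U from hw ▸ hgU⟩⟩
  have := hq.isFinite
  have hWaff : IsAffineOpen W := hU.preimage q
  have hgW : genericPoint X ∈ W :=
    ((genericPoint_spec X).mem_open_set_iff W.isOpen).mpr (by simpa using hWne)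
  have := functionField_isFractionRing_of_isAffineOpen Q U hU
  have := functionField_isFractionRing_of_isAffineOpen X W hWaff
  let β : Γ(Q, U) →+* X.functionField := (X.germToFunctionField W).hom.comp (q.app U).hom
  have hβ : Function.Injective β := (X.germToFunctionField_injective W).comp (hq.injective U)
  let σ₀ : Q.functionField →+* X.functionField := IsFractionRing.lift hβ
  have hσ₀ : ∀ s, σ₀ (Q.germToFunctionField U s) = X.germToFunctionField W (q.app U s) :=
    fun s => IsFractionRing.lift_algebraMap hβ s
  let σ : Q.functionField →ₐ[ℂ] X.functionField :=
    { σ₀ with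
      commutes' := fun z => by
        change σ₀ (algebraMap ℂ Q.functionField z) = algebraMap ℂ X.functionField z
        rw [← germ_scalarSection Q U hgU, ← germ_scalarSection X W hgW,
          ← appLE_scalarSection q hq.comp_structure U z]
        exact hσ₀ _ }
  have hinv : ∀ g ∈ G, W ≤ autHom g ⁻¹ᵁ W := by
    intro g hg
    change q ⁻¹ᵁ U ≤ autHom g ⁻¹ᵁ (q ⁻¹ᵁ U)
    rw [← Scheme.Hom.comp_preimage, hq.invariant g hg]
  have key : ∀ g ∈ G, ∀ τ, IsComorphism (autHom g).toRationalMap τ → ∀ s : Γ(Q, U),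
      τ (σ (algebraMap _ _ s)) = σ (algebraMap _ _ s) := by
    intro g hg τ hτ s
    change τ (σ₀ (Q.germToFunctionField U s)) = σ₀ (Q.germToFunctionField U s)
    rw [hσ₀]
    refine (comorphism_germ hτ hgW hgW (hinv g hg) _).trans ?_
    congr 1
    have h1 : q.app U ≫ (autHom g).appLE W W (hinv g hg) = q.app U := by
      rw [Scheme.Hom.app_eq_appLE, Scheme.Hom.appLE_comp_appLE]
      congr 1
      exact hq.invariant g hg
    exact congr($(h1).hom s)
  refine ⟨σ, fun f => ⟨?_, fun hf => ?_⟩⟩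
  · rintro ⟨z, rfl⟩ g hg τ hτ
    obtain ⟨a, b, hb, rfl⟩ := IsFractionRing.div_surjective (A := Γ(Q, U)) z
    rw [map_div₀, map_div₀, key g hg τ hτ, key g hg τ hτ]
  · have hintg : (q.app U).hom.IsIntegral := (IsFinite.finite_app q U hU).to_isIntegral
    let _ : Algebra Γ(Q, U) Γ(X, W) := (q.app U).hom.toAlgebra
    have : Algebra.IsIntegral Γ(Q, U) Γ(X, W) := ⟨hintg⟩
    obtain ⟨b, a, ha, rfl⟩ := IsFractionRing.div_surjective (A := Γ(X, W)) f
    have ha0 : a ≠ 0 := nonZeroDivisors.ne_zero ha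
    -- By integrality the denominator `a` divides a nonzero function `a'` coming from `Q`. With
    -- invariant denominator `a'`, the numerator `b c` of an invariant fraction is invariant and
    -- descends to `Q`.
    obtain ⟨a', ha', c, hc⟩ : ∃ a' : Γ(Q, U), a' ≠ 0 ∧ ∃ c, q.app U a' = a * c := by
      have hfs : FaithfulSMul Γ(Q, U) Γ(X, W) :=
        (faithfulSMul_iff_algebraMap_injective _ _).mpr (hq.injective U)
      exact (Algebra.IsIntegral.isIntegral (R := Γ(Q, U)) a).isAlgebraic.exists_nonzero_dvd ha
    have hac : algebraMap Γ(X, W) X.functionField a ≠ 0 := by simpa using ha0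
    have ha'0 : σ (algebraMap _ _ a') ≠ 0 := by
      simpa using ha'
    have h1 : algebraMap Γ(X, W) X.functionField b / algebraMap Γ(X, W) X.functionField a =
        algebraMap Γ(X, W) X.functionField (b * c) / σ (algebraMap _ _ a') := by
      have : σ (algebraMap _ _ a') = algebraMap Γ(X, W) X.functionField (a * c) := by
        rw [← hc]; exact hσ₀ a'
      rw [this] at ha'0 ⊢
      rw [map_mul] at ha'0 ⊢
      have hcc := right_ne_zero_of_mul ha'0
      rw [map_mul]
      field_simp
    obtain ⟨r, hr⟩ := hq.invariants U (b * c) (by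
      intro g hg h
      obtain ⟨τ, hτ⟩ := hG g hg
      apply X.germToFunctionField_injective W
      refine (comorphism_germ hτ hgW hgW h (b * c)).symm.trans ?_
      have h2 := hf g hg τ hτ
      rw [h1, map_div₀] at h2
      rw [key g hg τ hτ] at h2
      exact (div_left_inj' ha'0).mp h2)
    refine ⟨algebraMap _ _ r / algebraMap _ _ a', ?_⟩
    rw [h1, map_div₀]
    congr 1
    rw [← hr]
    exact hσ₀ r

/-- If the field of functions on `X` that are invariant under `G` is the image of `ℂ(Y)`, then the
quotient of `X` by `G` is birational to `Y`. -/
theorem quotientBirationalTo_of_range {Y : Scheme.{0}} [Y.Over SpecC] [IsIntegral Y]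
    [LocallyOfFiniteType (Y ↘ SpecC)] [IsSeparated (Y ↘ SpecC)] {G : Subgroup (AutC X)}
    (hG : ∀ g ∈ G, ∃ τ, IsComorphism (autHom g).toRationalMap τ)
    (ρ : Y.functionField →ₐ[ℂ] X.functionField)
    (hρ : ∀ f, f ∈ Set.range ρ ↔ ∀ g ∈ G, ∀ τ, IsComorphism (autHom g).toRationalMap τ → τ f = f) :
    QuotientBirationalTo X Y G := by
  intro Q _ q hQ hq
  have := hQ.isIntegral
  have := hQ.isSeparated
  have := hQ.locallyOfFiniteType
  obtain ⟨σ, hσ⟩ := exists_range_eq_invariants hq hG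
  obtain ⟨e, he⟩ := exists_algHom_of_range_le σ ρ fun z => (hρ _).mpr ((hσ _).mp ⟨z, rfl⟩)
  obtain ⟨e', he'⟩ := exists_algHom_of_range_le ρ σ fun z => (hσ _).mpr ((hρ _).mp ⟨z, rfl⟩)
  exact birationalOver_of_algHom (σ := e') (τ := e)
    (fun z => σ.toRingHom.injective ((he' _).trans (he z)))
    (fun z => ρ.toRingHom.injective ((he _).trans (he' z)))

/-- The invariants of a group generated by involutions. -/
lemma invariant_closure_iff {s : Set (AutC X)} (hs : ∀ g ∈ s, g * g = 1)
    (p : AutC X → X.functionField →ₐ[ℂ] X.functionField)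
    (hp : ∀ g ∈ s, IsComorphism (autHom g).toRationalMap (p g)) :
    (∀ g ∈ Subgroup.closure s, ∃ τ, IsComorphism (autHom g).toRationalMap τ) ∧
      ∀ f, (∀ g ∈ Subgroup.closure s, ∀ τ, IsComorphism (autHom g).toRationalMap τ → τ f = f) ↔
        ∀ g ∈ s, p g f = f := by
  have key : ∀ g ∈ Subgroup.closure s, ∃ τ, IsComorphism (autHom g).toRationalMap τ ∧
      ∀ f, (∀ g ∈ s, p g f = f) → τ f = f := by
    intro g hg
    have hinv : ∀ g ∈ s, g⁻¹ = g := fun g hg => inv_eq_of_mul_eq_one_left (hs g hg)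
    induction hg using Subgroup.closure_induction'' with
    | mem g hg => exact ⟨p g, hp g hg, fun f hf => hf g hg⟩
    | inv_mem g hg => rw [hinv g hg]; exact ⟨p g, hp g hg, fun f hf => hf g hg⟩
    | one => exact ⟨AlgHom.id ℂ _, isComorphism_one, fun f _ => rfl⟩
    | mul g h _ _ hg hh =>
      obtain ⟨σ, hσ, hσf⟩ := hg
      obtain ⟨τ, hτ, hτf⟩ := hh
      exact ⟨_, isComorphism_mul hσ hτ, fun f hf => by simp [hσf f hf, hτf f hf]⟩
  refine ⟨fun g hg => ⟨_, (key g hg).choose_spec.1⟩, fun f => ⟨fun h g hg => ?_, fun h g hg τ hτ => ?_⟩⟩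
  · exact h g (Subgroup.subset_closure hg) _ (hp g hg)
  · obtain ⟨τ', hτ', hf⟩ := key g hg
    rw [isComorphism_unique hτ hτ']
    exact hf f h

end

/-! ### The function field of the Kummer surface -/

section

variable {l₁ l₂ : ℂ} {S : Scheme.{0}} [IsIntegral S] (κ : S.PartialIso (kummerQuotient l₁ l₂))

lemma genericPoint_mem_source : genericPoint S ∈ κ.source :=
  ((genericPoint_spec S).mem_open_set_iff κ.source.isOpen).mpr (by
    simpa using κ.dense_source.nonempty)

lemma SpecMap_kummerFunction :
    Spec.map (CommRingCat.ofHom (kummerFunction κ)) =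
      κ.source.fromSpecStalkOfMem _ (genericPoint_mem_source κ) ≫ κ.iso.hom ≫ κ.target.ι := by
  rw [kummerFunction, CommRingCat.ofHom_hom]
  exact Spec.map_preimage _

/-- The generic point of `S` maps to a dense point, so the kernel consists of nilpotents. This
avoids proving that the invariant ring is a domain. -/
lemma isNilpotent_of_kummerFunction_eq_zero {a : kummerRing l₁ l₂} (ha : kummerFunction κ a = 0) :
    IsNilpotent a := by
  have hd : IsDominant (κ.source.fromSpecStalkOfMem _ (genericPoint_mem_source κ) ≫
      κ.source.ι) := by
    rw [Scheme.Opens.fromSpecStalkOfMem_ι]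
    infer_instance
  have hd1 : IsDominant (κ.source.fromSpecStalkOfMem _ (genericPoint_mem_source κ)) :=
    IsDominant.of_comp_of_isOpenImmersion _ κ.source.ι
  have hd2 : IsDominant κ.target.ι := AlgebraicGeometry.Opens.isDominant_ι κ.dense_target
  have hd4 : IsDominant (κ.source.fromSpecStalkOfMem _ (genericPoint_mem_source κ) ≫
      κ.iso.hom ≫ κ.target.ι) := inferInstance
  have hd3 : IsDominant (Spec.map (CommRingCat.ofHom (kummerFunction κ))) := by
    rw [SpecMap_kummerFunction]
    exact hd4
  have h := (PrimeSpectrum.denseRange_comap_iff_ker_le_nilRadical (kummerFunction κ)).mp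
    hd3.denseRange
  exact h ha

/-- As an isomorphism of dense opens, `κ` makes the generic point of `S` a preimmersion into the
affine quotient. Surjectivity on stalks then says that every rational function is a fraction of
invariant ones. -/
lemma exists_eq_div_kummerFunction (z : S.functionField) :
    ∃ a b : kummerRing l₁ l₂, z = kummerFunction κ a / kummerFunction κ b := by
  have hp : IsPreimmersion (κ.source.fromSpecStalkOfMem _ (genericPoint_mem_source κ) ≫
      κ.source.ι) := by
    rw [Scheme.Opens.fromSpecStalkOfMem_ι]
    infer_instance
  have hp1 : IsPreimmersion (κ.source.fromSpecStalkOfMem _ (genericPoint_mem_source κ)) :=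
    IsPreimmersion.of_comp _ κ.source.ι
  have hp3 : IsPreimmersion (κ.source.fromSpecStalkOfMem _ (genericPoint_mem_source κ) ≫
      κ.iso.hom ≫ κ.target.ι) := inferInstance
  have hp2 : IsPreimmersion (Spec.map (CommRingCat.ofHom (kummerFunction κ))) := by
    rw [SpecMap_kummerFunction]
    exact hp3
  have h := ((IsPreimmersion.SpecMap_iff _).mp hp2).2
  obtain ⟨a, b, c, hc, hb, h⟩ := (RingHom.surjectiveOnStalks_iff_forall_ideal.mp h) ⊥
    bot_ne_top z
  refine ⟨a, b, ?_⟩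
  have hc : c ≠ 0 := hc
  have hb : kummerFunction κ b ≠ 0 := hb
  rw [mul_assoc] at h
  rw [eq_div_iff hb, mul_comm]
  exact mul_left_cancel₀ hc h

lemma kummerFunction_algebraMap [S.Over SpecC]
    (hκ : κ.IsOver (S ↘ SpecC) (kummerQuotient l₁ l₂ ↘ SpecC)) (z : ℂ) :
    kummerFunction κ (algebraMap ℂ _ z) = algebraMap ℂ S.functionField z := by
  have h : Spec.map (CommRingCat.ofHom (kummerFunction κ)) ≫ (kummerQuotient l₁ l₂ ↘ SpecC) =
      S.fromSpecStalk (genericPoint S) ≫ (S ↘ SpecC) := by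
    have h : (κ.source.fromSpecStalkOfMem _ (genericPoint_mem_source κ) ≫
        κ.iso.hom ≫ κ.target.ι) ≫ (kummerQuotient l₁ l₂ ↘ SpecC) =
        S.fromSpecStalk (genericPoint S) ≫ (S ↘ SpecC) := by
      rw [Category.assoc, Category.assoc, hκ, Scheme.Opens.fromSpecStalkOfMem_ι_assoc]
    rw [SpecMap_kummerFunction]
    exact h
  rw [fromSpecStalk_genericPoint_over] at h
  have h2 : Spec.map (CommRingCat.ofHom (kummerFunction κ)) ≫
      Spec.map (CommRingCat.ofHom (algebraMap ℂ (kummerRing l₁ l₂))) =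
      Spec.map (CommRingCat.ofHom (algebraMap ℂ S.functionField)) := h
  rw [← Spec.map_comp] at h2
  exact congr($(Spec.map_injective h2).hom z)

end

/-! ### The invariant functions on a product of Legendre curves -/

lemma algebraMap_legendreRing (l : ℂ) (p : Polynomial ℂ) :
    algebraMap (Polynomial ℂ) (LegendreRing l) p = Polynomial.aeval (xE l) p := by
  induction p using Polynomial.induction_on' with
  | add p q hp hq => rw [map_add, map_add, hp, hq]
  | monomial n a =>
    rw [Polynomial.aeval_monomial, ← Polynomial.C_mul_X_pow_eq_monomial, map_mul, map_pow]
    rfl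

lemma exists_eq_aeval_add (l : ℂ) (z : LegendreRing l) :
    ∃ p q : Polynomial ℂ, z = Polynomial.aeval (xE l) p + Polynomial.aeval (xE l) q * yE l := by
  obtain ⟨p, q, rfl⟩ := WeierstrassCurve.Affine.CoordinateRing.exists_smul_basis_eq z
  refine ⟨p, q, ?_⟩
  rw [Algebra.smul_def, Algebra.smul_def, algebraMap_legendreRing, algebraMap_legendreRing, mul_one]
  rfl

lemma yE_sq (l : ℂ) : yE l ^ 2 = xE l * (xE l - 1) * (xE l - algebraMap ℂ _ l) := by
  have h : Polynomial.eval₂ (algebraMap (Polynomial ℂ) (LegendreRing l)) (yE l)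
    (legendre l).polynomial = 0 := AdjoinRoot.eval₂_root (legendre l).polynomial
  rw [eval₂_legendre, algebraMap_legendreRing, sub_eq_zero] at h
  rw [h]
  simp
  ring

/-- A point of the Legendre curve with given first coordinate. -/
lemma exists_legendreRing_algHom (l a : ℂ) : ∃ e : LegendreRing l →ₐ[ℂ] ℂ, e (xE l) = a := by
  obtain ⟨b, hb⟩ := IsAlgClosed.exists_pow_nat_eq (a ^ 3 + -(1 + l) * a ^ 2 + l * a)
    (n := 2) two_pos
  have h : Polynomial.eval₂ (Polynomial.aeval a : Polynomial ℂ →ₐ[ℂ] ℂ).toRingHom b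
      (legendre l).polynomial = 0 := by
    rw [eval₂_legendre, hb]
    simp
  refine ⟨AdjoinRoot.liftAlgHom (legendre l).polynomial (Polynomial.aeval a) b h, ?_⟩
  refine (AdjoinRoot.lift_of h).trans ?_
  simp

/-! ### Generators and relations of the ring of invariants -/

section

variable (l₁ l₂ : ℂ)

/-- The invariant function `x₁`. -/
def kummerX₁ : kummerRing l₁ l₂ :=
  ⟨xE l₁ ⊗ₜ 1, by
    change Algebra.TensorProduct.map (negE l₁) (negE l₂) _ = _
    simp [negE_xE]⟩

/-- The invariant function `x₂`. -/
def kummerX₂ : kummerRing l₁ l₂ :=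
  ⟨1 ⊗ₜ xE l₂, by
    change Algebra.TensorProduct.map (negE l₁) (negE l₂) _ = _
    simp [negE_xE]⟩

/-- The invariant function `y₁ y₂`. -/
def kummerW : kummerRing l₁ l₂ :=
  ⟨yE l₁ ⊗ₜ yE l₂, by
    change Algebra.TensorProduct.map (negE l₁) (negE l₂) _ = _
    simp [negE_yE, TensorProduct.neg_tmul, TensorProduct.tmul_neg]⟩

lemma kummerNum_eq : kummerNum l₁ l₂ = kummerX₁ l₁ l₂ * kummerW l₁ l₂ := by
  apply Subtype.ext
  simp [kummerNum, kummerX₁, kummerW]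

lemma kummerDen_eq : kummerDen l₁ l₂ = kummerX₁ l₁ l₂ * (kummerX₁ l₁ l₂ - 1) *
    (kummerX₁ l₁ l₂ - algebraMap ℂ _ l₁) * kummerX₂ l₁ l₂ := by
  apply Subtype.ext
  simp only [kummerDen, kummerX₁, kummerX₂, yE_sq, MulMemClass.coe_mul, AddSubgroupClass.coe_sub,
    OneMemClass.coe_one, Subalgebra.coe_algebraMap, Algebra.TensorProduct.one_def,
    Algebra.TensorProduct.algebraMap_apply, ← TensorProduct.sub_tmul,
    Algebra.TensorProduct.tmul_mul_tmul, one_mul, mul_one]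

lemma kummerW_sq : kummerW l₁ l₂ ^ 2 =
    kummerX₁ l₁ l₂ * (kummerX₁ l₁ l₂ - 1) * (kummerX₁ l₁ l₂ - algebraMap ℂ _ l₁) *
      (kummerX₂ l₁ l₂ * (kummerX₂ l₁ l₂ - 1) * (kummerX₂ l₁ l₂ - algebraMap ℂ _ l₂)) := by
  apply Subtype.ext
  have h : (algebraMap ℂ (LegendreRing l₁ ⊗[ℂ] LegendreRing l₂) l₂) =
      1 ⊗ₜ algebraMap ℂ (LegendreRing l₂) l₂ :=
    (Algebra.TensorProduct.algebraMap_apply' l₂)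
  simp only [kummerW, kummerX₁, kummerX₂, MulMemClass.coe_mul, AddSubgroupClass.coe_sub,
    SubmonoidClass.coe_pow, h,
    OneMemClass.coe_one, Subalgebra.coe_algebraMap, Algebra.TensorProduct.one_def,
    Algebra.TensorProduct.algebraMap_apply, ← TensorProduct.sub_tmul, ← TensorProduct.tmul_sub,
    Algebra.TensorProduct.tmul_mul_tmul, one_mul, mul_one, Algebra.TensorProduct.tmul_pow, yE_sq]

lemma negE_aeval (l : ℂ) (p : Polynomial ℂ) :
    negE l (Polynomial.aeval (xE l) p) = Polynomial.aeval (xE l) p := by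
  rw [← Polynomial.aeval_algHom_apply, negE_xE]

/-- The invariant functions are generated by `x₁`, `x₂` and `y₁ y₂`. -/
lemma mem_adjoin_kummer (a : kummerRing l₁ l₂) :
    a ∈ Algebra.adjoin ℂ {kummerX₁ l₁ l₂, kummerX₂ l₁ l₂, kummerW l₁ l₂} := by
  let ι := Algebra.TensorProduct.map (negE l₁) (negE l₂)
  let B : Subalgebra ℂ (LegendreRing l₁ ⊗[ℂ] LegendreRing l₂) :=
    Algebra.adjoin ℂ {(kummerX₁ l₁ l₂).1, (kummerX₂ l₁ l₂).1, (kummerW l₁ l₂).1}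
  have hmap : (Algebra.adjoin ℂ {kummerX₁ l₁ l₂, kummerX₂ l₁ l₂, kummerW l₁ l₂}).map
      (kummerRing l₁ l₂).val = B := by
    rw [AlgHom.map_adjoin]
    congr 1
    simp [Set.image_insert_eq]
  have h1 : ∀ p : Polynomial ℂ, Polynomial.aeval (xE l₁) p ⊗ₜ[ℂ] (1 : LegendreRing l₂) ∈ B := by
    intro p
    have : Polynomial.aeval (xE l₁) p ⊗ₜ[ℂ] (1 : LegendreRing l₂) =
        Polynomial.aeval (kummerX₁ l₁ l₂ : LegendreRing l₁ ⊗[ℂ] LegendreRing l₂) p :=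
      (Polynomial.aeval_algHom_apply (Algebra.TensorProduct.includeLeft (R := ℂ) (S := ℂ)) _ _).symm
    rw [this]
    exact Algebra.adjoin_mono (by simp) (Polynomial.aeval_mem_adjoin_singleton ℂ _)
  have h2 : ∀ p : Polynomial ℂ, (1 : LegendreRing l₁) ⊗ₜ[ℂ] Polynomial.aeval (xE l₂) p ∈ B := by
    intro p
    have : (1 : LegendreRing l₁) ⊗ₜ[ℂ] Polynomial.aeval (xE l₂) p =
        Polynomial.aeval (kummerX₂ l₁ l₂ : LegendreRing l₁ ⊗[ℂ] LegendreRing l₂) p :=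
      (Polynomial.aeval_algHom_apply (Algebra.TensorProduct.includeRight (R := ℂ)) _ _).symm
    rw [this]
    exact Algebra.adjoin_mono (by simp) (Polynomial.aeval_mem_adjoin_singleton ℂ _)
  have h3 : yE l₁ ⊗ₜ[ℂ] yE l₂ ∈ B := Algebra.subset_adjoin (by right; right; rfl)
  -- Summing over the group keeps only the terms with `1` and with `y₁y₂`; an invariant element is
  -- half of its own sum.
  have key : ∀ z, z + ι z ∈ B := by
    intro z
    induction z using TensorProduct.induction_on with
    | zero => simp
    | add z w hz hw =>
      rw [map_add, add_add_add_comm]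
      exact add_mem hz hw
    | tmul z w =>
      obtain ⟨p, q, rfl⟩ := exists_eq_aeval_add l₁ z
      obtain ⟨r, s, rfl⟩ := exists_eq_aeval_add l₂ w
      have : ∀ (a b : LegendreRing l₁) (c d : LegendreRing l₂),
          (a + b * yE l₁) ⊗ₜ[ℂ] (c + d * yE l₂) + (a + b * -yE l₁) ⊗ₜ[ℂ] (c + d * -yE l₂) =
          (2 : ℂ) • ((a ⊗ₜ 1) * (1 ⊗ₜ c) + (b ⊗ₜ 1) * (1 ⊗ₜ d) * (yE l₁ ⊗ₜ yE l₂)) := by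
        intro a b c d
        simp only [Algebra.TensorProduct.tmul_mul_tmul, one_mul, mul_one, TensorProduct.add_tmul,
          TensorProduct.tmul_add, mul_neg, TensorProduct.neg_tmul, TensorProduct.tmul_neg]
        module
      simp only [ι, Algebra.TensorProduct.map_tmul, map_add, map_mul, negE_aeval, negE_yE]
      rw [this]
      exact Subalgebra.smul_mem _ (add_mem (mul_mem (h1 _) (h2 _))
        (mul_mem (mul_mem (h1 _) (h2 _)) h3)) _
  have ha : (a : LegendreRing l₁ ⊗[ℂ] LegendreRing l₂) ∈ B := by
    have h4 := key a
    have h5 : ι (a : LegendreRing l₁ ⊗[ℂ] LegendreRing l₂) = a := a.2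
    rw [h5] at h4
    have h6 := Subalgebra.smul_mem _ h4 (1 / 2 : ℂ)
    convert h6 using 1
    module
  rw [← hmap] at ha
  obtain ⟨b, hb, hba⟩ := ha
  rwa [← Subtype.ext hba]

end

/-- Coordinates on the Kummer surface. -/
lemma exists_kummer_coordinates {l₁ l₂ : ℂ} {S : Scheme.{0}} [S.Over SpecC] [IsIntegral S]
    (κ : S.PartialIso (kummerQuotient l₁ l₂))
    (hκ : κ.IsOver (S ↘ SpecC) (kummerQuotient l₁ l₂ ↘ SpecC)) :
    ∃ x₁ x₂ w : S.functionField, AlgebraicIndependent ℂ ![x₁, x₂] ∧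
      w ^ 2 = x₁ * (x₁ - 1) * (x₁ - algebraMap ℂ _ l₁) *
        (x₂ * (x₂ - 1) * (x₂ - algebraMap ℂ _ l₂)) ∧
      IntermediateField.adjoin ℂ {x₁, x₂, w} = ⊤ ∧
      kummerParameter κ = x₁ * w / (x₁ * (x₁ - 1) * (x₁ - algebraMap ℂ _ l₁) * x₂) := by
  let θ : kummerRing l₁ l₂ →ₐ[ℂ] S.functionField :=
    { kummerFunction κ with commutes' := kummerFunction_algebraMap κ hκ }
  have hθ : ∀ a, kummerFunction κ a = θ a := fun _ => rfl
  refine ⟨θ (kummerX₁ l₁ l₂), θ (kummerX₂ l₁ l₂), θ (kummerW l₁ l₂), ?_, ?_, ?_, ?_⟩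
  · rw [AlgebraicIndependent, injective_iff_map_eq_zero]
    intro P hP
    have hcomp : MvPolynomial.aeval ![θ (kummerX₁ l₁ l₂), θ (kummerX₂ l₁ l₂)] P =
        θ (MvPolynomial.aeval ![kummerX₁ l₁ l₂, kummerX₂ l₁ l₂] P) := by
      rw [← AlgHom.comp_apply, MvPolynomial.comp_aeval]
      congr 2
      funext i
      fin_cases i <;> rfl
    rw [hcomp] at hP
    obtain ⟨n, hn⟩ := isNilpotent_of_kummerFunction_eq_zero κ hP
    -- A relation between `x₁` and `x₂` is so far only nilpotent. Every pair of complex numbers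
    -- lifts to a point of `E₁ × E₂`, and evaluation there shows that the polynomial vanishes on all
    -- of ℂ².
    apply MvPolynomial.funext
    intro a
    obtain ⟨e₁, he₁⟩ := exists_legendreRing_algHom l₁ (a 0)
    obtain ⟨e₂, he₂⟩ := exists_legendreRing_algHom l₂ (a 1)
    let e : kummerRing l₁ l₂ →ₐ[ℂ] ℂ :=
      (Algebra.TensorProduct.lift e₁ e₂ fun _ _ => Commute.all _ _).comp (kummerRing l₁ l₂).val
    have he : e (MvPolynomial.aeval ![kummerX₁ l₁ l₂, kummerX₂ l₁ l₂] P) =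
        MvPolynomial.eval a P := by
      rw [← AlgHom.comp_apply, MvPolynomial.comp_aeval,
        show MvPolynomial.eval a P = MvPolynomial.aeval a P from
          (MvPolynomial.aeval_eq_eval a ▸ rfl)]
      congr 2
      funext i
      fin_cases i
      · simp [e, kummerX₁, he₁]
      · simp [e, kummerX₂, he₂]
    rw [map_zero, ← he]
    apply eq_zero_of_pow_eq_zero (n := n)
    rw [← map_pow, hn, map_zero]
  · rw [← map_pow, kummerW_sq]
    simp
  · rw [eq_top_iff]
    intro z _
    obtain ⟨a, b, rfl⟩ := exists_eq_div_kummerFunction κ z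
    have key : ∀ a, θ a ∈ IntermediateField.adjoin ℂ
        {θ (kummerX₁ l₁ l₂), θ (kummerX₂ l₁ l₂), θ (kummerW l₁ l₂)} := by
      intro a
      apply IntermediateField.algebra_adjoin_le_adjoin
      have h := Subalgebra.mem_map (f := θ).mpr ⟨a, mem_adjoin_kummer l₁ l₂ a, rfl⟩
      rw [AlgHom.map_adjoin] at h
      rw [Set.image_insert_eq, Set.image_insert_eq, Set.image_singleton] at h
      exact h
    exact div_mem (key a) (key b)
  · rw [kummerParameter, hθ, hθ, kummerNum_eq, kummerDen_eq]
    simp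

/-! ### Function fields of surfaces `y² = F(t, x)` -/

section

variable {K L : Type} [Field K] [Algebra ℂ K] [Field L] [Algebra ℂ L]

lemma isAlgebraic_of_gens {E : IntermediateField ℂ K} {t x y : K}
    (hgen : IntermediateField.adjoin ℂ {t, x, y} = ⊤) (ht : IsAlgebraic E t) (hx : IsAlgebraic E x)
    (hy : IsAlgebraic E y) : Algebra.IsAlgebraic E K := by
  let M : IntermediateField ℂ K := (algebraicClosure E K).restrictScalars ℂ
  have hM : M = ⊤ := by
    rw [eq_top_iff, ← hgen, IntermediateField.adjoin_le_iff]
    rintro z (rfl | rfl | rfl)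
    · exact mem_algebraicClosure_iff.mpr ht
    · exact mem_algebraicClosure_iff.mpr hx
    · exact mem_algebraicClosure_iff.mpr hy
  refine ⟨fun z => ?_⟩
  have hz : z ∈ M := hM ▸ IntermediateField.mem_top
  exact mem_algebraicClosure_iff.mp hz

lemma isAlgebraic_of_mem {E : IntermediateField ℂ K} {z : K} (hz : z ∈ E) : IsAlgebraic E z :=
  isAlgebraic_algebraMap (⟨z, hz⟩ : E)

lemma isAlgebraic_of_sq_mem {E : IntermediateField ℂ K} {z : K} (hz : z ^ 2 ∈ E) :
    IsAlgebraic E z :=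
  (isAlgebraic_of_mem hz).of_pow two_pos

/-- The function field of a double cover of the plane is algebraic over `ℂ(t, x)`. -/
lemma isAlgebraic_of_generate {t x y : K} (hgen : IntermediateField.adjoin ℂ {t, x, y} = ⊤)
    (hy : y ^ 2 ∈ IntermediateField.adjoin ℂ {t, x}) :
    Algebra.IsAlgebraic (IntermediateField.adjoin ℂ {t, x}) K :=
  isAlgebraic_of_gens hgen
    (isAlgebraic_of_mem (IntermediateField.subset_adjoin _ _ (by simp)))
    (isAlgebraic_of_mem (IntermediateField.subset_adjoin _ _ (by simp)))
    (isAlgebraic_of_sq_mem hy)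

lemma range_pair {α : Type} (t x : α) : Set.range ![t, x] = {t, x} := by
  simp [Matrix.range_cons, Set.pair_comm]

lemma isAlgebraic_adjoin_range {t x : K}
    (halg : Algebra.IsAlgebraic (IntermediateField.adjoin ℂ {t, x}) K) :
    Algebra.IsAlgebraic (Algebra.adjoin ℂ (Set.range ![t, x])) K := by
  rw [range_pair]
  exact IntermediateField.isAlgebraic_adjoin_iff_top.mp halg

lemma trdeg_eq_two {t x : K} (h : AlgebraicIndependent ℂ ![t, x])
    (halg : Algebra.IsAlgebraic (IntermediateField.adjoin ℂ {t, x}) K) :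
    Algebra.trdeg ℂ K = 2 := by
  have := isAlgebraic_adjoin_range halg
  have hb : IsTranscendenceBasis ℂ ![t, x] :=
    h.isTranscendenceBasis_iff_isAlgebraic.mpr this
  have := hb.cardinalMk_eq_trdeg
  simpa using this.symm

/-- Two functions over which a field of transcendence degree two is algebraic are independent. -/
lemma algebraicIndependent_of_isAlgebraic {t x : K} (htr : Algebra.trdeg ℂ K = 2)
    (halg : Algebra.IsAlgebraic (IntermediateField.adjoin ℂ {t, x}) K) :
    AlgebraicIndependent ℂ ![t, x] := by
  have := isAlgebraic_adjoin_range halg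
  exact (Algebra.IsAlgebraic.isTranscendenceBasis_of_le_trdeg_of_finite ℂ ![t, x] (by simp [htr])).1

lemma algHom_ext_of_generate {t x y : K} (hgen : IntermediateField.adjoin ℂ {t, x, y} = ⊤)
    {σ τ : K →ₐ[ℂ] L} (ht : σ t = τ t) (hx : σ x = τ x) (hy : σ y = τ y) : σ = τ := by
  have h : AlgHom.equalizer σ τ = ⊤ := by
    rw [eq_top_iff]
    intro z _
    have hz : z ∈ IntermediateField.adjoin ℂ {t, x, y} := hgen ▸ IntermediateField.mem_top
    obtain ⟨a, ha, b, hb, rfl⟩ := (IntermediateField.mem_adjoin_iff_div ..).mp hz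
    have key : Algebra.adjoin ℂ {t, x, y} ≤ AlgHom.equalizer σ τ := by
      rw [Algebra.adjoin_le_iff]
      rintro z (rfl | rfl | rfl) <;> assumption
    have h1 : σ a = τ a := key ha
    have h2 : σ b = τ b := key hb
    change σ (a / b) = τ (a / b)
    rw [map_div₀, map_div₀, h1, h2]
  ext z
  exact (h ▸ Algebra.mem_top : z ∈ AlgHom.equalizer σ τ)

/-- The coordinate ring of `y² = F(t, x)` embeds into every field in which the equation has a
solution with independent `t` and `x`. -/
lemma exists_injective_algHom_adjoinRoot {F : MvPolynomial (Fin 2) ℂ}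
    (hF : ∀ a b : MvPolynomial (Fin 2) ℂ, a ^ 2 = F * b ^ 2 → b = 0) {t x y : K}
    (h : AlgebraicIndependent ℂ ![t, x]) (hy : y ^ 2 = MvPolynomial.aeval ![t, x] F) :
    ∃ g : AdjoinRoot (.X ^ 2 - .C F : Polynomial (MvPolynomial (Fin 2) ℂ)) →ₐ[ℂ] K,
      Function.Injective g ∧ (∀ a, g (AdjoinRoot.of _ a) = MvPolynomial.aeval ![t, x] a) ∧
        g (AdjoinRoot.root _) = y := by
  have h0 : Polynomial.eval₂ (MvPolynomial.aeval ![t, x] :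
      MvPolynomial (Fin 2) ℂ →ₐ[ℂ] K).toRingHom y (.X ^ 2 - .C F) = 0 := by
    rw [Polynomial.eval₂_sub, Polynomial.eval₂_X_pow, Polynomial.eval₂_C, hy]
    exact sub_self _
  let g := AdjoinRoot.liftAlgHom (Polynomial.X ^ 2 - Polynomial.C F)
    (MvPolynomial.aeval ![t, x]) y h0
  have hof : ∀ a, g (AdjoinRoot.of _ a) = MvPolynomial.aeval ![t, x] a :=
    fun a => AdjoinRoot.lift_of h0
  have hroot : g (AdjoinRoot.root _) = y := AdjoinRoot.lift_root h0
  refine ⟨g, ?_, hof, hroot⟩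
  rw [injective_iff_map_eq_zero]
  intro z hz
  obtain ⟨p, rfl⟩ := AdjoinRoot.mk_surjective z
  have hm : (.X ^ 2 - .C F : Polynomial (MvPolynomial (Fin 2) ℂ)).Monic :=
    Polynomial.monic_X_pow_sub_C F two_ne_zero
  have hd : (p %ₘ (.X ^ 2 - .C F : Polynomial (MvPolynomial (Fin 2) ℂ))).natDegree ≤ 1 := by
    have := Polynomial.natDegree_modByMonic_lt p hm (by
      intro h1
      have := congrArg Polynomial.natDegree h1
      rw [Polynomial.natDegree_X_pow_sub_C] at this
      simp at this)
    rw [Polynomial.natDegree_X_pow_sub_C] at this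
    omega
  obtain ⟨b, a, hba⟩ := Polynomial.exists_eq_X_add_C_of_natDegree_le_one hd
  have hmk : AdjoinRoot.mk (.X ^ 2 - .C F : Polynomial (MvPolynomial (Fin 2) ℂ)) p =
      AdjoinRoot.of _ b * AdjoinRoot.root _ + AdjoinRoot.of _ a := by
    conv_lhs => rw [← Polynomial.modByMonic_add_div p (.X ^ 2 - .C F)]
    rw [hba, map_add, map_mul, AdjoinRoot.mk_self, zero_mul, add_zero, map_add, map_mul,
      AdjoinRoot.mk_C, AdjoinRoot.mk_C, AdjoinRoot.mk_X]
  rw [hmk, map_add, map_mul, hof, hof, hroot] at hz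
  -- From `b y + a = 0` follows `a² = F b²`. That `F` is not a square of a fraction is all that is
  -- needed here.
  have hb : b = 0 := by
    refine hF a b (h ?_)
    rw [map_pow, map_mul, map_pow, ← hy]
    linear_combination (MvPolynomial.aeval ![t, x] a - MvPolynomial.aeval ![t, x] b * y) * hz
  have ha : a = 0 := by
    refine h ?_
    rw [hb] at hz
    simpa using hz
  rw [hmk, ha, hb]
  simp

/-- A solution of `y² = F(t, x)` with independent `t` and `x` in a field `L` gives an embedding of
the function field of this surface into `L`. -/
theorem exists_algHom_of_equation {F : MvPolynomial (Fin 2) ℂ}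
    (hF : ∀ a b : MvPolynomial (Fin 2) ℂ, a ^ 2 = F * b ^ 2 → b = 0) {t x y : K}
    (h : AlgebraicIndependent ℂ ![t, x]) (hy : y ^ 2 = MvPolynomial.aeval ![t, x] F)
    (hgen : IntermediateField.adjoin ℂ {t, x, y} = ⊤) {t' x' y' : L}
    (h' : AlgebraicIndependent ℂ ![t', x']) (hy' : y' ^ 2 = MvPolynomial.aeval ![t', x'] F) :
    ∃ σ : K →ₐ[ℂ] L, σ t = t' ∧ σ x = x' ∧ σ y = y' := by
  let A := AdjoinRoot (.X ^ 2 - .C F : Polynomial (MvPolynomial (Fin 2) ℂ))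
  obtain ⟨g, hg, hgo, hgr⟩ := exists_injective_algHom_adjoinRoot hF h hy
  obtain ⟨g', hg', hgo', hgr'⟩ := exists_injective_algHom_adjoinRoot hF h' hy'
  let _ : Algebra A K := g.toRingHom.toAlgebra
  have : IsDomain A := hg.isDomain g
  have : FaithfulSMul A K := (faithfulSMul_iff_algebraMap_injective _ _).mpr hg
  have hle : Algebra.adjoin ℂ {t, x, y} ≤ g.range := by
    rw [Algebra.adjoin_le_iff]
    rintro z (rfl | rfl | rfl)
    · exact ⟨AdjoinRoot.of _ (.X 0), by rw [AlgHom.toRingHom_eq_coe, RingHom.coe_coe, hgo]; simp⟩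
    · exact ⟨AdjoinRoot.of _ (.X 1), by rw [AlgHom.toRingHom_eq_coe, RingHom.coe_coe, hgo]; simp⟩
    · exact ⟨AdjoinRoot.root _, hgr⟩
  have : IsFractionRing A K := by
    refine IsFractionRing.of_field A K fun z => ?_
    have hz : z ∈ IntermediateField.adjoin ℂ {t, x, y} := hgen ▸ IntermediateField.mem_top
    obtain ⟨a, ha, b, hb, rfl⟩ := (IntermediateField.mem_adjoin_iff_div ..).mp hz
    obtain ⟨a', rfl⟩ := hle ha
    obtain ⟨b', rfl⟩ := hle hb
    exact ⟨a', b', rfl⟩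
  let σ₀ : K →+* L := IsFractionRing.lift (A := A) (g := g'.toRingHom) hg'
  have hσ₀ : ∀ a, σ₀ (g a) = g' a := fun a => IsFractionRing.lift_algebraMap (A := A) hg' a
  let σ : K →ₐ[ℂ] L :=
    { σ₀ with
      commutes' := fun z => by
        change σ₀ (algebraMap ℂ K z) = algebraMap ℂ L z
        rw [← g.commutes, ← g'.commutes, hσ₀] }
  refine ⟨σ, ?_, ?_, ?_⟩
  · have := hσ₀ (AdjoinRoot.of _ (.X 0))
    rw [hgo, hgo', MvPolynomial.aeval_X, MvPolynomial.aeval_X] at this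
    exact this
  · have := hσ₀ (AdjoinRoot.of _ (.X 1))
    rw [hgo, hgo', MvPolynomial.aeval_X, MvPolynomial.aeval_X] at this
    exact this
  · have := hσ₀ (AdjoinRoot.root _)
    rwa [hgr, hgr'] at this

/-- An element that a prime divides to first order is not a quotient of squares. -/
lemma eq_zero_of_sq_eq_prime_mul {R : Type} [CommRing R] [IsDomain R] [WfDvdMonoid R] {p g : R}
    (hp : Prime p) (hg : ¬ p ∣ g) (a b : R) (h : a ^ 2 = p * g * b ^ 2) : b = 0 := by
  by_contra hb
  have h1 : a ≠ 0 := by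
    rintro rfl
    have hg0 : g ≠ 0 := by rintro rfl; exact hg (dvd_zero p)
    have := mul_ne_zero (mul_ne_zero hp.ne_zero hg0) (pow_ne_zero 2 hb)
    exact this (by rw [← h]; simp)
  have fa := FiniteMultiplicity.of_prime_left hp h1
  have fb := FiniteMultiplicity.of_prime_left hp hb
  -- The multiplicity of `p` is even on the left and odd on the right.
  have h2 := congrArg (emultiplicity p) h
  rw [emultiplicity_mul hp, emultiplicity_mul hp, emultiplicity_pow hp, emultiplicity_pow hp,
    emultiplicity_eq_zero.mpr hg, fa.emultiplicity_eq_multiplicity,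
    fb.emultiplicity_eq_multiplicity,
    (FiniteMultiplicity.of_prime_left hp hp.ne_zero).emultiplicity_self] at h2
  norm_cast at h2
  omega

/-- The cubic polynomial `x³ + A(t) x² + B(t) x` is not a quotient of squares if `B ≠ 0`. -/
lemma eq_zero_of_sq_eq_cubic {A B : Polynomial ℂ} (hB : B ≠ 0) (a b : MvPolynomial (Fin 2) ℂ)
    (h : a ^ 2 = (.X 1 ^ 3 + Polynomial.aeval (.X 0) A * .X 1 ^ 2 +
      Polynomial.aeval (.X 0) B * .X 1) * b ^ 2) : b = 0 := by
  refine eq_zero_of_sq_eq_prime_mul (p := .X 1)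
    (g := .X 1 ^ 2 + Polynomial.aeval (.X 0) A * .X 1 + Polynomial.aeval (.X 0) B)
    MvPolynomial.X_prime ?_ a b (by rw [h]; ring)
  intro hd
  -- Setting `x = 0` in the cofactor of `x` leaves `B(t)`.
  have hd2 := map_dvd (MvPolynomial.aeval ![(.X : Polynomial ℂ), 0]) hd
  simp [← Polynomial.aeval_algHom_apply] at hd2
  exact hB hd2

/-- The degree and the image of a homomorphism `σ : K → L` such that `L` is generated over it by a
square root that an involution of `L` over `K` changes the sign of. -/
theorem mem_range_iff_and_degree_eq_two (σ : K →ₐ[ℂ] L) (τ : L →ₐ[ℂ] L) {s : L} (hs : s ≠ 0)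
    (hs2 : s ^ 2 ∈ Set.range σ) (hτσ : τ.comp σ = σ) (hτs : τ s = -s) {t x y : L}
    (hgen : IntermediateField.adjoin ℂ {t, x, y} = ⊤)
    (hL : ∀ M : IntermediateField ℂ L, (∀ a, σ a ∈ M) → s ∈ M → t ∈ M ∧ x ∈ M ∧ y ∈ M) :
    (∀ f, f ∈ Set.range σ ↔ τ f = f) ∧ degree σ = 2 := by
  have : CharZero L := charZero_of_injective_algebraMap (algebraMap ℂ L).injective
  have hτσ' : ∀ a, τ (σ a) = σ a := fun a => congr($hτσ a)
  have hs' : ∀ f, τ f = -f → f ∈ Set.range σ → f = 0 := by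
    rintro _ h ⟨a, rfl⟩
    rw [hτσ'] at h
    have h2 : (2 : L) * σ a = 0 := by linear_combination h
    simpa using h2
  have hsn : s ∉ Set.range σ := fun h => hs (hs' s hτs h)
  let E := σ.fieldRange
  obtain ⟨q, hq⟩ := hs2
  have hintg : IsIntegral E s := by
    refine ⟨.X ^ 2 - .C ⟨σ q, q, rfl⟩, Polynomial.monic_X_pow_sub_C _ two_ne_zero, ?_⟩
    simp only [Polynomial.eval₂_sub, Polynomial.eval₂_X_pow, Polynomial.eval₂_C]
    change s ^ 2 - σ q = 0
    rw [hq, sub_self]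
  have htop : IntermediateField.adjoin E {s} = ⊤ := by
    have : (IntermediateField.adjoin E {s}).restrictScalars ℂ = ⊤ := by
      rw [eq_top_iff, ← hgen, IntermediateField.adjoin_le_iff]
      obtain ⟨h1, h2, h3⟩ := hL ((IntermediateField.adjoin E {s}).restrictScalars ℂ)
        (fun a => IntermediateField.algebraMap_mem _ (⟨σ a, a, rfl⟩ : E))
        (IntermediateField.mem_adjoin_simple_self E s)
      rintro z (rfl | rfl | rfl)
      exacts [h1, h2, h3]
    rw [eq_top_iff]
    intro z _
    exact (this ▸ IntermediateField.mem_top : z ∈ (IntermediateField.adjoin E {s}).restrictScalars ℂ)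
  -- `L = σ(K) + σ(K) s`, and `τ` fixes the first summand and changes the sign of the second, so its
  -- fixed field is `σ(K)`.
  have hform : ∀ f, ∃ a b : K, f = σ a + σ b * s := by
    intro f
    have hf : f ∈ Algebra.adjoin E {s} := by
      rw [← IntermediateField.adjoin_simple_toSubalgebra_of_isAlgebraic hintg.isAlgebraic, htop]
      trivial
    induction hf using Algebra.adjoin_induction with
    | mem z hz => exact ⟨0, 1, by rw [Set.mem_singleton_iff.mp hz]; simp⟩
    | algebraMap z =>
      obtain ⟨_, a, rfl⟩ := z
      exact ⟨a, 0, by simp⟩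
    | add z w _ _ hz hw =>
      obtain ⟨a, b, rfl⟩ := hz
      obtain ⟨c, d, rfl⟩ := hw
      exact ⟨a + c, b + d, by simp; ring⟩
    | mul z w _ _ hz hw =>
      obtain ⟨a, b, rfl⟩ := hz
      obtain ⟨c, d, rfl⟩ := hw
      refine ⟨a * c + b * d * q, a * d + b * c, ?_⟩
      simp only [map_add, map_mul, hq]
      ring
  refine ⟨fun f => ⟨?_, fun hf => ?_⟩, ?_⟩
  · rintro ⟨a, rfl⟩
    exact hτσ' a
  · obtain ⟨a, b, rfl⟩ := hform f
    rw [map_add, map_mul, hτσ', hτσ', hτs] at hf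
    have h2 : (2 : L) * (σ b * s) = 0 := by linear_combination -hf
    have h3 : σ b * s = 0 := by simpa using h2
    exact ⟨a, by rw [h3, add_zero]⟩
  · have h1 : Module.finrank E L = (minpoly E s).natDegree := by
      rw [← IntermediateField.adjoin.finrank hintg, htop, IntermediateField.finrank_top']
    change Module.finrank E L = 2
    rw [h1]
    refine le_antisymm ?_ ?_
    · have h2 : (Polynomial.X ^ 2 - Polynomial.C (⟨σ q, q, rfl⟩ : E)).natDegree = 2 :=
        Polynomial.natDegree_X_pow_sub_C
      rw [← h2]
      refine Polynomial.natDegree_le_of_dvd (minpoly.dvd _ _ ?_)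
        (Polynomial.monic_X_pow_sub_C _ two_ne_zero).ne_zero
      simp only [map_sub, map_pow, Polynomial.aeval_X, Polynomial.aeval_C]
      change s ^ 2 - σ q = 0
      rw [hq, sub_self]
    · rw [minpoly.two_le_natDegree_iff hintg]
      rintro ⟨⟨_, a, rfl⟩, ha⟩
      exact hsn ⟨a, ha⟩

end

/-! ### Regularity of `dx₁ ∧ dx₂ / (y₁ y₂)` -/

section

variable {K : Type} [Field K] [Algebra ℂ K]

lemma aeval_mem_subalgebra (V : Subalgebra ℂ K) {z : K} (hz : z ∈ V) (G : Polynomial ℂ) :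
    Polynomial.aeval z G ∈ V :=
  Algebra.adjoin_le (by simpa using hz) (Polynomial.aeval_mem_adjoin_singleton ℂ z)

lemma mem_of_sq_mem {V : Subalgebra ℂ K} (hV : ∀ x, x ∈ V ∨ x⁻¹ ∈ V) {r : K} (hr : r ^ 2 ∈ V) :
    r ∈ V := by
  rcases hV r with h | h
  · exact h
  · by_cases h0 : r = 0
    · rw [h0]; exact zero_mem V
    · have := mul_mem hr h
      rwa [sq, mul_assoc, mul_inv_cancel₀ h0, mul_one] at this

/-- Write `f₁`, `f₂` for the two values and `g₂` for that of the derivative of `G₂`. The function `r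
= w/f₁` has `r² = f₂/f₁` in `V`, hence lies in `V`. Differentiating `f₂ = f₁ r²` and wedging with
`dz₁` gives `g₂ dz₁ ∧ dz₂ = 2w dz₁ ∧ dr`. As `A f₂ + B g₂ = 1` by separability and `f₂/w = r`, the
form is `A r dz₁ ∧ dz₂ + 2B dz₁ ∧ dr`, without denominators. -/
lemma inv_smul_wedge_mem_of_div_mem {V : Subalgebra ℂ K} (hV : ∀ x, x ∈ V ∨ x⁻¹ ∈ V)
    {z₁ z₂ w : K} (h₁ : z₁ ∈ V) (h₂ : z₂ ∈ V) {G₁ G₂ : Polynomial ℂ} (hG₂ : G₂.Separable)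
    (hw : w ^ 2 = Polynomial.aeval z₁ G₁ * Polynomial.aeval z₂ G₂) (hw0 : w ≠ 0)
    (hdiv : Polynomial.aeval z₂ G₂ / Polynomial.aeval z₁ G₁ ∈ V) :
    w⁻¹ • wedge z₁ z₂ ∈ formsOf V := by
  obtain ⟨A, B, hAB⟩ := hG₂
  set f₁ := Polynomial.aeval z₁ G₁ with hf₁
  set f₂ := Polynomial.aeval z₂ G₂ with hf₂
  have hf₁0 : f₁ ≠ 0 := by
    intro h
    rw [h, zero_mul] at hw
    exact hw0 (by simpa using hw)
  let r := w / f₁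
  have hrf : f₂ = f₁ * r ^ 2 := by
    simp only [r]
    field_simp
    linear_combination -hw
  have hr : r ∈ V := by
    apply mem_of_sq_mem hV
    convert hdiv using 1
    rw [hrf]
    field_simp
  have hwr : w = f₁ * r := by simp only [r]; field_simp
  have hr0 : r ≠ 0 := by
    intro h
    rw [h, mul_zero] at hwr
    exact hw0 hwr
  set g₂ := Polynomial.aeval z₂ (Polynomial.derivative G₂)
  have hbez : Polynomial.aeval z₂ A * f₂ + Polynomial.aeval z₂ B * g₂ = 1 := by
    rw [← map_mul, ← map_mul, ← map_add, hAB, map_one]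
  have hD₁ : D ℂ K f₁ = Polynomial.aeval z₁ (Polynomial.derivative G₁) • D ℂ K z₁ :=
    Derivation.map_aeval _ _ _
  have hD₂ : D ℂ K f₂ = g₂ • D ℂ K z₂ := Derivation.map_aeval _ _ _
  have hg : g₂ • wedge z₁ z₂ = (2 * w) • wedge z₁ r := by
    have h := congrArg (D ℂ K) hrf
    rw [hD₂, Derivation.leibniz, Derivation.leibniz_pow, hD₁] at h
    have h' := congrArg (wedgeB (D ℂ K z₁)) h
    simp only [map_add, map_smul, wedgeB_self, smul_zero, add_zero, map_nsmul, ← wedge_eq] at h'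
    rw [h', hwr]
    simp only [Nat.add_one_sub_one, pow_one]
    module
  have hfin : w⁻¹ • wedge z₁ z₂ =
      (Polynomial.aeval z₂ A * r) • wedge z₁ z₂ + (2 * Polynomial.aeval z₂ B) • wedge z₁ r := by
    have e1 : w⁻¹ • wedge z₁ z₂ = (w⁻¹ * (Polynomial.aeval z₂ A * f₂)) • wedge z₁ z₂ +
        (w⁻¹ * Polynomial.aeval z₂ B) • g₂ • wedge z₁ z₂ := by
      rw [smul_smul, ← add_smul]
      congr 1
      linear_combination -w⁻¹ * hbez
    rw [e1, hg, smul_smul]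
    congr 2
    · rw [hrf, hwr]; field_simp
    · field_simp
  rw [hfin]
  exact add_mem (smul_wedge_mem_formsOf (mul_mem (aeval_mem_subalgebra V h₂ A) hr) h₁ h₂)
    (smul_wedge_mem_formsOf (mul_mem (ofNat_mem V 2) (aeval_mem_subalgebra V h₂ B)) h₁ hr)

lemma wedge_swap (a b : K) : wedge a b = -wedge b a := wedgeB_swap _ _

/-- One of the two ratios lies in the valuation ring, and exchanging the factors only changes a
sign. -/
lemma inv_smul_wedge_mem {V : Subalgebra ℂ K} (hV : ∀ x, x ∈ V ∨ x⁻¹ ∈ V)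
    {z₁ z₂ w : K} (h₁ : z₁ ∈ V) (h₂ : z₂ ∈ V) {G₁ G₂ : Polynomial ℂ} (hG₁ : G₁.Separable)
    (hG₂ : G₂.Separable) (hw : w ^ 2 = Polynomial.aeval z₁ G₁ * Polynomial.aeval z₂ G₂)
    (hw0 : w ≠ 0) : w⁻¹ • wedge z₁ z₂ ∈ formsOf V := by
  rcases hV (Polynomial.aeval z₂ G₂ / Polynomial.aeval z₁ G₁) with h | h
  · exact inv_smul_wedge_mem_of_div_mem hV h₁ h₂ hG₂ hw hw0 h
  · rw [inv_div] at h
    rw [wedge_swap, smul_neg]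
    exact neg_mem (inv_smul_wedge_mem_of_div_mem hV h₂ h₁ hG₁ (by rw [hw, mul_comm]) hw0 h)

lemma separable_cubic {l : ℂ} (h0 : l ≠ 0) (h1 : l ≠ 1) :
    (Polynomial.X * (Polynomial.X - 1) * (Polynomial.X - Polynomial.C l)).Separable := by
  have hcop : ∀ a b : ℂ, a ≠ b →
      IsCoprime (Polynomial.X - Polynomial.C a) (Polynomial.X - Polynomial.C b) := fun a b h =>
    Polynomial.isCoprime_X_sub_C_of_isUnit_sub (sub_ne_zero.mpr h).isUnit
  have h := ((Polynomial.separable_X_sub_C (x := (0 : ℂ))).mul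
    (Polynomial.separable_X_sub_C (x := (1 : ℂ))) (hcop 0 1 zero_ne_one)).mul
    (Polynomial.separable_X_sub_C (x := l)) ((hcop 0 l h0.symm).mul_left (hcop 1 l h1.symm))
  simpa using h

/-- A coordinate of the Legendre curve that is regular along `V`, with the factor by which it
changes the invariant differential. -/
lemma exists_regular_coordinate {V : Subalgebra ℂ K} (hV : ∀ x, x ∈ V ∨ x⁻¹ ∈ V) {l : ℂ}
    (h0 : l ≠ 0) (h1 : l ≠ 1) {x : K} (hx : x ≠ 0) :
    ∃ z ∈ V, ∃ G : Polynomial ℂ, G.Separable ∧ ∃ s : K, s ≠ 0 ∧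
      Polynomial.aeval z G = s ^ 2 * (x * (x - 1) * (x - algebraMap ℂ K l)) ∧
      D ℂ K x = s⁻¹ • D ℂ K z := by
  rcases hV x with h | h
  · exact ⟨x, h, _, separable_cubic h0 h1, 1, one_ne_zero, by simp, by simp⟩
  -- The chart at infinity: for `z = 1/x` the cubic becomes `l z (z - 1)(z - 1/l)` after
  -- multiplication by `x⁻⁴ = s²`, and `dz = s dx` with `s = -x⁻²`.
  · refine ⟨x⁻¹, h, .C l * (.X * (.X - 1) * (.X - .C l⁻¹)), ?_, -(x⁻¹) ^ 2, by simpa using hx, ?_, ?_⟩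
    · exact (separable_cubic (inv_ne_zero h0) (by simpa using h1)).unit_mul
        (Polynomial.isUnit_C.mpr h0.isUnit)
    · have hl : algebraMap ℂ K l ≠ 0 := by simpa using h0
      simp only [map_mul, map_sub, Polynomial.aeval_X, Polynomial.aeval_C, map_one, map_inv₀]
      field_simp
      ring
    · rw [Derivation.leibniz_inv, smul_smul]
      have : (-x⁻¹ ^ 2)⁻¹ * -x⁻¹ ^ 2 = 1 := inv_mul_cancel₀ (by simpa using hx)
      rw [this, one_smul]

/-- The two-form `dx₁ ∧ dx₂ / (y₁ y₂)` on the Kummer surface is regular along every valuation. -/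
theorem inv_smul_wedge_mem_formsOf_legendre {V : Subalgebra ℂ K} (hV : ∀ x, x ∈ V ∨ x⁻¹ ∈ V)
    {l₁ l₂ : ℂ} (h₁ : l₁ ≠ 0) (h₁' : l₁ ≠ 1) (h₂ : l₂ ≠ 0) (h₂' : l₂ ≠ 1) {x₁ x₂ w : K}
    (hw : w ^ 2 = x₁ * (x₁ - 1) * (x₁ - algebraMap ℂ _ l₁) *
      (x₂ * (x₂ - 1) * (x₂ - algebraMap ℂ _ l₂))) (hw0 : w ≠ 0) :
    w⁻¹ • wedge x₁ x₂ ∈ formsOf V := by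
  have hx₁ : x₁ ≠ 0 := by rintro rfl; exact hw0 (by simpa using hw)
  have hx₂ : x₂ ≠ 0 := by rintro rfl; exact hw0 (by simpa using hw)
  obtain ⟨z₁, hz₁, G₁, hG₁, s₁, hs₁, e₁, d₁⟩ := exists_regular_coordinate hV h₁ h₁' hx₁
  obtain ⟨z₂, hz₂, G₂, hG₂, s₂, hs₂, e₂, d₂⟩ := exists_regular_coordinate hV h₂ h₂' hx₂
  have key := inv_smul_wedge_mem hV hz₁ hz₂ hG₁ hG₂ (w := s₁ * s₂ * w)
    (by rw [e₁, e₂]; linear_combination s₁ ^ 2 * s₂ ^ 2 * hw)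
    (mul_ne_zero (mul_ne_zero hs₁ hs₂) hw0)
  convert key using 1
  rw [wedge_eq, wedge_eq, d₁, d₂, map_smul, map_smul, LinearMap.smul_apply, smul_smul, smul_smul,
    mul_inv, mul_inv]
  congr 1
  ring

end

/-! ### Two elliptic fibrations on the Kummer surface -/

section

variable {K : Type} [Field K] [Algebra ℂ K]

/-- Each denominator below is shown to be nonzero by specializing the independent functions to two
numbers. -/
lemma aeval_ne_zero_of_eval_ne_zero {t x : K} (h : AlgebraicIndependent ℂ ![t, x])
    (P : MvPolynomial (Fin 2) ℂ) (a b : ℂ) (hP : MvPolynomial.eval ![a, b] P ≠ 0) :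
    MvPolynomial.aeval ![t, x] P ≠ 0 := by
  intro h0
  have : P = 0 := h (by rw [h0, map_zero])
  rw [this, map_zero] at hP
  exact hP rfl

lemma charZero_of_complex (K : Type) [Field K] [Algebra ℂ K] : CharZero K :=
  charZero_of_injective_algebraMap (algebraMap ℂ K).injective

lemma sq_mem_adjoin_of_equation {t x y : K} {A B : Polynomial ℂ}
    (h : y ^ 2 = x ^ 3 + Polynomial.aeval t A * x ^ 2 + Polynomial.aeval t B * x) :
    y ^ 2 ∈ IntermediateField.adjoin ℂ {t, x} := by
  have mt : t ∈ IntermediateField.adjoin ℂ {t, x} := IntermediateField.subset_adjoin _ _ (by simp)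
  have mx : x ∈ IntermediateField.adjoin ℂ {t, x} := IntermediateField.subset_adjoin _ _ (by simp)
  have hp : ∀ A : Polynomial ℂ, Polynomial.aeval t A ∈ IntermediateField.adjoin ℂ {t, x} :=
    fun A => aeval_mem_subalgebra (IntermediateField.adjoin ℂ {t, x}).toSubalgebra mt A
  rw [h]
  exact add_mem (add_mem (pow_mem mx 3) (mul_mem (hp A) (pow_mem mx 2))) (mul_mem (hp B) mx)

lemma IsWeierstrassSurface.isAlgebraic {t x y : K} {A B : Polynomial ℂ}
    (h : IsWeierstrassSurface t x y (Polynomial.aeval t A) (Polynomial.aeval t B)) :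
    Algebra.IsAlgebraic (IntermediateField.adjoin ℂ {t, x}) K :=
  isAlgebraic_of_generate h.generate (sq_mem_adjoin_of_equation h.equation)

lemma IsWeierstrassSurface.trdeg_eq_two {t x y : K} {A B : Polynomial ℂ}
    (h : IsWeierstrassSurface t x y (Polynomial.aeval t A) (Polynomial.aeval t B)) :
    Algebra.trdeg ℂ K = 2 :=
  KummerSandwich.trdeg_eq_two h.independent h.isAlgebraic

/-- In transcendence degree two, the independence of the coordinates is automatic. -/
lemma isWeierstrassSurface_of_trdeg {t x y : K} {A B : Polynomial ℂ}
    (htr : Algebra.trdeg ℂ K = 2)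
    (h : y ^ 2 = x ^ 3 + Polynomial.aeval t A * x ^ 2 + Polynomial.aeval t B * x)
    (hgen : IntermediateField.adjoin ℂ {t, x, y} = ⊤) :
    IsWeierstrassSurface t x y (Polynomial.aeval t A) (Polynomial.aeval t B) :=
  ⟨algebraicIndependent_of_isAlgebraic htr
    (isAlgebraic_of_generate hgen (sq_mem_adjoin_of_equation h)), h, hgen⟩

lemma aeval_cubic (A B : Polynomial ℂ) (t x : K) :
    MvPolynomial.aeval ![t, x] (.X 1 ^ 3 + Polynomial.aeval (.X 0) A * .X 1 ^ 2 +
      Polynomial.aeval (.X 0) B * .X 1 : MvPolynomial (Fin 2) ℂ) =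
      x ^ 3 + Polynomial.aeval t A * x ^ 2 + Polynomial.aeval t B * x := by
  simp [← Polynomial.aeval_algHom_apply]

/-- The homomorphisms on the function field of a Weierstrass equation. -/
theorem IsWeierstrassSurface.exists_algHom {L : Type} [Field L] [Algebra ℂ L] {t x y : K}
    {A B : Polynomial ℂ}
    (h : IsWeierstrassSurface t x y (Polynomial.aeval t A) (Polynomial.aeval t B)) (hB : B ≠ 0)
    {t' x' y' : L} (h' : AlgebraicIndependent ℂ ![t', x'])
    (e : y' ^ 2 = x' ^ 3 + Polynomial.aeval t' A * x' ^ 2 + Polynomial.aeval t' B * x') :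
    ∃ σ : K →ₐ[ℂ] L, σ t = t' ∧ σ x = x' ∧ σ y = y' :=
  exists_algHom_of_equation (eq_zero_of_sq_eq_cubic hB) h.independent
    (by rw [aeval_cubic, h.equation]) h.generate h' (by rw [aeval_cubic, e])

lemma IsWeierstrassSurface.y_ne_zero {t x y : K} {A B : Polynomial ℂ}
    (h : IsWeierstrassSurface t x y (Polynomial.aeval t A) (Polynomial.aeval t B)) (hB : B ≠ 0) :
    y ≠ 0 := by
  rintro rfl
  have h0 := h.equation
  rw [← aeval_cubic] at h0
  have h1 := h.independent (by rw [← h0]; simp :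
    MvPolynomial.aeval ![t, x] (.X 1 ^ 3 + Polynomial.aeval (.X 0) A * .X 1 ^ 2 +
      Polynomial.aeval (.X 0) B * .X 1 : MvPolynomial (Fin 2) ℂ) = MvPolynomial.aeval ![t, x] 0)
  exact one_ne_zero (eq_zero_of_sq_eq_cubic hB 0 1 (by rw [h1]; ring))

lemma IsWeierstrassSurface.form_ne_zero {t x y : K} {A B : Polynomial ℂ}
    (h : IsWeierstrassSurface t x y (Polynomial.aeval t A) (Polynomial.aeval t B)) (hB : B ≠ 0) :
    weierstrassForm t x y ≠ 0 :=
  smul_ne_zero (inv_ne_zero (h.y_ne_zero hB)) (wedge_ne_zero h.independent h.isAlgebraic)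

lemma ne_zero_left {t x : K} (h : AlgebraicIndependent ℂ ![t, x]) : t ≠ 0 := by
  simpa using aeval_ne_zero_of_eval_ne_zero h (.X 0) 1 1 (by simp)

lemma ne_zero_right {t x : K} (h : AlgebraicIndependent ℂ ![t, x]) : x ≠ 0 := by
  simpa using aeval_ne_zero_of_eval_ne_zero h (.X 1) 1 1 (by simp)

/-! ### The coefficients of the three equations as polynomials -/

section

variable (l₁ l₂ : ℂ)

/-- `(l₁ - 1) (l₂ - 1) (t⁴ + 1) - 2 (l₁ + 1) (l₂ + 1) t²` -/
def coeffJ1 : Polynomial ℂ :=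
  .C ((l₁ - 1) * (l₂ - 1)) * (.X ^ 4 + 1) - .C (2 * (l₁ + 1) * (l₂ + 1)) * .X ^ 2

/-- `(l₁ - 1) (l₂ - 1) (u³ + u) - 2 (l₁ + 1) (l₂ + 1) u²` -/
def coeffB12 : Polynomial ℂ :=
  .C ((l₁ - 1) * (l₂ - 1)) * (.X ^ 3 + .X) - .C (2 * (l₁ + 1) * (l₂ + 1)) * .X ^ 2

/-- `16 l₁ l₂ t⁴` -/
def coeffQuartic : Polynomial ℂ := .C (16 * l₁ * l₂) * .X ^ 4

/-- `(v² - 4) ((l₁ - 1) (l₂ - 1) v - 2 (l₁ + 1) (l₂ + 1))` -/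
def coeffJ7 : Polynomial ℂ :=
  (.X ^ 2 - 4) * (.C ((l₁ - 1) * (l₂ - 1)) * .X - .C (2 * (l₁ + 1) * (l₂ + 1)))

/-- `16 l₁ l₂ (v² - 4)²` -/
def coeffJ7' : Polynomial ℂ := .C (16 * l₁ * l₂) * (.X ^ 2 - 4) ^ 2

variable {l₁ l₂}

lemma coeffQuartic_ne_zero (h₁ : l₁ ≠ 0) (h₂ : l₂ ≠ 0) : coeffQuartic l₁ l₂ ≠ 0 := by
  simp [coeffQuartic, h₁, h₂]

lemma coeffJ7'_ne_zero (h₁ : l₁ ≠ 0) (h₂ : l₂ ≠ 0) : coeffJ7' l₁ l₂ ≠ 0 := by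
  intro h
  have := congrArg (Polynomial.eval 0) h
  simp [coeffJ7', h₁, h₂] at this

lemma aeval_coeffQuartic (t : K) : Polynomial.aeval t (coeffQuartic l₁ l₂) =
    algebraMap ℂ K (16 * l₁ * l₂) * t ^ 4 := by
  simp [coeffQuartic]

lemma aeval_coeffJ1 {t : K} (ht : t ≠ 0) : Polynomial.aeval t (coeffJ1 l₁ l₂) =
    t ^ 2 * linearTerm l₁ l₂ (t ^ 2 + (t ^ 2)⁻¹) := by
  simp only [coeffJ1, linearTerm, map_sub, map_mul (Polynomial.aeval t), map_add (Polynomial.aeval t),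
    map_pow, Polynomial.aeval_X, Polynomial.aeval_C, map_one (Polynomial.aeval t)]
  field_simp

lemma aeval_coeffB12 {t : K} (ht : t ≠ 0) : Polynomial.aeval t (coeffB12 l₁ l₂) =
    t ^ 2 * linearTerm l₁ l₂ (t + t⁻¹) := by
  simp only [coeffB12, linearTerm, map_sub, map_mul (Polynomial.aeval t),
    map_add (Polynomial.aeval t), map_pow, Polynomial.aeval_X, Polynomial.aeval_C]
  field_simp

lemma aeval_coeffJ7 (t : K) : Polynomial.aeval t (coeffJ7 l₁ l₂) =
    (t ^ 2 - 4) * linearTerm l₁ l₂ t := by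
  simp only [coeffJ7, linearTerm, map_sub, map_mul (Polynomial.aeval t), map_pow,
    Polynomial.aeval_X, Polynomial.aeval_C, map_ofNat (Polynomial.aeval t)]

lemma aeval_coeffJ7' (t : K) : Polynomial.aeval t (coeffJ7' l₁ l₂) =
    algebraMap ℂ K (16 * l₁ * l₂) * (t ^ 2 - 4) ^ 2 := by
  simp only [coeffJ7', map_sub, map_mul (Polynomial.aeval t), map_pow,
    Polynomial.aeval_X, Polynomial.aeval_C, map_ofNat (Polynomial.aeval t)]

lemma isJ1_iff {t x y : K} (ht : t ≠ 0) : IsJ1 l₁ l₂ t x y ↔ IsWeierstrassSurface t x y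
    (Polynomial.aeval t (coeffJ1 l₁ l₂)) (Polynomial.aeval t (coeffQuartic l₁ l₂)) := by
  rw [IsJ1, aeval_coeffJ1 ht, aeval_coeffQuartic]

lemma isB12_iff {t x y : K} (ht : t ≠ 0) : IsB12 l₁ l₂ t x y ↔ IsWeierstrassSurface t x y
    (Polynomial.aeval t (coeffB12 l₁ l₂)) (Polynomial.aeval t (coeffQuartic l₁ l₂)) := by
  rw [IsB12, aeval_coeffB12 ht, aeval_coeffQuartic]

lemma isJ7_iff {t x y : K} : IsJ7 l₁ l₂ t x y ↔ IsWeierstrassSurface t x y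
    (Polynomial.aeval t (coeffJ7 l₁ l₂)) (Polynomial.aeval t (coeffJ7' l₁ l₂)) := by
  rw [IsJ7, aeval_coeffJ7, aeval_coeffJ7']

end

lemma wedge_mul_sq (c : ℂ) (t k : K) :
    wedge t (algebraMap ℂ K c * t ^ 2 * k) = (algebraMap ℂ K c * t ^ 2) • wedge t k := by
  simp only [wedge_eq, Derivation.leibniz, Derivation.leibniz_pow, Derivation.map_algebraMap,
    map_add, map_smul, map_nsmul, wedgeB_self, smul_zero, add_zero]

/-- The differential of the relation is wedged with `dk`. The coefficients are its partial
derivatives in `t` and, up to sign, in `z`. -/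
lemma smul_wedge_of_quadratic {c l₁ l₂ : ℂ} {t k z : K}
    (h : (algebraMap ℂ K c ^ 2 * t ^ 2 * k - k ^ 2) * z ^ 2 + ((1 + algebraMap ℂ K l₂) * k -
      algebraMap ℂ K c ^ 2 * t ^ 2 * k * (1 + algebraMap ℂ K l₁)) * z +
      (algebraMap ℂ K c ^ 2 * t ^ 2 * k * algebraMap ℂ K l₁ - algebraMap ℂ K l₂) = 0) :
    (2 * algebraMap ℂ K c ^ 2 * t * (k * ((z - 1) * (z - algebraMap ℂ K l₁)))) • wedge t k =
      (-(2 * (algebraMap ℂ K c ^ 2 * t ^ 2 * k - k ^ 2) * z + k * ((1 + algebraMap ℂ K l₂) -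
        algebraMap ℂ K c ^ 2 * t ^ 2 * (1 + algebraMap ℂ K l₁)))) • wedge z k := by
  have h' := congrArg (fun α => wedgeB α (D ℂ K k)) (congrArg (D ℂ K) h)
  simp only [map_add, map_sub, Derivation.leibniz, Derivation.leibniz_pow,
    Derivation.map_algebraMap, Derivation.map_one_eq_zero, map_zero, LinearMap.add_apply,
    LinearMap.sub_apply, LinearMap.zero_apply, map_smul, map_nsmul, LinearMap.smul_apply,
    wedgeB_self, smul_zero, add_zero, zero_add, sub_zero, ← wedge_eq, Nat.add_one_sub_one,
    pow_one] at h'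
  linear_combination (norm := module) h'

/-- The fibration with parameter `y₂ x₁ / (y₁ x₂)`. -/
theorem exists_isJ1 {l₁ l₂ : ℂ} (h₁ : l₁ ≠ 0) (h₁' : l₁ ≠ 1) (h₂ : l₂ ≠ 0) (h₂' : l₂ ≠ 1)
    {x₁ x₂ w : K} (hind : AlgebraicIndependent ℂ ![x₁, x₂])
    (hw : w ^ 2 = x₁ * (x₁ - 1) * (x₁ - algebraMap ℂ _ l₁) *
      (x₂ * (x₂ - 1) * (x₂ - algebraMap ℂ _ l₂)))
    (hgen : IntermediateField.adjoin ℂ {x₁, x₂, w} = ⊤) :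
    ∃ (c : ℂ) (t x y : K), IsJ1 l₁ l₂ t x y ∧ c ^ 2 * (l₁ - 1) = l₂ - 1 ∧
      algebraMap ℂ K c * t = x₁ * w / (x₁ * (x₁ - 1) * (x₁ - algebraMap ℂ _ l₁) * x₂) ∧
      w ≠ 0 ∧ weierstrassForm t x y = (-(2 : K)⁻¹) • w⁻¹ • wedge x₁ x₂ := by
  have := charZero_of_complex K
  have hl₁ : l₁ - 1 ≠ 0 := sub_ne_zero.mpr h₁'
  have hl₂ : l₂ - 1 ≠ 0 := sub_ne_zero.mpr h₂'
  obtain ⟨c, hc⟩ := IsAlgClosed.exists_pow_nat_eq ((l₂ - 1) / (l₁ - 1)) (n := 2) two_pos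
  have hc' : c ^ 2 * (l₁ - 1) = l₂ - 1 := by rw [hc]; field_simp
  have hc0 : c ≠ 0 := by
    rintro rfl
    apply hl₂
    rw [← hc']
    ring
  set L₁ := algebraMap ℂ K l₁ with hL₁
  set L₂ := algebraMap ℂ K l₂ with hL₂
  set C := algebraMap ℂ K c with hC
  have hC0 : C ≠ 0 := by simpa [hC] using hc0
  have hL₁0 : L₁ ≠ 0 := by simpa [hL₁] using h₁
  have hCC : C ^ 2 * (L₁ - 1) = L₂ - 1 := by
    simp only [hC, hL₁, hL₂, ← map_pow, ← map_one (algebraMap ℂ K), ← map_sub, ← map_mul, hc']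
  have hx₁ : x₁ ≠ 0 := by
    simpa using aeval_ne_zero_of_eval_ne_zero hind (.X 0) 1 1 (by simp)
  have hx₂ : x₂ ≠ 0 := by
    simpa using aeval_ne_zero_of_eval_ne_zero hind (.X 1) 1 1 (by simp)
  have hx₁1 : x₁ - 1 ≠ 0 := by
    simpa using aeval_ne_zero_of_eval_ne_zero hind (.X 0 - 1) 2 1 (by norm_num)
  have hx₁l : x₁ - L₁ ≠ 0 := by
    simpa using aeval_ne_zero_of_eval_ne_zero hind (.X 0 - .C l₁) (l₁ + 1) 1 (by simp)
  have hx₂1 : x₂ - 1 ≠ 0 := by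
    simpa using aeval_ne_zero_of_eval_ne_zero hind (.X 1 - 1) 2 2 (by norm_num)
  have hx₂l : x₂ - L₂ ≠ 0 := by
    simpa using aeval_ne_zero_of_eval_ne_zero hind (.X 1 - .C l₂) 1 (l₂ + 1) (by simp)
  -- After clearing denominators, `hne₁` says that the leading coefficient of the quadratic in `x₁`
  -- is nonzero, and `hne₂` that its derivative `d` is.
  have hne₁ : (x₂ - 1) * (x₂ - L₂) * x₁ ^ 2 - (x₁ - 1) * (x₁ - L₁) * x₂ ^ 2 ≠ 0 := by
    have h := aeval_ne_zero_of_eval_ne_zero hind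
      ((.X 1 - 1) * (.X 1 - .C l₂) * .X 0 ^ 2 - (.X 0 - 1) * (.X 0 - .C l₁) * .X 1 ^ 2) 1 0
      (by simpa using h₂)
    simpa only [map_sub, map_mul, map_add, map_pow, map_one, MvPolynomial.aeval_X,
      MvPolynomial.aeval_C, Matrix.cons_val_zero, Matrix.cons_val_one] using h
  have hne₂ : x₁ * (2 * x₁ - (1 + L₁)) * ((x₂ - 1) * (x₂ - L₂)) -
      x₂ * (2 * x₂ - (1 + L₂)) * ((x₁ - 1) * (x₁ - L₁)) ≠ 0 := by
    have h := aeval_ne_zero_of_eval_ne_zero hind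
      (.X 0 * (.C 2 * .X 0 - (1 + .C l₁)) * ((.X 1 - 1) * (.X 1 - .C l₂)) -
        .X 1 * (.C 2 * .X 1 - (1 + .C l₂)) * ((.X 0 - 1) * (.X 0 - .C l₁))) 1 0
      (by
        simp only [map_sub, map_mul, map_add, MvPolynomial.eval_X, MvPolynomial.eval_C, map_one,
          Matrix.cons_val_zero, Matrix.cons_val_one]
        have : l₂ * (l₁ - 1) ≠ 0 := mul_ne_zero h₂ hl₁
        intro h
        apply this
        linear_combination -h)
    simpa only [map_sub, map_mul, map_add, map_pow, map_one, map_ofNat, MvPolynomial.aeval_X,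
      MvPolynomial.aeval_C, Matrix.cons_val_zero, Matrix.cons_val_one] using h
  have hw0 : w ≠ 0 := by
    rintro rfl
    have : x₁ * (x₁ - 1) * (x₁ - L₁) * (x₂ * (x₂ - 1) * (x₂ - L₂)) ≠ 0 :=
      mul_ne_zero (mul_ne_zero (mul_ne_zero hx₁ hx₁1) hx₁l) (mul_ne_zero (mul_ne_zero hx₂ hx₂1) hx₂l)
    exact this (by rw [← hw]; ring)
  set t := x₁ * w / (x₁ * (x₁ - 1) * (x₁ - L₁) * x₂) / C with ht
  set k := x₂ / x₁ with hk
  have hCt : C * t = x₁ * w / (x₁ * (x₁ - 1) * (x₁ - L₁) * x₂) := by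
    rw [ht]; field_simp
  have hk0 : k ≠ 0 := div_ne_zero hx₂ hx₁
  have ht0 : t ≠ 0 := by
    have : C * t ≠ 0 := by
      rw [hCt]
      exact div_ne_zero (mul_ne_zero hx₁ hw0)
        (mul_ne_zero (mul_ne_zero (mul_ne_zero hx₁ hx₁1) hx₁l) hx₂)
    exact right_ne_zero_of_mul this
  have hxk : x₂ = k * x₁ := by rw [hk]; field_simp
  have hwk : w = C * t * k * (x₁ * (x₁ - 1) * (x₁ - L₁)) := by
    rw [hCt, hk]; field_simp
  have hrel : C ^ 2 * t ^ 2 * (k * ((x₁ - 1) * (x₁ - L₁))) = (x₂ - 1) * (x₂ - L₂) := by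
    rw [hwk] at hw
    have h0 : k * x₁ ^ 2 * ((x₁ - 1) * (x₁ - L₁)) ≠ 0 :=
      mul_ne_zero (mul_ne_zero hk0 (pow_ne_zero 2 hx₁)) (mul_ne_zero hx₁1 hx₁l)
    apply mul_left_cancel₀ h0
    linear_combination hw + x₁ * (x₁ - 1) * (x₁ - L₁) * ((x₂ - 1) * (x₂ - L₂)) * hxk
  set T := C ^ 2 * t ^ 2 with hT
  -- `d` is the derivative of the quadratic at its root `x₁`, so `d²` is the discriminant. As `x₁`
  -- is rational in `t`, `k` and `d`, these three functions generate the field.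
  set d := 2 * (T * k - k ^ 2) * x₁ + k * ((1 + L₂) - T * (1 + L₁)) with hd
  have hquad : (T * k - k ^ 2) * x₁ ^ 2 + ((1 + L₂) * k - T * k * (1 + L₁)) * x₁ +
      (T * k * L₁ - L₂) = 0 := by
    rw [hxk] at hrel
    linear_combination hrel
  have hTk : T * k - k ^ 2 ≠ 0 := by
    intro h
    apply hne₁
    rw [← hrel, hxk]
    linear_combination (x₁ ^ 2 * ((x₁ - 1) * (x₁ - L₁))) * h
  have hd0 : d ≠ 0 := by
    intro h
    apply hne₂
    rw [← hrel, hxk]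
    linear_combination (x₁ * ((x₁ - 1) * (x₁ - L₁))) * h
  have hdd : d ^ 2 = k * (4 * T * L₁ * k ^ 2 + k * (((1 + L₂) - T * (1 + L₁)) ^ 2 -
      4 * T ^ 2 * L₁ - 4 * L₂) + 4 * T * L₂) := by
    rw [hd]
    linear_combination 4 * (T * k - k ^ 2) * hquad
  set x := 4 * L₁ * t ^ 2 * k with hx
  set y := 4 * L₁ * t ^ 2 * d / C with hy
  have hA : t ^ 2 * linearTerm l₁ l₂ (t ^ 2 + (t ^ 2)⁻¹) =
      (L₁ - 1) * (L₂ - 1) * (t ^ 4 + 1) - 2 * (L₁ + 1) * (L₂ + 1) * t ^ 2 := by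
    simp only [linearTerm, map_mul, map_sub, map_add, map_one, map_ofNat, ← hL₁, ← hL₂]
    field_simp
  have hB : algebraMap ℂ K (16 * l₁ * l₂) = 16 * L₁ * L₂ := by
    simp only [map_mul, map_ofNat, ← hL₁, ← hL₂]
  have heq : y ^ 2 = x ^ 3 + t ^ 2 * linearTerm l₁ l₂ (t ^ 2 + (t ^ 2)⁻¹) * x ^ 2 +
      algebraMap ℂ K (16 * l₁ * l₂) * t ^ 4 * x := by
    rw [hA, hB]
    have hCy : C * y = 4 * L₁ * t ^ 2 * d := by rw [hy]; field_simp
    apply mul_left_cancel₀ (pow_ne_zero 2 hC0)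
    have e1 : C ^ 2 * y ^ 2 = 16 * L₁ ^ 2 * t ^ 4 * d ^ 2 := by
      rw [← mul_pow, hCy]; ring
    rw [e1, hdd, hx, hT]
    -- This is where `c² (l₁ - 1) = l₂ - 1` enters: it makes the coefficients of `1` and `t⁴` both
    -- equal to `c² (l₁ - 1)(l₂ - 1)`.
    have e2 : ((1 + L₂) - C ^ 2 * t ^ 2 * (1 + L₁)) ^ 2 - 4 * (C ^ 2 * t ^ 2) ^ 2 * L₁ - 4 * L₂ =
        C ^ 2 * ((L₁ - 1) * (L₂ - 1) * (t ^ 4 + 1) - 2 * (L₁ + 1) * (L₂ + 1) * t ^ 2) := by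
      linear_combination (C ^ 2 * (L₁ - 1) * t ^ 4 - (L₂ - 1)) * hCC
    rw [e2]
    ring
  have hgen' : IntermediateField.adjoin ℂ {t, x, y} = ⊤ := by
    set E := IntermediateField.adjoin ℂ {t, x, y} with hE
    have m0 : ∀ z : ℂ, algebraMap ℂ K z ∈ E := fun z => E.algebraMap_mem z
    have mt : t ∈ E := IntermediateField.subset_adjoin _ _ (by simp)
    have mx : x ∈ E := IntermediateField.subset_adjoin _ _ (by simp)
    have my : y ∈ E := IntermediateField.subset_adjoin _ _ (by simp)
    have mL₁ : L₁ ∈ E := m0 _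
    have mL₂ : L₂ ∈ E := m0 _
    have mC : C ∈ E := m0 _
    have m1 : (1 : K) ∈ E := one_mem E
    have m2 : (2 : K) ∈ E := ofNat_mem E 2
    have m4 : (4 : K) ∈ E := ofNat_mem E 4
    have mu : 4 * L₁ * t ^ 2 ∈ E := mul_mem (mul_mem m4 mL₁) (pow_mem mt 2)
    have mT : T ∈ E := mul_mem (pow_mem mC 2) (pow_mem mt 2)
    have mk : k ∈ E := by
      have : k = x / (4 * L₁ * t ^ 2) := by rw [hx]; field_simp
      rw [this]
      exact div_mem mx mu
    have md : d ∈ E := by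
      have : d = y * C / (4 * L₁ * t ^ 2) := by rw [hy]; field_simp
      rw [this]
      exact div_mem (mul_mem my mC) mu
    have mx₁ : x₁ ∈ E := by
      have : x₁ = (d - k * ((1 + L₂) - T * (1 + L₁))) / (2 * (T * k - k ^ 2)) := by
        rw [eq_div_iff (mul_ne_zero two_ne_zero hTk), hd]; ring
      rw [this]
      exact div_mem (sub_mem md (mul_mem mk (sub_mem (add_mem m1 mL₂)
        (mul_mem mT (add_mem m1 mL₁))))) (mul_mem m2 (sub_mem (mul_mem mT mk) (pow_mem mk 2)))
    have mx₂ : x₂ ∈ E := hxk ▸ mul_mem mk mx₁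
    have mw : w ∈ E := by
      rw [hwk]
      exact mul_mem (mul_mem (mul_mem mC mt) mk)
        (mul_mem (mul_mem mx₁ (sub_mem mx₁ m1)) (sub_mem mx₁ mL₁))
    rw [eq_top_iff, ← hgen, IntermediateField.adjoin_le_iff]
    rintro z (rfl | rfl | rfl)
    exacts [mx₁, mx₂, mw]
  have hwmem : w ^ 2 ∈ IntermediateField.adjoin ℂ {x₁, x₂} := by
    rw [hw]
    have m₁ : x₁ ∈ IntermediateField.adjoin ℂ {x₁, x₂} :=
      IntermediateField.subset_adjoin _ _ (by simp)
    have m₂ : x₂ ∈ IntermediateField.adjoin ℂ {x₁, x₂} :=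
      IntermediateField.subset_adjoin _ _ (by simp)
    have m0 : ∀ z : ℂ, algebraMap ℂ K z ∈ IntermediateField.adjoin ℂ {x₁, x₂} :=
      fun z => IntermediateField.algebraMap_mem _ z
    exact mul_mem (mul_mem (mul_mem m₁ (sub_mem m₁ (one_mem _))) (sub_mem m₁ (m0 _)))
      (mul_mem (mul_mem m₂ (sub_mem m₂ (one_mem _))) (sub_mem m₂ (m0 _)))
  have htr := trdeg_eq_two hind (isAlgebraic_of_generate hgen hwmem)
  refine ⟨c, t, x, y, (isJ1_iff ht0).mpr (isWeierstrassSurface_of_trdeg htr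
    (by rw [heq, aeval_coeffJ1 ht0, aeval_coeffQuartic]) hgen'), hc', hCt, hw0, ?_⟩
  have hf1 : wedge t x = (4 * L₁ * t ^ 2) • wedge t k := by
    rw [hx, hL₁, ← map_ofNat (algebraMap ℂ K) 4, ← map_mul]
    exact wedge_mul_sq _ _ _
  have hf2 : wedge x₁ x₂ = x₁ • wedge x₁ k := by
    rw [wedge_eq, wedge_eq, hxk, Derivation.leibniz, map_add, map_smul, map_smul, wedgeB_self,
      smul_zero, zero_add]
  have hf3 : (2 * C ^ 2 * t * (k * ((x₁ - 1) * (x₁ - L₁)))) • wedge t k = (-d) • wedge x₁ k :=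
    smul_wedge_of_quadratic hquad
  have hu : 2 * C ^ 2 * t * (k * ((x₁ - 1) * (x₁ - L₁))) ≠ 0 :=
    mul_ne_zero (mul_ne_zero (mul_ne_zero two_ne_zero (pow_ne_zero 2 hC0)) ht0)
      (mul_ne_zero hk0 (mul_ne_zero hx₁1 hx₁l))
  have hf4 : wedge t k = ((2 * C ^ 2 * t * (k * ((x₁ - 1) * (x₁ - L₁))))⁻¹ * -d) • wedge x₁ k := by
    rw [mul_smul, ← hf3, inv_smul_smul₀ hu]
  rw [weierstrassForm, hf1, hf2, hf4, smul_smul, smul_smul, smul_smul, smul_smul, hy, hwk]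
  congr 1
  field_simp

/-- Again the differential of the relation is wedged, with `dq`, so that only `dt` and `dv`
contribute. -/
lemma smul_wedge_of_relation {m n p : ℂ} {t q v : K}
    (h : algebraMap ℂ K m * q * (v ^ 2 - 4) * t ^ 2 =
      4 * (q ^ 2 + (algebraMap ℂ K m * v - algebraMap ℂ K n) * q + algebraMap ℂ K p)) :
    (2 * (algebraMap ℂ K m * q * (v ^ 2 - 4) * t)) • wedge t q =
      (4 * (algebraMap ℂ K m * q) - 2 * (algebraMap ℂ K m * q * v * t ^ 2)) • wedge v q := by
  have h4 : (4 : K) = algebraMap ℂ K 4 := (map_ofNat _ 4).symm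
  rw [h4] at h
  have h' := congrArg (fun α => wedgeB α (D ℂ K q)) (congrArg (D ℂ K) h)
  simp only [map_add, map_sub, Derivation.leibniz, Derivation.leibniz_pow,
    Derivation.map_algebraMap, LinearMap.add_apply, map_smul, map_nsmul, LinearMap.smul_apply,
    wedgeB_self, smul_zero, add_zero, zero_add, sub_zero, ← wedge_eq, Nat.add_one_sub_one,
    pow_one] at h'
  rw [← h4] at h'
  linear_combination (norm := module) h'

/-- The second fibration. -/
theorem exists_isJ7 {l₁ l₂ : ℂ} (h₁ : l₁ ≠ 0) (h₁' : l₁ ≠ 1) (h₂ : l₂ ≠ 0) (h₂' : l₂ ≠ 1)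
    {t x y : K} (h : IsJ1 l₁ l₂ t x y) :
    ∃ v ξ η : K, IsJ7 l₁ l₂ v ξ η ∧ weierstrassForm v ξ η = weierstrassForm t x y := by
  have := charZero_of_complex K
  have ht0 := ne_zero_left h.independent
  have hx0 := ne_zero_right h.independent
  rw [isJ1_iff ht0] at h
  have hy0 := h.y_ne_zero (coeffQuartic_ne_zero h₁ h₂)
  have htr := h.trdeg_eq_two
  have heq := h.equation
  set m := (l₁ - 1) * (l₂ - 1) with hm
  set n := 2 * (l₁ + 1) * (l₂ + 1) with hn
  set p := 16 * l₁ * l₂ with hp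
  have hm0 : m ≠ 0 := mul_ne_zero (sub_ne_zero.mpr h₁') (sub_ne_zero.mpr h₂')
  obtain ⟨μ, hμ⟩ := IsAlgClosed.exists_pow_nat_eq m (n := 2) two_pos
  have hμ0 : μ ≠ 0 := by rintro rfl; exact hm0 (by rw [← hμ]; simp)
  have hcoeff : Polynomial.aeval t (coeffJ1 l₁ l₂) =
      algebraMap ℂ K m * (t ^ 4 + 1) - algebraMap ℂ K n * t ^ 2 := by
    rw [coeffJ1, ← hm, ← hn]
    simp only [map_sub, map_mul, map_add, map_pow, map_one, Polynomial.aeval_X, Polynomial.aeval_C]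
  rw [hcoeff, aeval_coeffQuartic, ← hp] at heq
  set M := algebraMap ℂ K m with hM
  set N := algebraMap ℂ K n with hN
  set P := algebraMap ℂ K p with hP
  set U := algebraMap ℂ K μ with hU
  have hUM : U ^ 2 = M := by rw [hU, hM, ← map_pow, hμ]
  have hU0 : U ≠ 0 := by simpa [hU] using hμ0
  have hM0 : M ≠ 0 := by simpa [hM] using hm0
  set q := x / t ^ 2 with hq
  -- Divided by `x²`, the equation reads `(y/x)² = M t⁴ + M + t²(q - N + P/q)`. Putting `2y/(Ux) = v
  -- t² - 2` with `U² = M` cancels the constant term, and division by `t²` leaves `hrel`, which is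
  -- linear in `t²`.
  set v := 2 * (1 + y / (U * x)) / t ^ 2 with hv
  have hq0 : q ≠ 0 := div_ne_zero hx0 (pow_ne_zero 2 ht0)
  have hxq : x = q * t ^ 2 := by rw [hq]; field_simp
  have hyv : 2 * y = U * q * t ^ 2 * (v * t ^ 2 - 2) := by
    rw [hv, hq]; field_simp; ring
  have hrel : M * q * (v ^ 2 - 4) * t ^ 2 = 4 * (q ^ 2 + (M * v - N) * q + P) := by
    apply mul_left_cancel₀ (mul_ne_zero hq0 (pow_ne_zero 6 ht0))
    have e := congrArg (· ^ 2) hyv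
    simp only [mul_pow, hUM, heq] at e
    rw [hxq] at e
    linear_combination -e
  have hv4 : v ^ 2 - 4 ≠ 0 := by
    intro h0
    -- For `v = ±2` the right side of `hrel` would vanish, a polynomial relation between the
    -- independent functions `t` and `x`.
    have hne : ∀ s : ℂ, x ^ 2 + algebraMap ℂ K s * t ^ 2 * x + P * t ^ 4 ≠ 0 := by
      intro s
      have h := aeval_ne_zero_of_eval_ne_zero h.independent
        (.X 1 ^ 2 + .C s * .X 0 ^ 2 * .X 1 + .C p * .X 0 ^ 4) 0 1 (by simp)
      simpa only [map_mul, map_add, map_pow, MvPolynomial.aeval_X,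
        MvPolynomial.aeval_C, Matrix.cons_val_zero, Matrix.cons_val_one] using h
    have h4 : (4 : K) * (q ^ 2 + (M * v - N) * q + P) = 0 := by rw [← hrel, h0]; ring
    have h5 : q ^ 2 + (M * v - N) * q + P = 0 := by
      simpa using h4
    have h6 : (v - 2) * (v + 2) = 0 := by linear_combination h0
    rcases mul_eq_zero.mp h6 with h7 | h7
    · refine hne (m * 2 - n) ?_
      rw [map_sub, map_mul, map_ofNat, hxq]
      linear_combination t ^ 4 * h5 - t ^ 4 * M * q * h7
    · refine hne (m * -2 - n) ?_
      rw [map_sub, map_mul, map_neg, map_ofNat, hxq]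
      linear_combination t ^ 4 * h5 - t ^ 4 * M * q * h7
  set ξ := (v ^ 2 - 4) * q with hξ
  -- Multiplying `hrel` by `(v² - 4)³ q` makes its left side the square of a multiple of `t`. The
  -- sign of `η` is the one for which the two-forms agree.
  set η := -((v ^ 2 - 4) ^ 2 * U * q * t / 2) with hη
  have hη0 : η ≠ 0 := neg_ne_zero.mpr (div_ne_zero (mul_ne_zero (mul_ne_zero (mul_ne_zero
    (pow_ne_zero 2 hv4) hU0) hq0) ht0) two_ne_zero)
  have heq' : η ^ 2 = ξ ^ 3 + (v ^ 2 - 4) * linearTerm l₁ l₂ v * ξ ^ 2 +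
      P * (v ^ 2 - 4) ^ 2 * ξ := by
    have e : (4 : K) * η ^ 2 = (v ^ 2 - 4) ^ 4 * M * q ^ 2 * t ^ 2 := by
      rw [hη, ← hUM]; ring
    apply mul_left_cancel₀ (by norm_num : (4 : K) ≠ 0)
    rw [e, linearTerm, ← hm, ← hn, ← hM, ← hN, hξ]
    linear_combination (v ^ 2 - 4) ^ 3 * q * hrel
  have hgen : IntermediateField.adjoin ℂ {v, ξ, η} = ⊤ := by
    set E := IntermediateField.adjoin ℂ {v, ξ, η}
    have mv : v ∈ E := IntermediateField.subset_adjoin _ _ (by simp)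
    have mξ : ξ ∈ E := IntermediateField.subset_adjoin _ _ (by simp)
    have mη : η ∈ E := IntermediateField.subset_adjoin _ _ (by simp)
    have mU : U ∈ E := E.algebraMap_mem μ
    have m2 : (2 : K) ∈ E := ofNat_mem E 2
    have md : v ^ 2 - 4 ∈ E := sub_mem (pow_mem mv 2) (ofNat_mem E 4)
    have mq : q ∈ E := by
      have : q = ξ / (v ^ 2 - 4) := by rw [hξ]; field_simp
      rw [this]
      exact div_mem mξ md
    have mt : t ∈ E := by
      have : t = -(2 * η) / ((v ^ 2 - 4) ^ 2 * U * q) := by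
        rw [eq_div_iff (mul_ne_zero (mul_ne_zero (pow_ne_zero 2 hv4) hU0) hq0), hη]; ring
      rw [this]
      exact div_mem (neg_mem (mul_mem m2 mη)) (mul_mem (mul_mem (pow_mem md 2) mU) mq)
    have mx : x ∈ E := hxq ▸ mul_mem mq (pow_mem mt 2)
    have my : y ∈ E := by
      have : y = U * q * t ^ 2 * (v * t ^ 2 - 2) / 2 := by rw [← hyv]; ring
      rw [this]
      exact div_mem (mul_mem (mul_mem (mul_mem mU mq) (pow_mem mt 2))
        (sub_mem (mul_mem mv (pow_mem mt 2)) m2)) m2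
    rw [eq_top_iff, ← h.generate, IntermediateField.adjoin_le_iff]
    rintro z (rfl | rfl | rfl)
    exacts [mt, mx, my]
  refine ⟨v, ξ, η, isJ7_iff.mpr (isWeierstrassSurface_of_trdeg htr
    (by rw [heq', aeval_coeffJ7, aeval_coeffJ7', hP, hp]) hgen), ?_⟩
  have hf1 : wedge t x = t ^ 2 • wedge t q := by
    have := wedge_mul_sq 1 t q
    rw [map_one, one_mul] at this
    rw [hxq, mul_comm, this]
  have hf2 : wedge v ξ = (v ^ 2 - 4) • wedge v q := by
    have h4 : (4 : K) = algebraMap ℂ K 4 := (map_ofNat _ 4).symm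
    rw [hξ, h4]
    simp only [wedge_eq, Derivation.leibniz, Derivation.leibniz_pow, Derivation.map_algebraMap,
      map_add, map_sub, map_smul, map_nsmul, wedgeB_self, smul_zero, add_zero, sub_zero]
  have hf3 := smul_wedge_of_relation hrel
  have hu : 2 * (M * q * (v ^ 2 - 4) * t) ≠ 0 :=
    mul_ne_zero two_ne_zero (mul_ne_zero (mul_ne_zero (mul_ne_zero hM0 hq0) hv4) ht0)
  have hf4 : wedge t q = ((2 * (M * q * (v ^ 2 - 4) * t))⁻¹ *
      (4 * (M * q) - 2 * (M * q * v * t ^ 2))) • wedge v q := by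
    rw [mul_smul, ← hf3, inv_smul_smul₀ hu]
  rw [weierstrassForm, weierstrassForm, hf1, hf2, hf4, smul_smul, smul_smul, smul_smul]
  congr 1
  have hvt : v * t ^ 2 - 2 ≠ 0 := by
    intro h0
    rw [h0, mul_zero] at hyv
    exact hy0 (by simpa using hyv)
  have hy' : y = U * q * t ^ 2 * (v * t ^ 2 - 2) / 2 := by rw [← hyv]; ring
  rw [hy', hη]
  field_simp
  ring

end

/-! ### The rational maps between the surfaces -/

section

variable {K L : Type} [Field K] [Algebra ℂ K] [Field L] [Algebra ℂ L]

/-- In a change of variables with factor `b ∈ ℂ(t)` the term with `db` is a multiple of `dt` and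
drops out of the wedge with `dt`. -/
lemma exists_D_eq_smul {t z : K} (hz : z ∈ IntermediateField.adjoin ℂ {t}) :
    ∃ g : K, D ℂ K z = g • D ℂ K t := by
  induction hz using IntermediateField.adjoin_induction with
  | mem z hz => exact ⟨1, by rw [Set.mem_singleton_iff.mp hz, one_smul]⟩
  | algebraMap c => exact ⟨0, by simp⟩
  | add z w _ _ hz hw =>
    obtain ⟨g, hg⟩ := hz
    obtain ⟨h, hh⟩ := hw
    exact ⟨g + h, by rw [map_add, hg, hh, add_smul]⟩
  | inv z _ hz =>
    obtain ⟨g, hg⟩ := hz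
    exact ⟨-z⁻¹ ^ 2 * g, by rw [Derivation.leibniz_inv, hg, smul_smul]⟩
  | mul z w _ _ hz hw =>
    obtain ⟨g, hg⟩ := hz
    obtain ⟨h, hh⟩ := hw
    exact ⟨z * h + w * g, by rw [Derivation.leibniz, hg, hh, smul_smul, smul_smul, add_smul]⟩

lemma formPullback_weierstrassForm (σ : K →ₐ[ℂ] L) (t x y : K) :
    formPullback σ (weierstrassForm t x y) = weierstrassForm (σ t) (σ x) (σ y) := by
  rw [weierstrassForm, formPullback_smul_wedge, map_inv₀, weierstrassForm]

/-- A change of variables `(t, x, y) ↦ (a(t), b(t) x, r y)` multiplies the two-form by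
`a' b / r`. -/
lemma weierstrassForm_change {t x y a b r g : K} (ha : D ℂ K a = g • D ℂ K t)
    (hb : b ∈ IntermediateField.adjoin ℂ {t}) :
    weierstrassForm a (b * x) (r * y) = (g * b / r) • weierstrassForm t x y := by
  obtain ⟨h, hh⟩ := exists_D_eq_smul hb
  rw [weierstrassForm, weierstrassForm, wedge_eq, wedge_eq, Derivation.leibniz, hh, ha]
  simp only [map_add, map_smul, LinearMap.smul_apply, wedgeB_self, smul_zero, add_zero, smul_smul]
  congr 1
  rw [mul_inv]
  ring

/-- The independence of two functions over which the generators are algebraic. -/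
lemma algebraicIndependent_of_gens {t x y t' x' : K} (htr : Algebra.trdeg ℂ K = 2)
    (hgen : IntermediateField.adjoin ℂ {t, x, y} = ⊤)
    (ht : t ∈ algebraicClosure (IntermediateField.adjoin ℂ {t', x'}) K)
    (hx : x ∈ algebraicClosure (IntermediateField.adjoin ℂ {t', x'}) K)
    (hy : y ∈ algebraicClosure (IntermediateField.adjoin ℂ {t', x'}) K) :
    AlgebraicIndependent ℂ ![t', x'] :=
  algebraicIndependent_of_isAlgebraic htr (isAlgebraic_of_gens hgen
    (mem_algebraicClosure_iff.mp ht) (mem_algebraicClosure_iff.mp hx)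
    (mem_algebraicClosure_iff.mp hy))

lemma left_mem_algebraicClosure (t x : K) :
    t ∈ algebraicClosure (IntermediateField.adjoin ℂ {t, x}) K :=
  mem_algebraicClosure_iff.mpr
    (isAlgebraic_of_mem (IntermediateField.subset_adjoin _ _ (by simp)))

lemma right_mem_algebraicClosure (t x : K) :
    x ∈ algebraicClosure (IntermediateField.adjoin ℂ {t, x}) K :=
  mem_algebraicClosure_iff.mpr
    (isAlgebraic_of_mem (IntermediateField.subset_adjoin _ _ (by simp)))

lemma mem_algebraicClosure_of_sq {E : IntermediateField ℂ K} {z : K}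
    (hz : z ^ 2 ∈ algebraicClosure E K) : z ∈ algebraicClosure E K :=
  mem_algebraicClosure_iff.mpr ((mem_algebraicClosure_iff.mp hz).of_pow two_pos)

lemma mem_algebraicClosure_of_equation {t x y : K} {A B : Polynomial ℂ}
    (h : y ^ 2 = x ^ 3 + Polynomial.aeval t A * x ^ 2 + Polynomial.aeval t B * x) :
    y ∈ algebraicClosure (IntermediateField.adjoin ℂ {t, x}) K :=
  mem_algebraicClosure_iff.mpr (isAlgebraic_of_sq_mem (sq_mem_adjoin_of_equation h))

variable {l₁ l₂ : ℂ}

lemma aeval_coeffJ1' (t : K) : Polynomial.aeval t (coeffJ1 l₁ l₂) =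
    algebraMap ℂ K ((l₁ - 1) * (l₂ - 1)) * (t ^ 4 + 1) -
      algebraMap ℂ K (2 * (l₁ + 1) * (l₂ + 1)) * t ^ 2 := by
  simp only [coeffJ1, map_sub (Polynomial.aeval (R := ℂ) t), map_mul (Polynomial.aeval (R := ℂ) t),
    map_add (Polynomial.aeval (R := ℂ) t), map_pow, map_one (Polynomial.aeval (R := ℂ) t),
    Polynomial.aeval_X, Polynomial.aeval_C]

lemma aeval_coeffB12' (t : K) : Polynomial.aeval t (coeffB12 l₁ l₂) =
    algebraMap ℂ K ((l₁ - 1) * (l₂ - 1)) * (t ^ 3 + t) -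
      algebraMap ℂ K (2 * (l₁ + 1) * (l₂ + 1)) * t ^ 2 := by
  simp only [coeffB12, map_sub (Polynomial.aeval (R := ℂ) t),
    map_mul (Polynomial.aeval (R := ℂ) t), map_add (Polynomial.aeval (R := ℂ) t), map_pow,
    Polynomial.aeval_X, Polynomial.aeval_C]

/-- The involution `(t, x, y) ↦ (-t, x, -y)`. -/
lemma exists_involution_neg (h₁ : l₁ ≠ 0) (h₂ : l₂ ≠ 0) {t x y : K} (h : IsJ1 l₁ l₂ t x y) :
    ∃ σ : K →ₐ[ℂ] K, σ t = -t ∧ σ x = x ∧ σ y = -y := by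
  have ht0 := ne_zero_left h.independent
  rw [isJ1_iff ht0] at h
  have he : (-y) ^ 2 = x ^ 3 + Polynomial.aeval (-t) (coeffJ1 l₁ l₂) * x ^ 2 +
      Polynomial.aeval (-t) (coeffQuartic l₁ l₂) * x := by
    have := h.equation
    rw [aeval_coeffJ1', aeval_coeffQuartic] at this ⊢
    linear_combination this
  refine h.exists_algHom (coeffQuartic_ne_zero h₁ h₂) ?_ he
  refine algebraicIndependent_of_gens h.trdeg_eq_two h.generate ?_
    (right_mem_algebraicClosure _ _) ?_
  · simpa using neg_mem (left_mem_algebraicClosure (-t) x)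
  · simpa using neg_mem (mem_algebraicClosure_of_equation he)

/-- The involution `(t, x, y) ↦ (1/t, x/t⁴, -y/t⁶)` of a Weierstrass equation with suitable
coefficients. -/
lemma exists_involution_inv (h₁ : l₁ ≠ 0) (h₂ : l₂ ≠ 0) {t x y : K} {A : Polynomial ℂ}
    (h : IsWeierstrassSurface t x y (Polynomial.aeval t A)
      (Polynomial.aeval t (coeffQuartic l₁ l₂)))
    (hA : Polynomial.aeval (1 / t) A = Polynomial.aeval t A / t ^ 4) :
    ∃ σ : K →ₐ[ℂ] K, σ t = 1 / t ∧ σ x = x / t ^ 4 ∧ σ y = -(y / t ^ 6) := by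
  have ht0 := ne_zero_left h.independent
  have he : (-(y / t ^ 6)) ^ 2 = (x / t ^ 4) ^ 3 + Polynomial.aeval (1 / t) A * (x / t ^ 4) ^ 2 +
      Polynomial.aeval (1 / t) (coeffQuartic l₁ l₂) * (x / t ^ 4) := by
    have := h.equation
    rw [hA]
    rw [aeval_coeffQuartic] at this ⊢
    rw [neg_sq, div_pow, this]
    field_simp
  refine h.exists_algHom (coeffQuartic_ne_zero h₁ h₂) ?_ he
  have mt : t ∈ algebraicClosure (IntermediateField.adjoin ℂ {1 / t, x / t ^ 4}) K := by
    simpa using inv_mem (left_mem_algebraicClosure (1 / t) (x / t ^ 4))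
  refine algebraicIndependent_of_gens h.trdeg_eq_two h.generate mt ?_ ?_
  · have := mul_mem (right_mem_algebraicClosure (1 / t) (x / t ^ 4)) (pow_mem mt 4)
    rwa [div_mul_cancel₀ _ (pow_ne_zero 4 ht0)] at this
  · have : y = -(-(y / t ^ 6)) * t ^ 6 := by field_simp
    rw [this]
    exact mul_mem (neg_mem (mem_algebraicClosure_of_equation he)) (pow_mem mt 6)

lemma aeval_coeffJ1_inv {t : K} (ht : t ≠ 0) : Polynomial.aeval (1 / t) (coeffJ1 l₁ l₂) =
    Polynomial.aeval t (coeffJ1 l₁ l₂) / t ^ 4 := by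
  rw [aeval_coeffJ1', aeval_coeffJ1']
  field_simp
  ring

lemma aeval_coeffB12_inv {t : K} (ht : t ≠ 0) : Polynomial.aeval (1 / t) (coeffB12 l₁ l₂) =
    Polynomial.aeval t (coeffB12 l₁ l₂) / t ^ 4 := by
  rw [aeval_coeffB12', aeval_coeffB12']
  field_simp
  ring

/-- The comorphism `(u, X, Y) ↦ (t², t² x, t³ y)`. -/
lemma exists_comorphism_sq (h₁ : l₁ ≠ 0) (h₂ : l₂ ≠ 0) {u X Y : L} (hu : IsB12 l₁ l₂ u X Y)
    {t x y : K} (h : IsJ1 l₁ l₂ t x y) :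
    ∃ σ : L →ₐ[ℂ] K, σ u = t ^ 2 ∧ σ X = t ^ 2 * x ∧ σ Y = t ^ 3 * y := by
  have ht0 := ne_zero_left h.independent
  rw [isJ1_iff ht0] at h
  rw [isB12_iff (ne_zero_left hu.independent)] at hu
  have he : (t ^ 3 * y) ^ 2 = (t ^ 2 * x) ^ 3 + Polynomial.aeval (t ^ 2) (coeffB12 l₁ l₂) *
      (t ^ 2 * x) ^ 2 + Polynomial.aeval (t ^ 2) (coeffQuartic l₁ l₂) * (t ^ 2 * x) := by
    have := h.equation
    rw [aeval_coeffJ1', aeval_coeffQuartic] at this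
    rw [aeval_coeffB12', aeval_coeffQuartic]
    linear_combination t ^ 6 * this
  refine hu.exists_algHom (coeffQuartic_ne_zero h₁ h₂) ?_ he
  have mt : t ∈ algebraicClosure (IntermediateField.adjoin ℂ {t ^ 2, t ^ 2 * x}) K :=
    mem_algebraicClosure_of_sq (left_mem_algebraicClosure _ _)
  refine algebraicIndependent_of_gens h.trdeg_eq_two h.generate mt ?_ ?_
  · have := div_mem (right_mem_algebraicClosure (t ^ 2) (t ^ 2 * x)) (pow_mem mt 2)
    rwa [mul_div_cancel_left₀ _ (pow_ne_zero 2 ht0)] at this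
  · have : y = t ^ 3 * y / t ^ 3 := by field_simp
    rw [this]
    exact div_mem (mem_algebraicClosure_of_equation he) (pow_mem mt 3)

lemma sq_sub_one_ne_zero {u X : L} (h : AlgebraicIndependent ℂ ![u, X]) : u ^ 2 - 1 ≠ 0 := by
  have h := aeval_ne_zero_of_eval_ne_zero h (.X 0 ^ 2 - 1) 0 0 (by simp)
  simpa only [map_sub, map_pow, map_one, MvPolynomial.aeval_X, Matrix.cons_val_zero] using h

/-- The comorphism `(v, ξ, η) ↦ (u + 1/u, (u² - 1)² X / u⁴, (u² - 1)³ Y / u⁶)`. -/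
lemma exists_comorphism_add_inv (h₁ : l₁ ≠ 0) (h₂ : l₂ ≠ 0) {u X Y : L} (hu : IsB12 l₁ l₂ u X Y)
    {v ξ η : K} (h : IsJ7 l₁ l₂ v ξ η) :
    ∃ σ : K →ₐ[ℂ] L, σ v = u + u⁻¹ ∧ σ ξ = (u ^ 2 - 1) ^ 2 / u ^ 4 * X ∧
      σ η = (u ^ 2 - 1) ^ 3 / u ^ 6 * Y := by
  have := charZero_of_complex L
  have hu0 := ne_zero_left hu.independent
  have hu1 := sq_sub_one_ne_zero hu.independent
  rw [isB12_iff hu0] at hu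
  rw [isJ7_iff] at h
  have he : ((u ^ 2 - 1) ^ 3 / u ^ 6 * Y) ^ 2 = ((u ^ 2 - 1) ^ 2 / u ^ 4 * X) ^ 3 +
      Polynomial.aeval (u + u⁻¹) (coeffJ7 l₁ l₂) * ((u ^ 2 - 1) ^ 2 / u ^ 4 * X) ^ 2 +
      Polynomial.aeval (u + u⁻¹) (coeffJ7' l₁ l₂) * ((u ^ 2 - 1) ^ 2 / u ^ 4 * X) := by
    have e := hu.equation
    rw [aeval_coeffB12 hu0, aeval_coeffQuartic] at e
    rw [aeval_coeffJ7, aeval_coeffJ7', mul_pow, e]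
    generalize linearTerm l₁ l₂ (u + u⁻¹) = ℓ
    have hv : (u + u⁻¹) ^ 2 - 4 = (u ^ 2 - 1) ^ 2 / u ^ 2 := by field_simp; ring
    rw [hv]
    field_simp
  refine h.exists_algHom (coeffJ7'_ne_zero h₁ h₂) ?_ he
  set a := u + u⁻¹ with ha
  set b := (u ^ 2 - 1) ^ 2 / u ^ 4 * X with hb
  have mE : ∀ k : ℕ, [k.AtLeastTwo] → (OfNat.ofNat k : L) ∈
    algebraicClosure (IntermediateField.adjoin ℂ {a, b}) L := fun k _ => ofNat_mem _ k
  -- `u` is recovered from `a = u + 1/u` by the square root `u - 1/u` of `a² - 4`.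
  have ms : u - u⁻¹ ∈ algebraicClosure (IntermediateField.adjoin ℂ {a, b}) L := by
    apply mem_algebraicClosure_of_sq
    have : (u - u⁻¹) ^ 2 = a ^ 2 - 4 := by rw [ha]; field_simp; ring
    rw [this]
    exact sub_mem (pow_mem (left_mem_algebraicClosure _ _) 2) (mE 4)
  have mu : u ∈ algebraicClosure (IntermediateField.adjoin ℂ {a, b}) L := by
    have : u = (a + (u - u⁻¹)) / 2 := by rw [ha]; ring
    rw [this]
    exact div_mem (add_mem (left_mem_algebraicClosure _ _) ms) (mE 2)
  have mu1 := sub_mem (pow_mem mu 2)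
    (one_mem (algebraicClosure (IntermediateField.adjoin ℂ {a, b}) L))
  refine algebraicIndependent_of_gens hu.trdeg_eq_two hu.generate mu ?_ ?_
  · have : X = b / ((u ^ 2 - 1) ^ 2 / u ^ 4) := by rw [hb]; field_simp
    rw [this]
    exact div_mem (right_mem_algebraicClosure _ _) (div_mem (pow_mem mu1 2) (pow_mem mu 4))
  · have : Y = (u ^ 2 - 1) ^ 3 / u ^ 6 * Y / ((u ^ 2 - 1) ^ 3 / u ^ 6) := by field_simp
    rw [this]
    exact div_mem (mem_algebraicClosure_of_equation he) (div_mem (pow_mem mu1 3) (pow_mem mu 6))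

end

/-! ### Effect of the maps on two-forms, and their images as fixed fields -/

section

variable {K L : Type} [Field K] [Algebra ℂ K] [Field L] [Algebra ℂ L]

lemma weierstrassForm_neg (t x y : K) : weierstrassForm (-t) x (-y) = weierstrassForm t x y := by
  have h := weierstrassForm_change (x := x) (y := y) (a := -t) (r := -1) (g := -1)
    (show D ℂ K (-t) = (-1 : K) • D ℂ K t by rw [map_neg, neg_one_smul])
    (one_mem (IntermediateField.adjoin ℂ {t}))
  simpa using h

lemma weierstrassForm_inv {t : K} (ht : t ≠ 0) (x y : K) :
    weierstrassForm (1 / t) (x / t ^ 4) (-(y / t ^ 6)) = weierstrassForm t x y := by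
  have h := weierstrassForm_change (x := x) (y := y) (a := 1 / t) (r := -(t ^ 6)⁻¹)
    (g := -t⁻¹ ^ 2) (show D ℂ K (1 / t) = _ by rw [one_div, Derivation.leibniz_inv])
    (inv_mem (pow_mem (IntermediateField.mem_adjoin_simple_self ℂ t) 4))
  rw [div_eq_inv_mul x, div_eq_inv_mul y, ← neg_mul, h]
  convert one_smul K _ using 2
  field_simp

lemma weierstrassForm_sq {t : K} (ht : t ≠ 0) (x y : K) :
    weierstrassForm (t ^ 2) (t ^ 2 * x) (t ^ 3 * y) = (2 : K) • weierstrassForm t x y := by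
  rw [weierstrassForm_change (g := 2 * t) (show D ℂ K (t ^ 2) = _ by
      rw [Derivation.leibniz_pow]; simp only [Nat.add_one_sub_one, pow_one]; module)
    (pow_mem (IntermediateField.mem_adjoin_simple_self ℂ t) 2)]
  congr 1
  field_simp

lemma weierstrassForm_add_inv {u : K} (hu : u ≠ 0) (hu1 : u ^ 2 - 1 ≠ 0) (x y : K) :
    weierstrassForm (u + u⁻¹) ((u ^ 2 - 1) ^ 2 / u ^ 4 * x) ((u ^ 2 - 1) ^ 3 / u ^ 6 * y) =
      weierstrassForm u x y := by
  have m := IntermediateField.mem_adjoin_simple_self ℂ u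
  rw [weierstrassForm_change (g := 1 - u⁻¹ ^ 2) (show D ℂ K (u + u⁻¹) = _ by
      rw [map_add, Derivation.leibniz_inv]; module)
    (div_mem (pow_mem (sub_mem (pow_mem m 2) (one_mem _)) 2) (pow_mem m 4))]
  convert one_smul K _ using 2
  field_simp

variable {l₁ l₂ : ℂ}

/-- The image of the comorphism of the first map is the field of invariants. -/
lemma range_comorphism_sq {u X Y : L} {t x y : K} (h : IsJ1 l₁ l₂ t x y)
    (hu : IsB12 l₁ l₂ u X Y) {ψ : L →ₐ[ℂ] K} (ψu : ψ u = t ^ 2) (ψX : ψ X = t ^ 2 * x)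
    (ψY : ψ Y = t ^ 3 * y) {i : K →ₐ[ℂ] K} (it : i t = -t) (ix : i x = x) (iy : i y = -y) :
    (∀ f, f ∈ Set.range ψ ↔ i f = f) ∧ degree ψ = 2 := by
  have ht0 := ne_zero_left h.independent
  refine mem_range_iff_and_degree_eq_two ψ i ht0 ⟨u, ψu⟩ ?_ it h.generate ?_
  · refine algHom_ext_of_generate hu.generate ?_ ?_ ?_
    · simp [ψu, it]
    · simp [ψX, it, ix]
    · simp [ψY, it, iy]
      ring
  · intro M hM mt
    refine ⟨mt, ?_, ?_⟩
    · have := div_mem (hM X) (pow_mem mt 2)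
      rwa [ψX, mul_div_cancel_left₀ _ (pow_ne_zero 2 ht0)] at this
    · have := div_mem (hM Y) (pow_mem mt 3)
      rwa [ψY, mul_div_cancel_left₀ _ (pow_ne_zero 3 ht0)] at this

/-- The image of the comorphism of the second map is the field of invariants. -/
lemma range_comorphism_add_inv {u X Y : L} {v ξ η : K} (h : IsJ7 l₁ l₂ v ξ η)
    (hu : IsB12 l₁ l₂ u X Y) {φ : K →ₐ[ℂ] L} (φv : φ v = u + u⁻¹)
    (φξ : φ ξ = (u ^ 2 - 1) ^ 2 / u ^ 4 * X) (φη : φ η = (u ^ 2 - 1) ^ 3 / u ^ 6 * Y)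
    {τ : L →ₐ[ℂ] L} (τu : τ u = 1 / u) (τX : τ X = X / u ^ 4) (τY : τ Y = -(Y / u ^ 6)) :
    (∀ f, f ∈ Set.range φ ↔ τ f = f) ∧ degree φ = 2 := by
  have := charZero_of_complex L
  have hu0 := ne_zero_left hu.independent
  have hu1 := sq_sub_one_ne_zero hu.independent
  have hs : u - u⁻¹ = (u ^ 2 - 1) / u := by field_simp
  refine mem_range_iff_and_degree_eq_two φ τ (s := u - u⁻¹) (by rw [hs]; exact div_ne_zero hu1 hu0)
    ⟨v ^ 2 - 4, ?_⟩ ?_ ?_ hu.generate ?_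
  · rw [map_sub, map_pow, φv, map_ofNat]
    field_simp
    ring
  · refine algHom_ext_of_generate h.generate ?_ ?_ ?_
    · simp [φv, τu]
      ring
    · simp only [AlgHom.comp_apply, φξ, map_mul, map_div₀, map_pow, map_sub, map_one, τu, τX]
      field_simp
      ring
    · simp only [AlgHom.comp_apply, φη, map_mul, map_div₀, map_pow, map_sub, map_one, τu, τY]
      field_simp
      ring
  · rw [map_sub, map_inv₀, τu]
    simp
  · intro M hM ms
    have mu : u ∈ M := by
      have : u = (φ v + (u - u⁻¹)) / 2 := by rw [φv]; ring
      rw [this]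
      exact div_mem (add_mem (hM v) ms) (ofNat_mem M 2)
    have mu1 := sub_mem (pow_mem mu 2) (one_mem M)
    refine ⟨mu, ?_, ?_⟩
    · have : X = φ ξ / ((u ^ 2 - 1) ^ 2 / u ^ 4) := by rw [φξ]; field_simp
      rw [this]
      exact div_mem (hM ξ) (div_mem (pow_mem mu1 2) (pow_mem mu 4))
    · have : Y = φ η / ((u ^ 2 - 1) ^ 3 / u ^ 6) := by rw [φη]; field_simp
      rw [this]
      exact div_mem (hM η) (div_mem (pow_mem mu1 3) (pow_mem mu 6))

end

end KummerSandwich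

end

/-! ### The theorem -/

theorem mainTheorem4 (l₁ l₂ : ℂ) (h₁ : l₁ ≠ 0) (h₁' : l₁ ≠ 1) (h₂ : l₂ ≠ 0) (h₂' : l₂ ≠ 1)
    -- the Kummer surface `S` of `E₁ × E₂`
    (S : Scheme.{0}) [S.Over SpecC] [IsIntegral S] (hS : IsK3Surface S)
    (κ : S.PartialIso (kummerQuotient l₁ l₂))
    (hκ : κ.IsOver (S ↘ SpecC) (kummerQuotient l₁ l₂ ↘ SpecC))
    -- the surface `Y`, with its Weierstrass coordinates
    (Y : Scheme.{0}) [Y.Over SpecC] [IsIntegral Y] (hY : IsComplexVariety Y)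
    (u X y₁ : Y.functionField) (hu : IsB12 l₁ l₂ u X y₁) :
    ∃ (c : ℂ) (t x y v ξ η : S.functionField) (i j : AutC S)
      (iPull jPull : S.functionField →ₐ[ℂ] S.functionField)
      (ψ : S ⤏ Y) (ψPull : Y.functionField →ₐ[ℂ] S.functionField)
      (φ : Y ⤏ S) (φPull : S.functionField →ₐ[ℂ] Y.functionField),
      -- the fibration `𝒥₁` on `S`, whose parameter is `y₂ x₁ / (y₁ x₂)` up to scaling
      (IsJ1 l₁ l₂ t x y ∧ c ^ 2 * (l₁ - 1) = l₂ - 1 ∧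
        algebraMap ℂ S.functionField c * t = kummerParameter κ) ∧
      -- the second Weierstrass equation of `S`, with the same two-form
      (IsJ7 l₁ l₂ v ξ η ∧ weierstrassForm v ξ η = weierstrassForm t x y) ∧
      -- the two-forms of the Weierstrass equations span the holomorphic two-forms
      (∀ ω, ω ∈ holomorphicTwoForms S ↔
        ∃ a : ℂ, ω = algebraMap ℂ S.functionField a • weierstrassForm t x y) ∧
      (IsK3Surface Y → ∀ ω, ω ∈ holomorphicTwoForms Y ↔
        ∃ a : ℂ, ω = algebraMap ℂ Y.functionField a • weierstrassForm u X y₁) ∧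
      -- the commuting Nikulin involutions
      (IsNikulinInvolution i ∧ IsComorphism (autHom i).toRationalMap iPull ∧
        iPull t = -t ∧ iPull x = x ∧ iPull y = -y) ∧
      (IsNikulinInvolution j ∧ IsComorphism (autHom j).toRationalMap jPull ∧
        jPull t = 1 / t ∧ jPull x = x / t ^ 4 ∧ jPull y = -(y / t ^ 6)) ∧
      i * j = j * i ∧
      -- the quotient surfaces
      QuotientBirationalTo S Y (Subgroup.closure {i}) ∧
      QuotientBirationalTo S S (Subgroup.closure {i, j}) ∧
      -- the rational map `ψ` of degree two
      (IsComorphism ψ ψPull ∧ degree ψPull = 2 ∧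
        (∀ f, f ∈ Set.range ψPull ↔ iPull f = f) ∧
        ψPull u = t ^ 2 ∧ ψPull X = t ^ 2 * x ∧ ψPull y₁ = t ^ 3 * y ∧
        formPullback ψPull (weierstrassForm u X y₁) = (2 : S.functionField) • weierstrassForm t x y) ∧
      -- the rational map `φ` of degree two
      (IsComorphism φ φPull ∧ degree φPull = 2 ∧
        (∀ f, f ∈ Set.range (ψPull.comp φPull) ↔ iPull f = f ∧ jPull f = f) ∧
        φPull v = u + u⁻¹ ∧ φPull ξ = (u ^ 2 - 1) ^ 2 / u ^ 4 * X ∧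
        φPull η = (u ^ 2 - 1) ^ 3 / u ^ 6 * y₁ ∧
        formPullback φPull (weierstrassForm t x y) = weierstrassForm u X y₁) := by
  have := hS.isProper
  have := hY.isSeparated
  have := hY.locallyOfFiniteType
  obtain ⟨x₁, x₂, w, hind, hw, hgen, hpar⟩ := exists_kummer_coordinates κ hκ
  obtain ⟨c, t, x, y, hJ1, hc, hct, hw0, hform⟩ := exists_isJ1 h₁ h₁' h₂ h₂' hind hw hgen
  obtain ⟨v, ξ, η, hJ7, hform7⟩ := exists_isJ7 h₁ h₁' h₂ h₂' hJ1
  have ht0 := ne_zero_left hJ1.independent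
  have hu0 := ne_zero_left hu.independent
  have hJ1' := (isJ1_iff ht0).mp hJ1
  have hu' := (isB12_iff hu0).mp hu
  have hB := coeffQuartic_ne_zero h₁ h₂
  have hreg : ∀ V : Subalgebra ℂ S.functionField, (∀ x, x ∈ V ∨ x⁻¹ ∈ V) →
      weierstrassForm t x y ∈ formsOf V := by
    intro V hV
    rw [hform]
    have h2 := V.algebraMap_mem (2 : ℂ)⁻¹
    rw [map_inv₀, map_ofNat] at h2
    exact smul_mem_formsOf (neg_mem h2)
      (inv_smul_wedge_mem_formsOf_legendre hV h₁ h₁' h₂ h₂' hw hw0)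
  have h0 := hJ1'.form_ne_zero hB
  have htr := hJ1'.trdeg_eq_two.le
  obtain ⟨iPull, it, ix, iy⟩ := exists_involution_neg h₁ h₂ hJ1
  obtain ⟨jPull, jt, jx, jy⟩ := exists_involution_inv h₁ h₂ hJ1' (aeval_coeffJ1_inv ht0)
  obtain ⟨τ, τu, τX, τy⟩ := exists_involution_inv h₁ h₂ hu' (aeval_coeffB12_inv hu0)
  obtain ⟨ψPull, ψu, ψX, ψy⟩ := exists_comorphism_sq h₁ h₂ hu hJ1
  obtain ⟨φPull, φv, φξ, φη⟩ := exists_comorphism_add_inv h₁ h₂ hu hJ7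
  obtain ⟨hψ, hψdeg⟩ := range_comorphism_sq hJ1 hu ψu ψX ψy it ix iy
  obtain ⟨hφ, hφdeg⟩ := range_comorphism_add_inv hJ7 hu φv φξ φη τu τX τy
  have hφform : formPullback φPull (weierstrassForm t x y) = weierstrassForm u X y₁ := by
    rw [← hform7, formPullback_weierstrassForm, φv, φξ, φη,
      weierstrassForm_add_inv hu0 (sq_sub_one_ne_zero hu.independent)]
  -- Every valuation ring of ℂ(Y) restricts along `φ^*` to one of ℂ(S), where the form is regular,
  -- and pullback preserves regularity. No model of `𝒴` is involved.
  have hregY : ∀ V : Subalgebra ℂ Y.functionField, (∀ x, x ∈ V ∨ x⁻¹ ∈ V) →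
      weierstrassForm u X y₁ ∈ formsOf V := by
    intro V hV
    rw [← hφform]
    refine formPullback_mem_formsOf φPull (R := V.comap φPull) (fun a ha => ha)
      (hreg _ fun z => ?_)
    simpa using hV (φPull z)
  obtain ⟨i, hi, hiPull⟩ := exists_isNikulinInvolution hS htr h0 hreg (σ := iPull)
    (fun z => by
      have : iPull.comp iPull = AlgHom.id ℂ _ := algHom_ext_of_generate hJ1.generate
        (by simp [it]) (by simp [ix]) (by simp [iy])
      exact congr($this z))
    (fun h => by
      have := charZero_of_complex S.functionField
      rw [h] at it
      exact ht0 (self_eq_neg.mp it))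
    (by rw [← weierstrassForm, formPullback_weierstrassForm, it, ix, iy, weierstrassForm_neg])
  obtain ⟨j, hj, hjPull⟩ := exists_isNikulinInvolution hS htr h0 hreg (σ := jPull)
    (fun z => by
      have : jPull.comp jPull = AlgHom.id ℂ _ := by
        refine algHom_ext_of_generate hJ1.generate (by simp [jt]) ?_ ?_
        · simp only [AlgHom.comp_apply, jx, map_div₀, map_pow, jt, AlgHom.id_apply]
          field_simp
        · simp only [AlgHom.comp_apply, jy, map_neg, map_div₀, map_pow, jt, AlgHom.id_apply]
          field_simp
      exact congr($this z))
    (fun h => by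
      rw [h] at jt
      have h1 := sq_sub_one_ne_zero hJ1.independent
      apply h1
      have h2 : t = 1 / t := jt
      field_simp at h2
      linear_combination h2)
    (by rw [← weierstrassForm, formPullback_weierstrassForm, jt, jx, jy, weierstrassForm_inv ht0])
  have hcomm : iPull.comp jPull = jPull.comp iPull := by
    refine algHom_ext_of_generate hJ1.generate ?_ ?_ ?_
    · simp only [AlgHom.comp_apply, jt, it, map_div₀, map_neg, map_one]
      ring
    · simp only [AlgHom.comp_apply, jx, it, ix, map_div₀, map_pow]
      ring
    · simp only [AlgHom.comp_apply, jy, it, iy, map_div₀, map_pow, map_neg]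
      ring
  -- The involution `j` descends along `ψ` to `τ`, `(u, X, Y) ↦ (1/u, X/u⁴, -Y/u⁶)`, whose
  -- invariants are the image of `φ^*`. So functions invariant under `i` and `j` are those from `𝒴`
  -- that `τ` fixes.
  have hjψ : jPull.comp ψPull = ψPull.comp τ := by
    refine algHom_ext_of_generate hu.generate ?_ ?_ ?_
    · simp [ψu, τu, jt]
    · simp only [AlgHom.comp_apply, ψX, τX, ψu, jt, jx, map_mul, map_div₀, map_pow]
      field_simp
    · simp only [AlgHom.comp_apply, ψy, τy, ψu, jt, jy, map_mul, map_div₀, map_pow, map_neg]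
      field_simp
  have hψφ : ∀ f, f ∈ Set.range (ψPull.comp φPull) ↔ iPull f = f ∧ jPull f = f := by
    intro f
    constructor
    · rintro ⟨g, rfl⟩
      refine ⟨(hψ _).mp ⟨_, rfl⟩, ?_⟩
      have h1 := congr($hjψ (φPull g))
      have h2 := (hφ _).mp ⟨g, rfl⟩
      simp only [AlgHom.comp_apply] at h1 ⊢
      rw [h1, h2]
    · rintro ⟨hfi, hfj⟩
      obtain ⟨g, rfl⟩ := (hψ f).mpr hfi
      have h1 := congr($hjψ g)
      simp only [AlgHom.comp_apply] at h1
      rw [hfj] at h1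
      obtain ⟨e, rfl⟩ := (hφ g).mpr (ψPull.toRingHom.injective h1).symm
      exact ⟨e, rfl⟩
  obtain ⟨ψ, hψcom⟩ := exists_isComorphism ψPull
  obtain ⟨φ, hφcom⟩ := exists_isComorphism φPull
  refine ⟨c, t, x, y, v, ξ, η, i, j, iPull, jPull, ψ, ψPull, φ, φPull,
    ⟨hJ1, hc, hct.trans hpar.symm⟩, ⟨hJ7, hform7⟩, mem_holomorphicTwoForms_iff hS h0 hreg,
    fun hYK3 => mem_holomorphicTwoForms_iff hYK3 (hu'.form_ne_zero hB) hregY,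
    ⟨hi, hiPull, it, ix, iy⟩, ⟨hj, hjPull, jt, jx, jy⟩, ?_, ?_, ?_,
    ⟨hψcom, hψdeg, hψ, ψu, ψX, ψy, ?_⟩, ⟨hφcom, hφdeg, hψφ, φv, φξ, φη, hφform⟩⟩
  · exact autC_ext (isComorphism_mul hiPull hjPull) (hcomm ▸ isComorphism_mul hjPull hiPull)
  · obtain ⟨hG, hGf⟩ := invariant_closure_iff (s := {i}) (by rintro _ rfl; exact hi.mul_self)
      (fun _ => iPull) (by rintro _ rfl; exact hiPull)
    exact quotientBirationalTo_of_range hG ψPull fun f => by rw [hψ, hGf]; simp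
  · classical
    have hpull : ∀ g ∈ ({i, j} : Set (AutC S)), IsComorphism (autHom g).toRationalMap
        (if g = i then iPull else jPull) := by
      rintro g (rfl | rfl)
      · rwa [if_pos rfl]
      · split_ifs with hg
        · rwa [hg]
        · exact hjPull
    obtain ⟨hG, hGf⟩ := invariant_closure_iff
      (by rintro _ (rfl | rfl); exacts [hi.mul_self, hj.mul_self]) _ hpull
    refine quotientBirationalTo_of_range hG (ψPull.comp φPull) fun f => ?_
    rw [hψφ, hGf]
    -- The case `j = i` need not be excluded, since equal automorphisms have equal comorphisms.
    have hij : (if j = i then iPull else jPull) = jPull := by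
      split_ifs with hg
      · exact isComorphism_unique (hg ▸ hiPull) hjPull
      · rfl
    simp [hij]
  · rw [formPullback_weierstrassForm, ψu, ψX, ψy, weierstrassForm_sq ht0]
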